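/- For $\Omega\in\{\mathbb{R}_+,\mathbb{R}\}$, $\mathbb{R}_+=(0,\infty)$, let $X(\Omega)$ be one of the following Banach spaces of (classes of) Lebesgue measurable functions $f:\Omega\to\mathbb{C}$. (a) The Lorentz space $L^{p,q}(\Omega)$, $1<p,q<\infty$, with the norm $\|f\|=\big(\int_0^\infty (t^{1/p}f^{**}(t))^q\,\frac{dt}{t}\big)^{1/q}$, where $f^{**}(t)=\frac1t\int_0^t f^*(s)\,ds$ and $f^*(t)=\inf\{\lambda\ge0: |\{x\in\Omega:|f(x)|>\lambda\}|\le t\}$. (b) A reflexive Orlicz space $L^\Phi(\Omega)$ with the Luxemburg norm $\|f\|=\inf\{\lambda>0:\int_\Omega\Phi(|f(x)|/\lambda)\,dx\le1\}$, where $\Phi(x)=\int_0^x\phi(t)\,dt$ and $\phi:[0,\infty)\to[0,\infty]$ is nondecreasing and left-continuous with $\phi(0)=0$, $\lim_{t\to\infty}\phi(t)=\infty$, and $\phi$ is not identically $\infty$ on $(0,\infty)$. (c) The variable Lebesgue space $L^{p(\cdot)}(\Omega)$ with the norm $\|f\|=\inf\{\lambda>0:\int_\Omega|f(x)/\lambda|^{p(x)}\,dx\le1\}$,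 where $p(\cdot):\mathbb{R}\to[1,\infty)$ is measurable, $1<\operatorname{ess\,inf}p\le\operatorname{ess\,sup}p<\infty$, and the Hardy–Littlewood maximal operator $(Mf)(x)=\sup_{I\ni x}\frac1{|I|}\int_I|f(t)|\,dt$ (supremum over bounded intervals $I$ containing $x$) is bounded on $L^{p(\cdot)}(\mathbb{R})$. Let $F$ be the Fourier transform on $L^2(\mathbb{R})$, $(Ff)(\xi)=\int_{\mathbb{R}}f(x)e^{i\xi x}\,dx$ for $f\in L^1(\mathbb{R})\cap L^2(\mathbb{R})$. A function $a\in L^\infty(\mathbb{R})$ is a Fourier multiplier on $X(\mathbb{R})$ if $f\mapsto F^{-1}(a\cdot Ff)$ maps $L^2(\mathbb{R})\cap X(\mathbb{R})$ into $X(\mathbb{R})$ and extends to a bounded linear operator $W^0(a)$ on $X(\mathbb{R})$; the Wiener–Hopf operator with symbol $a$ is then $W(a)=r_+W^0(a)\ell_+$ on $X(\mathbb{R}_+)$, where $r_+:X(\mathbb{R})\to X(\mathbb{R}_+)$ is restriction and $\ell_+:X(\mathbb{R}_+)\to X(\mathbb{R})$ is extension by zero. Theorem. For every $n\in\mathbb{Z}$,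 the function $r_n(\xi)=\big(\frac{\xi-i}{\xi+i}\big)^n$, $\xi\in\mathbb{R}$, is a Fourier multiplier on $X(\mathbb{R})$, and the Wiener–Hopf operator $W(r_n)$ is Fredholm on $X(\mathbb{R}_+)$ with index $\dim\operatorname{Ker}W(r_n)-\dim X(\mathbb{R}_+)/\operatorname{Im}W(r_n)=-n$. -/

import Mathlib

open MeasureTheory Set Filter Topology
open scoped ENNReal NNReal FourierTransform

noncomputable section

namespace WienerHopf

/-! ### Function norms and the spaces they generate -/

/-- A function norm over the measure `μ`, given on nonnegative functions (the moduli of the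
elements of the space). -/
structure FunctionNorm (μ : Measure ℝ) where
  toFun : (ℝ → ℝ≥0∞) → ℝ≥0∞
  mono : ∀ {g h : ℝ → ℝ≥0∞}, g ≤ᵐ[μ] h → toFun g ≤ toFun h
  zero : toFun (fun _ => 0) = 0
  add_le : ∀ {g h : ℝ → ℝ≥0∞}, AEMeasurable g μ → AEMeasurable h μ →
    toFun (fun x => g x + h x) ≤ toFun g + toFun h
  smul_le : ∀ (c : ℝ≥0), c ≠ 0 → ∀ g : ℝ → ℝ≥0∞, toFun (fun x => c * g x) ≤ c * toFun g
  eq_zero : ∀ {g : ℝ → ℝ≥0∞}, AEMeasurable g μ → toFun g = 0 → g =ᵐ[μ] fun _ => 0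

namespace FunctionNorm

variable {μ : Measure ℝ}

theorem congr (ρ : FunctionNorm μ) {g h : ℝ → ℝ≥0∞} (hgh : g =ᵐ[μ] h) :
    ρ.toFun g = ρ.toFun h :=
  le_antisymm (ρ.mono hgh.le) (ρ.mono hgh.symm.le)

/-- The norm of a class of complex-valued measurable functions, possibly infinite. -/
def eval (ρ : FunctionNorm μ) (f : ℝ →ₘ[μ] ℂ) : ℝ≥0∞ := ρ.toFun fun x => ‖f x‖ₑ

theorem eval_zero (ρ : FunctionNorm μ) : ρ.eval 0 = 0 := by
  rw [← ρ.zero]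
  refine ρ.congr ?_
  filter_upwards [AEEqFun.coeFn_zero (μ := μ) (β := ℂ)] with x hx
  simp [hx]

theorem aemeasurable_enorm (f : ℝ →ₘ[μ] ℂ) : AEMeasurable (fun x => ‖f x‖ₑ) μ :=
  f.aestronglyMeasurable.enorm

theorem eval_add_le (ρ : FunctionNorm μ) (f g : ℝ →ₘ[μ] ℂ) :
    ρ.eval (f + g) ≤ ρ.eval f + ρ.eval g := by
  refine le_trans (ρ.mono ?_) (ρ.add_le (aemeasurable_enorm f) (aemeasurable_enorm g))
  filter_upwards [AEEqFun.coeFn_add f g] with x hx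
  simp only [hx, Pi.add_apply]
  exact enorm_add_le _ _

theorem eval_smul_le (ρ : FunctionNorm μ) (c : ℂ) (f : ℝ →ₘ[μ] ℂ) :
    ρ.eval (c • f) ≤ ‖c‖ₑ * ρ.eval f := by
  by_cases hc : c = 0
  · have h0 : c • f = 0 := by
      refine AEEqFun.ext ?_
      filter_upwards [AEEqFun.coeFn_smul c f, AEEqFun.coeFn_zero (μ := μ) (β := ℂ)] with x hx hy
      rw [hx, hy, hc]
      simp
    rw [h0, eval_zero]
    exact zero_le
  · refine le_trans (ρ.mono ?_) (ρ.smul_le ‖c‖₊ (by simpa using hc) _)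
    filter_upwards [AEEqFun.coeFn_smul c f] with x hx
    simp only [hx, Pi.smul_apply, enorm_smul]
    exact le_of_eq rfl

theorem eval_neg (ρ : FunctionNorm μ) (f : ℝ →ₘ[μ] ℂ) : ρ.eval (-f) = ρ.eval f := by
  refine ρ.congr ?_
  filter_upwards [AEEqFun.coeFn_neg f] with x hx
  simp [hx]

theorem eq_zero_of_eval (ρ : FunctionNorm μ) {f : ℝ →ₘ[μ] ℂ} (hf : ρ.eval f = 0) : f = 0 := by
  refine AEEqFun.ext ?_
  filter_upwards [ρ.eq_zero (aemeasurable_enorm f) hf,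
    AEEqFun.coeFn_zero (μ := μ) (β := ℂ)] with x hx h0
  rw [h0]
  simpa using hx

/-- The function space of all (classes of) measurable functions of finite norm. -/
def space (ρ : FunctionNorm μ) : Submodule ℂ (ℝ →ₘ[μ] ℂ) where
  carrier := {f | ρ.eval f < ∞}
  add_mem' {f g} hf hg := lt_of_le_of_lt (ρ.eval_add_le f g) (ENNReal.add_lt_top.2 ⟨hf, hg⟩)
  zero_mem' := by simp [eval_zero]
  smul_mem' c f hf :=
    lt_of_le_of_lt (ρ.eval_smul_le c f) (ENNReal.mul_lt_top enorm_lt_top hf)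

instance (ρ : FunctionNorm μ) : NormedAddCommGroup ρ.space :=
  AddGroupNorm.toNormedAddCommGroup
    { toFun := fun f => (ρ.eval (f : ℝ →ₘ[μ] ℂ)).toReal
      map_zero' := by simp [eval_zero]
      add_le' := fun f g => by
        rw [← ENNReal.toReal_add f.2.ne g.2.ne]
        exact ENNReal.toReal_mono (ENNReal.add_ne_top.2 ⟨f.2.ne, g.2.ne⟩) (ρ.eval_add_le _ _)
      neg' := fun f => by
        simp [eval_neg]
      eq_zero_of_map_eq_zero' := fun f hf => by
        rcases (ENNReal.toReal_eq_zero_iff _).1 hf with h | h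
        · exact Subtype.ext (ρ.eq_zero_of_eval h)
        · exact absurd h f.2.ne }

theorem norm_def (ρ : FunctionNorm μ) (f : ρ.space) :
    ‖f‖ = (ρ.eval (f : ℝ →ₘ[μ] ℂ)).toReal := rfl

instance (ρ : FunctionNorm μ) : NormedSpace ℂ ρ.space where
  norm_smul_le c f := by
    have h := ENNReal.toReal_mono (ENNReal.mul_ne_top enorm_ne_top f.2.ne)
      (ρ.eval_smul_le c (f : ℝ →ₘ[μ] ℂ))
    rw [ENNReal.toReal_mul, toReal_enorm] at h
    exact h

end FunctionNorm

/-! ### Restriction to the half-line and extension by zero -/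

/-- Lebesgue measure on the half-line `ℝ₊ = (0, ∞)`. -/
abbrev halfVolume : Measure ℝ := volume.restrict (Ioi 0)

/-- Restriction of (classes of) functions from `ℝ` to `ℝ₊`. -/
def restrictFun (f : ℝ →ₘ[volume] ℂ) : ℝ →ₘ[halfVolume] ℂ :=
  AEEqFun.mk f f.aestronglyMeasurable.restrict

/-- Extension of (classes of) functions from `ℝ₊` to `ℝ` by zero. -/
def extendFun (f : ℝ →ₘ[halfVolume] ℂ) : ℝ →ₘ[volume] ℂ :=
  AEEqFun.mk ((Ioi 0).indicator f)
    ((aestronglyMeasurable_indicator_iff measurableSet_Ioi).2 f.aestronglyMeasurable)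

theorem coeFn_restrictFun (f : ℝ →ₘ[volume] ℂ) : restrictFun f =ᵐ[halfVolume] f :=
  AEEqFun.coeFn_mk _ _

theorem coeFn_extendFun (f : ℝ →ₘ[halfVolume] ℂ) :
    extendFun f =ᵐ[volume] (Ioi 0).indicator f :=
  AEEqFun.coeFn_mk _ _

/-- A function space considered both over `ℝ` and over `ℝ₊`: the two norms are compatible with
extension by zero. -/
structure SpacePair where
  line : FunctionNorm volume
  half : FunctionNorm halfVolume
  indicator_eq : ∀ g : ℝ → ℝ≥0∞, line.toFun ((Ioi 0).indicator g) = half.toFun g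

namespace SpacePair

theorem eval_extendFun (X : SpacePair) (f : ℝ →ₘ[halfVolume] ℂ) :
    X.line.eval (extendFun f) = X.half.eval f := by
  rw [FunctionNorm.eval, FunctionNorm.eval, ← X.indicator_eq]
  refine X.line.congr ?_
  filter_upwards [coeFn_extendFun f] with x hx
  rw [hx]
  by_cases h : x ∈ Ioi (0 : ℝ) <;> simp [indicator, h]

theorem eval_restrictFun_le (X : SpacePair) (f : ℝ →ₘ[volume] ℂ) :
    X.half.eval (restrictFun f) ≤ X.line.eval f := by
  have h : X.half.eval (restrictFun f) = X.half.toFun (fun x => ‖f x‖ₑ) := by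
    refine X.half.congr ?_
    filter_upwards [coeFn_restrictFun f] with x hx
    rw [hx]
  rw [h, ← X.indicator_eq]
  exact X.line.mono (Eventually.of_forall fun x => indicator_le_self' (by simp) x)

/-- The restriction operator `r₊ : X(ℝ) → X(ℝ₊)`. -/
def restrict (X : SpacePair) : X.line.space →L[ℂ] X.half.space :=
  LinearMap.mkContinuous
    { toFun := fun f => ⟨restrictFun f, lt_of_le_of_lt (X.eval_restrictFun_le _) f.2⟩
      map_add' := fun f g => by
        refine Subtype.ext (AEEqFun.ext ?_)
        change restrictFun ((f : ℝ →ₘ[volume] ℂ) + g) =ᵐ[halfVolume]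
          (restrictFun f + restrictFun g : ℝ →ₘ[halfVolume] ℂ)
        filter_upwards [coeFn_restrictFun ((f : ℝ →ₘ[volume] ℂ) + g),
          coeFn_restrictFun (f : ℝ →ₘ[volume] ℂ), coeFn_restrictFun (g : ℝ →ₘ[volume] ℂ),
          AEEqFun.coeFn_add (restrictFun (f : ℝ →ₘ[volume] ℂ)) (restrictFun g),
          ae_restrict_of_ae (AEEqFun.coeFn_add (f : ℝ →ₘ[volume] ℂ) g)] with x h1 h2 h3 h4 h5
        rw [h1, h4, h5, Pi.add_apply, Pi.add_apply, h2, h3]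
      map_smul' := fun c f => by
        refine Subtype.ext (AEEqFun.ext ?_)
        change restrictFun (c • (f : ℝ →ₘ[volume] ℂ)) =ᵐ[halfVolume]
          (c • restrictFun f : ℝ →ₘ[halfVolume] ℂ)
        filter_upwards [coeFn_restrictFun (c • (f : ℝ →ₘ[volume] ℂ)),
          coeFn_restrictFun (f : ℝ →ₘ[volume] ℂ),
          AEEqFun.coeFn_smul c (restrictFun (f : ℝ →ₘ[volume] ℂ)),
          ae_restrict_of_ae (AEEqFun.coeFn_smul c (f : ℝ →ₘ[volume] ℂ))] with x h1 h2 h3 h4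
        rw [h1, h3, h4, Pi.smul_apply, Pi.smul_apply, h2] }
    1 fun f => by
      rw [one_mul]
      exact ENNReal.toReal_mono f.2.ne (X.eval_restrictFun_le _)

/-- The zero extension operator `ℓ₊ : X(ℝ₊) → X(ℝ)`. -/
def extend (X : SpacePair) : X.half.space →L[ℂ] X.line.space :=
  LinearMap.mkContinuous
    { toFun := fun f => ⟨extendFun f, lt_of_eq_of_lt (X.eval_extendFun _) f.2⟩
      map_add' := fun f g => by
        refine Subtype.ext (AEEqFun.ext ?_)
        change extendFun ((f : ℝ →ₘ[halfVolume] ℂ) + g) =ᵐ[volume]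
          (extendFun f + extendFun g : ℝ →ₘ[volume] ℂ)
        filter_upwards [coeFn_extendFun ((f : ℝ →ₘ[halfVolume] ℂ) + g),
          coeFn_extendFun (f : ℝ →ₘ[halfVolume] ℂ), coeFn_extendFun (g : ℝ →ₘ[halfVolume] ℂ),
          AEEqFun.coeFn_add (extendFun (f : ℝ →ₘ[halfVolume] ℂ)) (extendFun g),
          (ae_restrict_iff' measurableSet_Ioi).1
            (AEEqFun.coeFn_add (f : ℝ →ₘ[halfVolume] ℂ) g)] with x h1 h2 h3 h4 h5
        rw [h1, h4, Pi.add_apply, h2, h3]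
        by_cases hx : x ∈ Ioi (0 : ℝ)
        · simp only [indicator_of_mem hx, h5 hx, Pi.add_apply]
        · simp only [indicator_of_notMem hx, add_zero]
      map_smul' := fun c f => by
        refine Subtype.ext (AEEqFun.ext ?_)
        change extendFun (c • (f : ℝ →ₘ[halfVolume] ℂ)) =ᵐ[volume]
          (c • extendFun f : ℝ →ₘ[volume] ℂ)
        filter_upwards [coeFn_extendFun (c • (f : ℝ →ₘ[halfVolume] ℂ)),
          coeFn_extendFun (f : ℝ →ₘ[halfVolume] ℂ),
          AEEqFun.coeFn_smul c (extendFun (f : ℝ →ₘ[halfVolume] ℂ)),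
          (ae_restrict_iff' measurableSet_Ioi).1
            (AEEqFun.coeFn_smul c (f : ℝ →ₘ[halfVolume] ℂ))] with x h1 h2 h3 h4
        rw [h1, h3, Pi.smul_apply, h2]
        by_cases hx : x ∈ Ioi (0 : ℝ)
        · simp only [indicator_of_mem hx, h4 hx, Pi.smul_apply]
        · simp only [indicator_of_notMem hx, smul_zero] }
    1 fun f => by
      rw [one_mul]
      exact ENNReal.toReal_mono f.2.ne (X.eval_extendFun _).le

end SpacePair

/-! ### Luxemburg norms -/

/-- The Luxemburg norm `inf {s > 0 : ∫ Ψ(x, g(x) / s) dμ(x) ≤ 1}`. -/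
def luxemburg (μ : Measure ℝ) (Ψ : ℝ → ℝ≥0∞ → ℝ≥0∞) (g : ℝ → ℝ≥0∞) : ℝ≥0∞ :=
  ⨅ (s : ℝ≥0) (_ : 0 < s) (_ : ∫⁻ x, Ψ x (g x / s) ∂μ ≤ 1), (s : ℝ≥0∞)

theorem luxemburg_le {μ : Measure ℝ} {Ψ : ℝ → ℝ≥0∞ → ℝ≥0∞} {g : ℝ → ℝ≥0∞} {s : ℝ≥0}
    (hs : 0 < s) (h : ∫⁻ x, Ψ x (g x / s) ∂μ ≤ 1) : luxemburg μ Ψ g ≤ s :=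
  iInf₂_le_of_le s hs (iInf_le _ h)

theorem exists_of_luxemburg_lt {μ : Measure ℝ} {Ψ : ℝ → ℝ≥0∞ → ℝ≥0∞} {g : ℝ → ℝ≥0∞}
    {t : ℝ≥0∞} (h : luxemburg μ Ψ g < t) :
    ∃ s : ℝ≥0, 0 < s ∧ ∫⁻ x, Ψ x (g x / s) ∂μ ≤ 1 ∧ (s : ℝ≥0∞) < t := by
  simp only [luxemburg, iInf_lt_iff] at h
  obtain ⟨s, hs, h1, h2⟩ := h
  exact ⟨s, hs, h1, h2⟩

/-- The properties of an integrand that make the Luxemburg functional a norm. -/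
structure IsYoungIntegrand (μ : Measure ℝ) (Ψ : ℝ → ℝ≥0∞ → ℝ≥0∞) : Prop where
  zero : ∀ x, Ψ x 0 = 0
  mono : ∀ x, Monotone (Ψ x)
  convex : ∀ x (a b s t : ℝ≥0∞), a + b = 1 → Ψ x (a * s + b * t) ≤ a * Ψ x s + b * Ψ x t
  unbounded : ∀ x s, s ≠ 0 → ∃ k : ℕ, Ψ x (k * s) ≠ 0
  aemeasurable : ∀ g : ℝ → ℝ≥0∞, AEMeasurable g μ → AEMeasurable (fun x => Ψ x (g x)) μ

namespace IsYoungIntegrand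

variable {μ : Measure ℝ} {Ψ : ℝ → ℝ≥0∞ → ℝ≥0∞}

theorem mul_le (h : IsYoungIntegrand μ Ψ) (x : ℝ) {a : ℝ≥0∞} (ha : a ≤ 1) (s : ℝ≥0∞) :
    Ψ x (a * s) ≤ a * Ψ x s := by
  have := h.convex x a (1 - a) s 0 (add_tsub_cancel_of_le ha)
  simpa [h.zero x] using this

theorem luxemburg_add_le (h : IsYoungIntegrand μ Ψ) {g g' : ℝ → ℝ≥0∞}
    (hg : AEMeasurable g μ) :
    luxemburg μ Ψ (fun x => g x + g' x) ≤ luxemburg μ Ψ g + luxemburg μ Ψ g' := by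
  refine ENNReal.le_of_forall_pos_le_add fun ε hε hfin => ?_
  obtain ⟨h1, h2⟩ := ENNReal.add_lt_top.1 hfin
  have hε2 : (0 : ℝ≥0∞) < ((ε / 2 : ℝ≥0) : ℝ≥0∞) := by
    exact_mod_cast half_pos hε
  obtain ⟨s, hs, hs1, hs2⟩ := exists_of_luxemburg_lt (ENNReal.lt_add_right h1.ne hε2.ne')
  obtain ⟨t, ht, ht1, ht2⟩ := exists_of_luxemburg_lt (ENNReal.lt_add_right h2.ne hε2.ne')
  have hst : 0 < s + t := add_pos hs ht
  have key : luxemburg μ Ψ (fun x => g x + g' x) ≤ ((s + t : ℝ≥0) : ℝ≥0∞) := by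
    refine luxemburg_le hst ?_
    set a : ℝ≥0 := s / (s + t) with ha
    set b : ℝ≥0 := t / (s + t) with hb
    have hab : (a : ℝ≥0∞) + b = 1 := by
      rw [← ENNReal.coe_add, ha, hb, ← add_div, div_self hst.ne', ENNReal.coe_one]
    have hpt : ∀ x, (g x + g' x) / ((s + t : ℝ≥0) : ℝ≥0∞)
        = a * (g x / s) + b * (g' x / t) := by
      intro x
      have e1 : (a : ℝ≥0∞) * (g x / s) = g x / ((s + t : ℝ≥0) : ℝ≥0∞) := by
        rw [ha, ENNReal.coe_div hst.ne', ENNReal.div_eq_inv_mul, ENNReal.div_eq_inv_mul,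
          ENNReal.div_eq_inv_mul, mul_assoc, ← mul_assoc (s : ℝ≥0∞),
          ENNReal.mul_inv_cancel (by exact_mod_cast hs.ne') ENNReal.coe_ne_top, one_mul]
      have e2 : (b : ℝ≥0∞) * (g' x / t) = g' x / ((s + t : ℝ≥0) : ℝ≥0∞) := by
        rw [hb, ENNReal.coe_div hst.ne', ENNReal.div_eq_inv_mul, ENNReal.div_eq_inv_mul,
          ENNReal.div_eq_inv_mul, mul_assoc, ← mul_assoc (t : ℝ≥0∞),
          ENNReal.mul_inv_cancel (by exact_mod_cast ht.ne') ENNReal.coe_ne_top, one_mul]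
      rw [e1, e2, ENNReal.add_div]
    calc ∫⁻ x, Ψ x ((g x + g' x) / ((s + t : ℝ≥0) : ℝ≥0∞)) ∂μ
        ≤ ∫⁻ x, (a * Ψ x (g x / s) + b * Ψ x (g' x / t)) ∂μ := by
          refine lintegral_mono fun x => ?_
          rw [hpt x]
          exact h.convex x _ _ _ _ hab
      _ = a * ∫⁻ x, Ψ x (g x / s) ∂μ + b * ∫⁻ x, Ψ x (g' x / t) ∂μ := by
          rw [lintegral_add_left' ((h.aemeasurable _ (hg.div_const _)).const_mul _),
            lintegral_const_mul' _ _ ENNReal.coe_ne_top,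
            lintegral_const_mul' _ _ ENNReal.coe_ne_top]
      _ ≤ a * 1 + b * 1 := by gcongr
      _ = 1 := by simpa using hab
  refine key.trans ?_
  calc ((s + t : ℝ≥0) : ℝ≥0∞) = s + t := ENNReal.coe_add _ _
    _ ≤ (luxemburg μ Ψ g + ((ε / 2 : ℝ≥0) : ℝ≥0∞))
        + (luxemburg μ Ψ g' + ((ε / 2 : ℝ≥0) : ℝ≥0∞)) := add_le_add hs2.le ht2.le
    _ = luxemburg μ Ψ g + luxemburg μ Ψ g' + (((ε / 2 : ℝ≥0) : ℝ≥0∞) + ((ε / 2 : ℝ≥0) : ℝ≥0∞)) :=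
        by abel
    _ = luxemburg μ Ψ g + luxemburg μ Ψ g' + ε := by
        rw [← ENNReal.coe_add, add_halves]

theorem luxemburg_smul_le (c : ℝ≥0) (hc : c ≠ 0) (g : ℝ → ℝ≥0∞) :
    luxemburg μ Ψ (fun x => c * g x) ≤ c * luxemburg μ Ψ g := by
  refine le_of_forall_gt fun t ht => ?_
  have hc0 : (c : ℝ≥0∞) ≠ 0 := by exact_mod_cast hc
  have h1 : luxemburg μ Ψ g < t / c := by
    rw [ENNReal.lt_div_iff_mul_lt (Or.inl hc0) (Or.inl ENNReal.coe_ne_top), mul_comm]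
    exact ht
  obtain ⟨s, hs, hs1, hs2⟩ := exists_of_luxemburg_lt h1
  have h2 : luxemburg μ Ψ (fun x => c * g x) ≤ ((c * s : ℝ≥0) : ℝ≥0∞) := by
    refine luxemburg_le (mul_pos (pos_iff_ne_zero.2 hc) hs) ?_
    convert hs1 using 4 with x
    rw [ENNReal.coe_mul, ENNReal.mul_div_mul_left _ _ hc0 ENNReal.coe_ne_top]
  refine h2.trans_lt ?_
  rw [ENNReal.lt_div_iff_mul_lt (Or.inl hc0) (Or.inl ENNReal.coe_ne_top), mul_comm] at hs2
  exact_mod_cast hs2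

theorem eq_zero_of_luxemburg (h : IsYoungIntegrand μ Ψ) {g : ℝ → ℝ≥0∞}
    (hg : AEMeasurable g μ) (h0 : luxemburg μ Ψ g = 0) : g =ᵐ[μ] fun _ => 0 := by
  have h1 : ∀ k : ℕ, ∫⁻ x, Ψ x (k * g x) ∂μ = 0 := by
    intro k
    refine le_antisymm (ENNReal.le_of_forall_pos_le_add fun ε hε _ => ?_) zero_le
    rw [zero_add]
    set a : ℝ≥0 := min ε 1 with ha
    have ha0 : 0 < a := lt_min hε one_pos
    have hk : (0 : ℝ≥0) < a / (k + 1) := div_pos ha0 (by positivity)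
    obtain ⟨s, hs, hs1, hs2⟩ := exists_of_luxemburg_lt
      (t := ((a / (k + 1) : ℝ≥0) : ℝ≥0∞)) (by rw [h0]; exact_mod_cast hk)
    have hs3 : (k : ℝ≥0) * s ≤ a := by
      have h5 : s < a / (k + 1) := by exact_mod_cast hs2
      rw [lt_div_iff₀ (by positivity)] at h5
      calc (k : ℝ≥0) * s ≤ s * (k + 1) := by
            rw [mul_comm]
            gcongr
            exact le_self_add
        _ ≤ a := h5.le
    have hpt : ∀ x, Ψ x (k * g x) ≤ a * Ψ x (g x / s) := by
      intro x
      refine le_trans (h.mono x ?_) (h.mul_le x (a := a) (by exact_mod_cast min_le_right _ _) _)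
      have hs0 : (s : ℝ≥0∞) ≠ 0 := by exact_mod_cast hs.ne'
      calc (k : ℝ≥0∞) * g x = (k * s) * (g x / s) := by
            rw [mul_assoc, ENNReal.mul_div_cancel hs0 ENNReal.coe_ne_top]
        _ ≤ a * (g x / s) := by
            gcongr
            exact_mod_cast hs3
    calc ∫⁻ x, Ψ x (k * g x) ∂μ ≤ ∫⁻ x, a * Ψ x (g x / s) ∂μ := lintegral_mono hpt
      _ = a * ∫⁻ x, Ψ x (g x / s) ∂μ := lintegral_const_mul' _ _ ENNReal.coe_ne_top
      _ ≤ a * 1 := by gcongr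
      _ ≤ ε := by
        rw [mul_one]
        exact_mod_cast min_le_left _ _
  have h2 : ∀ᵐ x ∂μ, ∀ k : ℕ, Ψ x (k * g x) = 0 := by
    rw [ae_all_iff]
    intro k
    exact (lintegral_eq_zero_iff' (h.aemeasurable _ (hg.const_mul _))).1 (h1 k)
  filter_upwards [h2] with x hx
  by_contra hne
  obtain ⟨k, hk⟩ := h.unbounded x (g x) hne
  exact hk (hx k)

/-- The Luxemburg norm as a function norm. -/
def functionNorm (h : IsYoungIntegrand μ Ψ) : FunctionNorm μ where
  toFun := luxemburg μ Ψ
  mono {g g'} hgg := by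
    refine le_of_forall_gt fun t ht => ?_
    obtain ⟨s, hs, hs1, hs2⟩ := exists_of_luxemburg_lt ht
    refine lt_of_le_of_lt (luxemburg_le hs (le_trans (lintegral_mono_ae ?_) hs1)) hs2
    filter_upwards [hgg] with x hx
    exact h.mono x (ENNReal.div_le_div_right hx _)
  zero := by
    refine le_antisymm (ENNReal.le_of_forall_pos_le_add fun ε hε _ => ?_) zero_le
    rw [zero_add]
    exact luxemburg_le hε (by simp [h.zero])
  add_le hg _ := h.luxemburg_add_le hg
  smul_le c hc g := luxemburg_smul_le c hc g
  eq_zero hg h0 := h.eq_zero_of_luxemburg hg h0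

/-- A function belongs to the space of the Luxemburg norm if and only if
`∫ Ψ(x, |f(x)| / s) dμ(x) < ∞` for some `s > 0`. -/
theorem mem_space_iff (h : IsYoungIntegrand μ Ψ) (f : ℝ →ₘ[μ] ℂ) :
    f ∈ h.functionNorm.space ↔ ∃ s : ℝ≥0, 0 < s ∧ ∫⁻ x, Ψ x (‖f x‖ₑ / s) ∂μ < ∞ := by
  constructor
  · intro hf
    obtain ⟨s, hs, hs1, -⟩ := exists_of_luxemburg_lt (show luxemburg μ Ψ _ < ∞ from hf)
    exact ⟨s, hs, hs1.trans_lt ENNReal.one_lt_top⟩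
  · rintro ⟨s, hs, hs1⟩
    lift ∫⁻ x, Ψ x (‖f x‖ₑ / s) ∂μ to ℝ≥0 using hs1.ne with I hI
    have hI1 : (0 : ℝ≥0) < I + 1 := by positivity
    refine lt_of_le_of_lt (luxemburg_le (s := s * (I + 1)) (mul_pos hs hI1) ?_)
      ENNReal.coe_lt_top
    have hpt : ∀ x, Ψ x (‖f x‖ₑ / ((s * (I + 1) : ℝ≥0) : ℝ≥0∞))
        ≤ ((I + 1)⁻¹ : ℝ≥0) * Ψ x (‖f x‖ₑ / s) := by
      intro x
      refine le_trans (h.mono x (le_of_eq ?_)) (h.mul_le x ?_ _)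
      · rw [ENNReal.coe_inv hI1.ne', ENNReal.coe_mul, ENNReal.div_eq_inv_mul,
          ENNReal.div_eq_inv_mul, ENNReal.mul_inv (Or.inr ENNReal.coe_ne_top)
          (Or.inl ENNReal.coe_ne_top), ← mul_assoc, mul_comm (s : ℝ≥0∞)⁻¹]
      · exact_mod_cast inv_le_one_of_one_le₀ (le_add_self : (1 : ℝ≥0) ≤ I + 1)
    refine (lintegral_mono hpt).trans ?_
    rw [lintegral_const_mul' _ _ ENNReal.coe_ne_top, ← hI, ← ENNReal.coe_mul]
    have : (I + 1)⁻¹ * I ≤ 1 := by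
      rw [inv_mul_le_iff₀ hI1, mul_one]
      exact le_self_add
    exact_mod_cast this

/-- The function space generated by an integrand, over `ℝ` and over `ℝ₊`. -/
def spacePair (h : IsYoungIntegrand volume Ψ) (h' : IsYoungIntegrand halfVolume Ψ) :
    SpacePair where
  line := h.functionNorm
  half := h'.functionNorm
  indicator_eq g := by
    change luxemburg volume Ψ _ = luxemburg halfVolume Ψ g
    have key : ∀ s : ℝ≥0, ∫⁻ x, Ψ x ((Ioi (0 : ℝ)).indicator g x / s)
        = ∫⁻ x in Ioi 0, Ψ x (g x / s) := by
      intro s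
      rw [← lintegral_indicator measurableSet_Ioi]
      refine lintegral_congr fun x => ?_
      by_cases hx : x ∈ Ioi (0 : ℝ)
      · simp only [indicator_of_mem hx]
      · simp only [indicator_of_notMem hx, ENNReal.zero_div, h.zero]
    simp only [luxemburg, key]

end IsYoungIntegrand

/-! ### Orlicz spaces -/

/-- A function `φ : [0, ∞) → [0, ∞]` (its values at negative numbers play no role) whose integral
is a Young function: nondecreasing, left-continuous, `φ(0) = 0`, `φ(∞) = ∞`, and not identically
infinite on `(0, ∞)`. -/
structure IsYoungDensity (φ : ℝ → ℝ≥0∞) : Prop where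
  mono : MonotoneOn φ (Ici 0)
  left_cont : ∀ t, 0 < t → ContinuousWithinAt φ (Iio t) t
  zero : φ 0 = 0
  tendsto : Tendsto φ atTop (𝓝 ∞)
  finite : ∃ t, 0 < t ∧ φ t < ∞

/-- The Young function `Φ(s) = ∫₀ˢ φ(t) dt`. -/
def youngFunction (φ : ℝ → ℝ≥0∞) (s : ℝ≥0∞) : ℝ≥0∞ :=
  ∫⁻ t in {t : ℝ | 0 < t ∧ ENNReal.ofReal t ≤ s}, φ t

theorem youngFunction_mono (φ : ℝ → ℝ≥0∞) : Monotone (youngFunction φ) := fun _ _ h =>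
  lintegral_mono_set fun _ ht => ⟨ht.1, ht.2.trans h⟩

theorem youngFunction_coe (φ : ℝ → ℝ≥0∞) (s : ℝ≥0) :
    youngFunction φ s = ∫⁻ t in Ioc 0 (s : ℝ), φ t := by
  have : {t : ℝ | 0 < t ∧ ENNReal.ofReal t ≤ s} = Ioc 0 (s : ℝ) := by
    ext t
    simp only [mem_ofPred_eq, mem_Ioc]
    refine and_congr_right fun _ => ?_
    rw [ENNReal.ofReal_le_iff_le_toReal ENNReal.coe_ne_top, ENNReal.coe_toReal]
  rw [youngFunction, this]

namespace IsYoungDensity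

variable {φ : ℝ → ℝ≥0∞}

theorem youngFunction_le (h : IsYoungDensity φ) {s m : ℝ≥0} (hsm : s ≤ m) :
    youngFunction φ m ≤ youngFunction φ s + (m - s : ℝ≥0) * φ m := by
  rw [youngFunction_coe, youngFunction_coe,
    ← Ioc_union_Ioc_eq_Ioc s.2 (show (s : ℝ) ≤ m from hsm)]
  refine (lintegral_union_le _ _ _).trans (add_le_add le_rfl ?_)
  calc ∫⁻ t in Ioc (s : ℝ) m, φ t ≤ ∫⁻ _ in Ioc (s : ℝ) m, φ m :=
        setLIntegral_mono measurable_const fun t ht =>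
          h.mono (s.2.trans ht.1.le) m.2 ht.2
    _ = (m - s : ℝ≥0) * φ m := by
        rw [setLIntegral_const, Real.volume_Ioc, mul_comm, ← NNReal.coe_sub hsm,
          ENNReal.ofReal_coe_nnreal]

theorem le_youngFunction (h : IsYoungDensity φ) {m t : ℝ≥0} (hmt : m ≤ t) :
    youngFunction φ m + (t - m : ℝ≥0) * φ m ≤ youngFunction φ t := by
  rw [youngFunction_coe, youngFunction_coe,
    ← Ioc_union_Ioc_eq_Ioc m.2 (show (m : ℝ) ≤ t from hmt),
    lintegral_union measurableSet_Ioc (by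
      rw [Set.disjoint_left]
      intro x hx hx'
      exact absurd hx.2 (not_le.2 hx'.1))]
  refine add_le_add le_rfl ?_
  calc ((t - m : ℝ≥0) : ℝ≥0∞) * φ m = ∫⁻ _ in Ioc (m : ℝ) t, φ m := by
        rw [setLIntegral_const, Real.volume_Ioc, mul_comm, ← NNReal.coe_sub hmt,
          ENNReal.ofReal_coe_nnreal]
    _ ≤ ∫⁻ u in Ioc (m : ℝ) t, φ u :=
        setLIntegral_mono' measurableSet_Ioc fun u hu =>
          h.mono m.2 (show (0 : ℝ) ≤ u from m.2.trans hu.1.le) hu.1.le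

theorem youngFunction_top (h : IsYoungDensity φ) : youngFunction φ ∞ = ∞ := by
  obtain ⟨c, hc⟩ := (h.tendsto.eventually
    (lt_mem_nhds (show (1 : ℝ≥0∞) < ∞ from ENNReal.one_lt_top))).exists_forall_of_atTop
  refine top_unique ?_
  calc (∞ : ℝ≥0∞) = ∫⁻ _ in Ioi (max c 0), (1 : ℝ≥0∞) := by simp
    _ ≤ ∫⁻ t in Ioi (max c 0), φ t :=
        setLIntegral_mono' measurableSet_Ioi fun t ht =>
          (hc t ((le_max_left _ _).trans (le_of_lt ht))).le
    _ ≤ youngFunction φ ∞ :=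
        lintegral_mono_set fun t ht => ⟨(le_max_right _ _).trans_lt ht, le_top⟩

theorem youngFunction_convex (h : IsYoungDensity φ) (a b s t : ℝ≥0∞) (hab : a + b = 1) :
    youngFunction φ (a * s + b * t) ≤ a * youngFunction φ s + b * youngFunction φ t := by
  wlog hst : s ≤ t generalizing a b s t
  · rw [add_comm (a * s), add_comm (a * youngFunction φ s)]
    exact this b a t s (by rw [add_comm, hab]) (le_of_not_ge hst)
  have ha : a ≠ ∞ := fun h' => by simp [h'] at hab
  have hb : b ≠ ∞ := fun h' => by simp [h'] at hab
  by_cases ht : t = ∞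
  · by_cases hb0 : b = 0
    · have : a = 1 := by simpa [hb0] using hab
      simp [hb0, this]
    · rw [ht, h.youngFunction_top, ENNReal.mul_top hb0]
      simp
  have hs : s ≠ ∞ := ne_top_of_le_ne_top ht hst
  lift a to ℝ≥0 using ha
  lift b to ℝ≥0 using hb
  lift s to ℝ≥0 using hs
  lift t to ℝ≥0 using ht
  have hab' : a + b = 1 := by exact_mod_cast hab
  have hst' : s ≤ t := by exact_mod_cast hst
  set m : ℝ≥0 := a * s + b * t with hm
  have hcoe : (a : ℝ≥0∞) * s + b * t = (m : ℝ≥0∞) := by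
    rw [hm]
    push_cast
    rfl
  rw [hcoe]
  have hsm : s ≤ m := by
    calc s = a * s + b * s := by rw [← add_mul, hab', one_mul]
      _ ≤ m := by rw [hm]; gcongr
  have hmt : m ≤ t := by
    calc m ≤ a * t + b * t := by rw [hm]; gcongr
      _ = t := by rw [← add_mul, hab', one_mul]
  have hbal : a * (m - s) = b * (t - m) := by
    have e : (a : ℝ) + b = 1 := by exact_mod_cast hab'
    have e2 : (m : ℝ) = a * s + b * t := by rw [hm]; push_cast; rfl
    apply NNReal.coe_injective
    rw [NNReal.coe_mul, NNReal.coe_mul, NNReal.coe_sub hsm, NNReal.coe_sub hmt, e2]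
    have e3 : (a : ℝ) = 1 - b := by linarith
    rw [e3]
    ring
  calc youngFunction φ m = a * youngFunction φ m + b * youngFunction φ m := by
        rw [← add_mul, hab, one_mul]
    _ ≤ a * (youngFunction φ s + (m - s : ℝ≥0) * φ m) + b * youngFunction φ m := by
        gcongr
        exact h.youngFunction_le hsm
    _ = a * youngFunction φ s + ((a * (m - s) : ℝ≥0) * φ m + b * youngFunction φ m) := by
        rw [ENNReal.coe_mul, mul_add, mul_assoc, add_assoc]
    _ = a * youngFunction φ s + b * (youngFunction φ m + (t - m : ℝ≥0) * φ m) := by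
        rw [hbal, ENNReal.coe_mul, mul_add, mul_assoc, add_comm ((b : ℝ≥0∞) * _) (b * _)]
    _ ≤ a * youngFunction φ s + b * youngFunction φ t := by
        gcongr
        exact h.le_youngFunction hmt

theorem isYoungIntegrand (h : IsYoungDensity φ) (μ : Measure ℝ) :
    IsYoungIntegrand μ (fun _ => youngFunction φ) where
  zero _ := by
    have := youngFunction_coe φ 0
    simpa using this
  mono _ := youngFunction_mono φ
  convex _ := h.youngFunction_convex
  unbounded _ s hs := by
    by_contra! hall
    obtain ⟨c, hc⟩ :=
      (h.tendsto.eventually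
        (lt_mem_nhds (show (0 : ℝ≥0∞) < ∞ from ENNReal.zero_lt_top))).exists_forall_of_atTop
    obtain ⟨k, hk⟩ := ENNReal.exists_nat_mul_gt hs (b := ENNReal.ofReal (max c 0 + 1))
      ENNReal.ofReal_ne_top
    have h1 : ∫⁻ t in Ioc (max c 0) (max c 0 + 1), φ t = 0 := by
      refine le_antisymm ?_ zero_le
      rw [← hall k]
      refine lintegral_mono_set fun t ht => ⟨(le_max_right _ _).trans_lt ht.1, ?_⟩
      exact (ENNReal.ofReal_le_ofReal ht.2).trans hk.le
    have h2 : 0 < φ (max c 0) := hc _ (le_max_left _ _)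
    have h3 : φ (max c 0) ≤ ∫⁻ t in Ioc (max c 0) (max c 0 + 1), φ t := by
      calc φ (max c 0) = ∫⁻ _ in Ioc (max c 0) (max c 0 + 1), φ (max c 0) := by
            rw [setLIntegral_const, Real.volume_Ioc]
            simp
        _ ≤ _ := setLIntegral_mono' measurableSet_Ioc fun u hu =>
            h.mono (show (0 : ℝ) ≤ max c 0 from le_max_right _ _)
              (show (0 : ℝ) ≤ u from (le_max_right _ _).trans hu.1.le) hu.1.le
    rw [h1] at h3
    exact absurd h3 (not_le.2 h2)
  aemeasurable _ hg := (youngFunction_mono φ).measurable.comp_aemeasurable hg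

end IsYoungDensity

/-- The Orlicz space `L^Φ`, where `Φ(s) = ∫₀ˢ φ(t) dt`. -/
def orlicz {φ : ℝ → ℝ≥0∞} (h : IsYoungDensity φ) : SpacePair :=
  IsYoungIntegrand.spacePair (h.isYoungIntegrand volume) (h.isYoungIntegrand halfVolume)

/-- A normed space is reflexive if the canonical map into its bidual is onto. -/
def IsReflexive (E : Type*) [NormedAddCommGroup E] [NormedSpace ℂ E] : Prop :=
  Function.Surjective (NormedSpace.inclusionInDoubleDual ℂ E)

/-! ### Variable Lebesgue spaces -/

/-- A variable exponent: a (Lebesgue) measurable function with values in `[1, ∞)`. -/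
structure IsVariableExponent (p : ℝ → ℝ) : Prop where
  aemeasurable : AEMeasurable p volume
  one_le : ∀ x, 1 ≤ p x

theorem IsVariableExponent.isYoungIntegrand {p : ℝ → ℝ} (h : IsVariableExponent p)
    {μ : Measure ℝ} (hμ : μ ≪ volume) : IsYoungIntegrand μ (fun x s => s ^ p x) where
  zero x := ENNReal.zero_rpow_of_pos (zero_lt_one.trans_le (h.one_le x))
  mono x := ENNReal.monotone_rpow_of_nonneg (zero_le_one.trans (h.one_le x))
  convex x a b s t hab := ENNReal.rpow_arith_mean_le_arith_mean2_rpow a b s t hab (h.one_le x)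
  unbounded x s hs := ⟨1, by
    rw [Nat.cast_one, one_mul]
    intro h0
    rcases ENNReal.rpow_eq_zero_iff.1 h0 with h1 | h1
    · exact hs h1.1
    · exact absurd h1.2 (not_lt.2 (zero_le_one.trans (h.one_le x)))⟩
  aemeasurable g hg := hg.pow (h.aemeasurable.mono_ac hμ)

/-- The variable Lebesgue space `L^{p(·)}`. -/
def variableLebesgue {p : ℝ → ℝ} (h : IsVariableExponent p) : SpacePair :=
  IsYoungIntegrand.spacePair (h.isYoungIntegrand Measure.AbsolutelyContinuous.rfl)
    (h.isYoungIntegrand Measure.absolutelyContinuous_restrict)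

/-- The Hardy-Littlewood maximal function: the supremum of the averages of `|f|` over the bounded
intervals that contain `x` (closed intervals suffice). -/
def maximalFunction (f : ℝ → ℂ) (x : ℝ) : ℝ≥0∞ :=
  ⨆ (a : ℝ) (b : ℝ) (_ : a < b) (_ : x ∈ Icc a b),
    (∫⁻ t in Icc a b, ‖f t‖ₑ) / ENNReal.ofReal (b - a)

/-- The class `𝓑_M(ℝ)`: `1 < p₋`, `p₊ < ∞`, and the maximal operator is bounded on
`L^{p(·)}(ℝ)`. -/
structure IsMaximalExponent (p : ℝ → ℝ) : Prop extends IsVariableExponent p where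
  one_lt_inf : ∃ c, 1 < c ∧ ∀ᵐ x, c ≤ p x
  sup_lt_top : ∃ c, ∀ᵐ x, p x ≤ c
  maximal_bounded : ∃ C : ℝ≥0, ∀ f : ℝ →ₘ[volume] ℂ,
    f ∈ (variableLebesgue toIsVariableExponent).line.space →
      (variableLebesgue toIsVariableExponent).line.toFun (maximalFunction f)
        ≤ C * (variableLebesgue toIsVariableExponent).line.eval f

/-! ### Lorentz spaces -/

/-- The distribution function `μ_g`. -/
def distribution (μ : Measure ℝ) (g : ℝ → ℝ≥0∞) (l : ℝ≥0∞) : ℝ≥0∞ := μ {x | l < g x}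

/-- The nonincreasing rearrangement `g*(t) = inf {l ≥ 0 : μ_g(l) ≤ t}` (`inf ∅ = ∞`). -/
def rearrangement (μ : Measure ℝ) (g : ℝ → ℝ≥0∞) (t : ℝ) : ℝ≥0∞ :=
  sInf {l : ℝ≥0∞ | distribution μ g l ≤ ENNReal.ofReal t}

/-- The maximal average `g**(t) = t⁻¹ ∫₀ᵗ g*(s) ds`. -/
def rearrangementAverage (μ : Measure ℝ) (g : ℝ → ℝ≥0∞) (t : ℝ) : ℝ≥0∞ :=
  (∫⁻ s in Ioo 0 t, rearrangement μ g s) / ENNReal.ofReal t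

/-- The Lorentz norm `(∫₀^∞ (t^{1/p} g**(t))^q dt / t)^{1/q}`. -/
def lorentzFun (μ : Measure ℝ) (p q : ℝ) (g : ℝ → ℝ≥0∞) : ℝ≥0∞ :=
  (∫⁻ t in Ioi (0 : ℝ),
    (ENNReal.ofReal (t ^ (1 / p)) * rearrangementAverage μ g t) ^ q / ENNReal.ofReal t) ^ (1 / q)

section Lorentz

variable {μ : Measure ℝ} {g h : ℝ → ℝ≥0∞}

theorem distribution_mono (hgh : g ≤ᵐ[μ] h) (l : ℝ≥0∞) :
    distribution μ g l ≤ distribution μ h l := by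
  refine measure_mono_ae ?_
  filter_upwards [hgh] with x hx hl
  exact lt_of_lt_of_le hl hx

theorem rearrangement_mono (hgh : g ≤ᵐ[μ] h) (t : ℝ) :
    rearrangement μ g t ≤ rearrangement μ h t :=
  sInf_le_sInf fun l hl => (distribution_mono hgh l).trans hl

theorem rearrangement_antitone (μ : Measure ℝ) (g : ℝ → ℝ≥0∞) : Antitone (rearrangement μ g) :=
  fun _ _ hst => sInf_le_sInf fun _ hl => le_trans hl (ENNReal.ofReal_le_ofReal hst)

theorem rearrangement_le_iff {t : ℝ} {l : ℝ≥0∞} :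
    rearrangement μ g t ≤ l ↔ distribution μ g l ≤ ENNReal.ofReal t := by
  refine ⟨fun hl => ?_, fun hl => sInf_le hl⟩
  by_cases htop : l = ∞
  · simp [htop, distribution]
  have hgt : ∀ m, l < m → distribution μ g m ≤ ENNReal.ofReal t := by
    intro m hm
    obtain ⟨k, hk, hkm⟩ := sInf_lt_iff.1 (lt_of_le_of_lt hl hm)
    exact le_trans (measure_mono fun x hx => lt_trans hkm hx) hk
  obtain ⟨u, hu, hul, hulim⟩ := exists_seq_strictAnti_tendsto' (lt_top_iff_ne_top.2 htop)
  have hset : {x | l < g x} = ⋃ k, {x | u k < g x} := by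
    ext x
    simp only [mem_ofPred_eq, mem_iUnion]
    refine ⟨fun hx => (hulim.eventually (gt_mem_nhds hx)).exists, ?_⟩
    rintro ⟨k, hk⟩
    exact (hul k).1.trans hk
  have hmono : Monotone fun k => {x | u k < g x} :=
    fun i j hij x hx => lt_of_le_of_lt (hu.antitone hij) hx
  rw [distribution, hset, hmono.measure_iUnion]
  exact iSup_le fun k => hgt _ (hul k).1

theorem distribution_rearrangement (μ : Measure ℝ) (g : ℝ → ℝ≥0∞) (t : ℝ) :
    μ {x | rearrangement μ g t < g x} ≤ ENNReal.ofReal t :=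
  rearrangement_le_iff.1 le_rfl

theorem volume_ofReal_lt (y : ℝ≥0∞) : volume {s : ℝ | 0 < s ∧ ENNReal.ofReal s < y} = y := by
  by_cases hy : y = ∞
  · have : {s : ℝ | 0 < s ∧ ENNReal.ofReal s < y} = Ioi 0 := by
      ext s
      simp [hy]
    rw [this, hy, Real.volume_Ioi]
  · have : {s : ℝ | 0 < s ∧ ENNReal.ofReal s < y} = Ioo 0 y.toReal := by
      ext s
      simp only [mem_ofPred_eq, mem_Ioo]
      refine and_congr_right fun hs => ?_
      rw [ENNReal.ofReal_lt_iff_lt_toReal hs.le hy]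
    rw [this, Real.volume_Ioo, sub_zero, ENNReal.ofReal_toReal hy]

theorem lintegral_eq_distribution [SFinite μ] (hg : Measurable g) :
    ∫⁻ x, g x ∂μ = ∫⁻ l in Ioi (0 : ℝ), distribution μ g (ENNReal.ofReal l) := by
  have hmeas : MeasurableSet {z : ℝ × ℝ | ENNReal.ofReal z.2 < g z.1} :=
    measurableSet_lt (ENNReal.measurable_ofReal.comp measurable_snd) (hg.comp measurable_fst)
  have e1 : ∀ x, g x = ∫⁻ l in Ioi (0 : ℝ),
      {z : ℝ × ℝ | ENNReal.ofReal z.2 < g z.1}.indicator (fun _ => (1 : ℝ≥0∞)) (x, l) := by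
    intro x
    have hm : MeasurableSet {l : ℝ | ENNReal.ofReal l < g x} :=
      measurableSet_lt ENNReal.measurable_ofReal measurable_const
    have : ∀ l : ℝ, {z : ℝ × ℝ | ENNReal.ofReal z.2 < g z.1}.indicator
        (fun _ => (1 : ℝ≥0∞)) (x, l)
        = {l : ℝ | ENNReal.ofReal l < g x}.indicator (fun _ => 1) l := fun l => rfl
    simp only [this]
    rw [lintegral_indicator hm, setLIntegral_one, Measure.restrict_apply hm]
    conv_lhs => rw [← volume_ofReal_lt (g x)]
    congr 1
    ext l
    simp [and_comm]
  calc ∫⁻ x, g x ∂μ = ∫⁻ x, (∫⁻ l in Ioi (0 : ℝ),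
        {z : ℝ × ℝ | ENNReal.ofReal z.2 < g z.1}.indicator (fun _ => (1 : ℝ≥0∞)) (x, l)) ∂μ :=
        lintegral_congr e1
    _ = ∫⁻ l in Ioi (0 : ℝ), ∫⁻ x,
        {z : ℝ × ℝ | ENNReal.ofReal z.2 < g z.1}.indicator (fun _ => (1 : ℝ≥0∞)) (x, l) ∂μ :=
        lintegral_lintegral_swap (μ := μ) (ν := volume.restrict (Ioi (0 : ℝ)))
          (f := fun x l => {z : ℝ × ℝ | ENNReal.ofReal z.2 < g z.1}.indicator
          (fun _ => (1 : ℝ≥0∞)) (x, l)) (measurable_const.indicator hmeas).aemeasurable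
    _ = _ := by
        refine lintegral_congr fun l => ?_
        have hm : MeasurableSet {x : ℝ | ENNReal.ofReal l < g x} :=
          measurableSet_lt measurable_const hg
        have : ∀ x : ℝ, {z : ℝ × ℝ | ENNReal.ofReal z.2 < g z.1}.indicator
            (fun _ => (1 : ℝ≥0∞)) (x, l)
            = {x : ℝ | ENNReal.ofReal l < g x}.indicator (fun _ => 1) x := fun x => rfl
        simp only [this]
        rw [lintegral_indicator hm, setLIntegral_one, distribution]

theorem lintegral_rearrangement [SFinite μ] (hg : AEMeasurable g μ) :
    ∫⁻ s in Ioi (0 : ℝ), rearrangement μ g s = ∫⁻ x, g x ∂μ := by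
  have hr : ∀ t, rearrangement μ g t = rearrangement μ (hg.mk g) t := fun t =>
    le_antisymm (rearrangement_mono hg.ae_eq_mk.le t) (rearrangement_mono hg.ae_eq_mk.symm.le t)
  rw [lintegral_congr_ae hg.ae_eq_mk, lintegral_eq_distribution hg.measurable_mk]
  simp only [hr]
  rw [lintegral_eq_distribution (rearrangement_antitone μ _).measurable]
  refine lintegral_congr fun l => ?_
  have hm : MeasurableSet {s : ℝ | ENNReal.ofReal l < rearrangement μ (hg.mk g) s} :=
    measurableSet_lt measurable_const (rearrangement_antitone μ _).measurable
  rw [distribution, Measure.restrict_apply hm]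
  conv_rhs => rw [← volume_ofReal_lt (distribution μ (hg.mk g) (ENNReal.ofReal l))]
  congr 1
  ext s
  simp only [mem_inter_iff, mem_ofPred_eq, mem_Ioi]
  rw [and_comm]
  refine and_congr_right fun _ => ?_
  rw [← not_le, rearrangement_le_iff, not_le]

theorem lintegral_Ioo_rearrangement_le [SFinite μ] (hg : AEMeasurable g μ) (t : ℝ) (l : ℝ≥0∞) :
    ∫⁻ s in Ioo 0 t, rearrangement μ g s
      ≤ ∫⁻ x, (g x - l) ∂μ + ENNReal.ofReal t * l := by
  have h1 : ∀ s, rearrangement μ g s ≤ rearrangement μ (fun x => g x - l) s + l := by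
    intro s
    rw [rearrangement_le_iff]
    refine le_trans (measure_mono ?_) (distribution_rearrangement μ (fun x => g x - l) s)
    intro x hx
    exact lt_tsub_iff_right.2 (show _ + l < g x from hx)
  calc ∫⁻ s in Ioo 0 t, rearrangement μ g s
      ≤ ∫⁻ s in Ioo 0 t, (rearrangement μ (fun x => g x - l) s + l) := lintegral_mono h1
    _ = (∫⁻ s in Ioo 0 t, rearrangement μ (fun x => g x - l) s) + ENNReal.ofReal t * l := by
        rw [lintegral_add_right _ measurable_const, setLIntegral_const, Real.volume_Ioo, sub_zero,
          mul_comm l]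
    _ ≤ (∫⁻ s in Ioi (0 : ℝ), rearrangement μ (fun x => g x - l) s) + ENNReal.ofReal t * l :=
        add_le_add (lintegral_mono_set Ioo_subset_Ioi_self) le_rfl
    _ = _ := by rw [lintegral_rearrangement (hg.sub_const l)]

theorem exists_lintegral_Ioo_rearrangement [SFinite μ] (hg : AEMeasurable g μ) {t : ℝ}
    (ht : 0 < t) :
    ∃ l : ℝ≥0∞, ∫⁻ x, (g x - l) ∂μ + ENNReal.ofReal t * l
      ≤ ∫⁻ s in Ioo 0 t, rearrangement μ g s := by
  set l := rearrangement μ g t with hl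
  have hlow : ∀ s ∈ Ioo 0 t, l ≤ rearrangement μ g s := fun s hs =>
    rearrangement_antitone μ g hs.2.le
  have hle : ∀ s, rearrangement μ (fun x => g x - l) s ≤ rearrangement μ g s - l := by
    intro s
    rw [rearrangement_le_iff]
    refine le_trans (measure_mono ?_) (distribution_rearrangement μ g s)
    intro x hx
    by_contra hcon
    exact absurd hx (not_lt.2 (tsub_le_tsub_right (not_lt.1 hcon) l))
  refine ⟨l, ?_⟩
  rw [← lintegral_rearrangement (hg.sub_const l), ← Ioo_union_Ici_eq_Ioi ht]
  have hz : ∫⁻ s in Ici t, rearrangement μ (fun x => g x - l) s = 0 := by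
    refine le_antisymm ?_ zero_le
    calc _ ≤ ∫⁻ _ in Ici t, (0 : ℝ≥0∞) := setLIntegral_mono' measurableSet_Ici fun s hs =>
          (hle s).trans (tsub_le_iff_right.2 (by
            rw [zero_add]
            exact rearrangement_antitone μ g hs))
      _ = 0 := by simp
  calc _ ≤ ((∫⁻ s in Ioo 0 t, rearrangement μ (fun x => g x - l) s)
          + ∫⁻ s in Ici t, rearrangement μ (fun x => g x - l) s) + ENNReal.ofReal t * l :=
        add_le_add (lintegral_union_le _ _ _) le_rfl
    _ ≤ (∫⁻ s in Ioo 0 t, (rearrangement μ g s - l)) + ENNReal.ofReal t * l := by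
        rw [hz, add_zero]
        exact add_le_add (lintegral_mono hle) le_rfl
    _ = ∫⁻ s in Ioo 0 t, ((rearrangement μ g s - l) + l) := by
        rw [lintegral_add_right _ measurable_const, setLIntegral_const, Real.volume_Ioo, sub_zero,
          mul_comm]
    _ = ∫⁻ s in Ioo 0 t, rearrangement μ g s :=
        setLIntegral_congr_fun measurableSet_Ioo fun s hs => tsub_add_cancel_of_le (hlow s hs)

theorem rearrangementAverage_add_le [SFinite μ] (hg : AEMeasurable g μ) (hh : AEMeasurable h μ)
    {t : ℝ} (ht : 0 < t) :
    rearrangementAverage μ (fun x => g x + h x) t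
      ≤ rearrangementAverage μ g t + rearrangementAverage μ h t := by
  rw [rearrangementAverage, rearrangementAverage, rearrangementAverage, ← ENNReal.add_div]
  refine ENNReal.div_le_div_right ?_ _
  obtain ⟨l, hl⟩ := exists_lintegral_Ioo_rearrangement hg ht
  obtain ⟨m, hm⟩ := exists_lintegral_Ioo_rearrangement hh ht
  calc ∫⁻ s in Ioo 0 t, rearrangement μ (fun x => g x + h x) s
      ≤ ∫⁻ x, (g x + h x - (l + m)) ∂μ + ENNReal.ofReal t * (l + m) :=
        lintegral_Ioo_rearrangement_le (hg.add hh) t _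
    _ ≤ ∫⁻ x, ((g x - l) + (h x - m)) ∂μ + ENNReal.ofReal t * (l + m) := by
        gcongr with x
        exact add_tsub_add_le_tsub_add_tsub
    _ = (∫⁻ x, (g x - l) ∂μ + ENNReal.ofReal t * l)
        + (∫⁻ x, (h x - m) ∂μ + ENNReal.ofReal t * m) := by
        rw [lintegral_add_left' (hg.sub_const l), mul_add]
        abel
    _ ≤ _ := add_le_add hl hm

theorem measurable_rearrangementAverage (μ : Measure ℝ) (g : ℝ → ℝ≥0∞) :
    Measurable (rearrangementAverage μ g) := by
  refine Measurable.div (Monotone.measurable fun s t hst => ?_) ENNReal.measurable_ofReal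
  exact lintegral_mono_set (Ioo_subset_Ioo_right hst)

theorem rearrangement_smul_le (c : ℝ≥0) (hc : c ≠ 0) (t : ℝ) :
    rearrangement μ (fun x => c * g x) t ≤ c * rearrangement μ g t := by
  rw [rearrangement_le_iff]
  refine le_trans (measure_mono ?_) (distribution_rearrangement μ g t)
  intro x hx
  exact (ENNReal.mul_lt_mul_iff_right (by exact_mod_cast hc) ENNReal.coe_ne_top).1 hx

theorem lorentzFun_eq_lpNorm (μ : Measure ℝ) (p q : ℝ) (g : ℝ → ℝ≥0∞) :
    lorentzFun μ p q g = (∫⁻ t, (ENNReal.ofReal (t ^ (1 / p)) * rearrangementAverage μ g t) ^ q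
      ∂((volume.restrict (Ioi (0 : ℝ))).withDensity fun t => (ENNReal.ofReal t)⁻¹)) ^ (1 / q) := by
  rw [lorentzFun, lintegral_withDensity_eq_lintegral_mul _ (f := fun t => (ENNReal.ofReal t)⁻¹)
    ENNReal.measurable_ofReal.inv]
  · simp only [Pi.mul_apply, ENNReal.div_eq_inv_mul]
  · exact ((ENNReal.measurable_ofReal.comp (by fun_prop)).mul
      (measurable_rearrangementAverage μ g)).pow_const q

theorem lorentzFun_mono_of_average {p q : ℝ} (hq : 0 ≤ q) {ν : Measure ℝ}
    (H : ∀ t, 0 < t → rearrangementAverage μ g t ≤ rearrangementAverage ν h t) :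
    lorentzFun μ p q g ≤ lorentzFun ν p q h := by
  refine ENNReal.rpow_le_rpow (setLIntegral_mono' measurableSet_Ioi fun t ht => ?_) (by positivity)
  refine ENNReal.div_le_div_right (ENNReal.rpow_le_rpow ?_ hq) _
  gcongr
  exact H t ht

theorem lorentzFun_add_le [SFinite μ] {p q : ℝ} (hq : 1 < q) (hg : AEMeasurable g μ)
    (hh : AEMeasurable h μ) :
    lorentzFun μ p q (fun x => g x + h x) ≤ lorentzFun μ p q g + lorentzFun μ p q h := by
  have hm : ∀ k : ℝ → ℝ≥0∞, Measurable
      fun t : ℝ => ENNReal.ofReal (t ^ (1 / p)) * rearrangementAverage μ k t := fun k =>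
    (ENNReal.measurable_ofReal.comp (by fun_prop)).mul (measurable_rearrangementAverage μ k)
  rw [lorentzFun_eq_lpNorm μ p q g, lorentzFun_eq_lpNorm μ p q h, lorentzFun_eq_lpNorm]
  refine le_trans ?_
    (ENNReal.lintegral_Lp_add_le (hm g).aemeasurable (hm h).aemeasurable hq.le)
  refine ENNReal.rpow_le_rpow (lintegral_mono_ae ?_) (one_div_nonneg.2 (zero_le_one.trans hq.le))
  refine (withDensity_absolutelyContinuous _ _).ae_le ?_
  filter_upwards [ae_restrict_mem measurableSet_Ioi] with t ht
  refine ENNReal.rpow_le_rpow ?_ (by positivity)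
  rw [Pi.add_apply, ← mul_add]
  gcongr
  exact rearrangementAverage_add_le hg hh ht

theorem lorentzFun_smul_le {p q : ℝ} (hq : 1 < q) (c : ℝ≥0) (hc : c ≠ 0) (g : ℝ → ℝ≥0∞) :
    lorentzFun μ p q (fun x => c * g x) ≤ c * lorentzFun μ p q g := by
  have hq0 : 0 < q := by positivity
  have hav : ∀ t, rearrangementAverage μ (fun x => c * g x) t
      ≤ c * rearrangementAverage μ g t := by
    intro t
    rw [rearrangementAverage, rearrangementAverage, ← mul_div_assoc]
    refine ENNReal.div_le_div_right ?_ _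
    rw [← lintegral_const_mul' _ _ ENNReal.coe_ne_top]
    exact lintegral_mono fun s => rearrangement_smul_le c hc s
  have hcq : (c : ℝ≥0∞) ^ q ≠ ∞ := ENNReal.rpow_ne_top_of_nonneg hq0.le ENNReal.coe_ne_top
  calc lorentzFun μ p q (fun x => c * g x)
      ≤ (∫⁻ t in Ioi (0 : ℝ), (c : ℝ≥0∞) ^ q * ((ENNReal.ofReal (t ^ (1 / p))
          * rearrangementAverage μ g t) ^ q / ENNReal.ofReal t)) ^ (1 / q) := by
        refine ENNReal.rpow_le_rpow (lintegral_mono fun t => ?_) (by positivity)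
        rw [← mul_div_assoc, ← ENNReal.mul_rpow_of_nonneg _ _ hq0.le]
        refine ENNReal.div_le_div_right (ENNReal.rpow_le_rpow ?_ hq0.le) _
        rw [mul_left_comm]
        gcongr
        exact hav t
    _ = c * lorentzFun μ p q g := by
        rw [lintegral_const_mul' _ _ hcq, ENNReal.mul_rpow_of_nonneg _ _ (by positivity),
          ← ENNReal.rpow_mul, mul_one_div_cancel hq0.ne', ENNReal.rpow_one, lorentzFun]

theorem eq_zero_of_lorentzFun {p q : ℝ} (hq : 1 < q) (h0 : lorentzFun μ p q g = 0) :
    g =ᵐ[μ] fun _ => 0 := by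
  have hq0 : 0 < q := by positivity
  have hm : Measurable fun t : ℝ => (ENNReal.ofReal (t ^ (1 / p))
      * rearrangementAverage μ g t) ^ q / ENNReal.ofReal t :=
    (((ENNReal.measurable_ofReal.comp (by fun_prop)).mul
      (measurable_rearrangementAverage μ g)).pow_const q).div ENNReal.measurable_ofReal
  rw [lorentzFun, ENNReal.rpow_eq_zero_iff_of_pos (by positivity), lintegral_eq_zero_iff hm] at h0
  have hav : ∀ᵐ t ∂(volume.restrict (Ioi (0 : ℝ))),
      ∫⁻ s in Ioo 0 t, rearrangement μ g s = 0 := by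
    filter_upwards [h0, ae_restrict_mem measurableSet_Ioi] with t ht ht0
    have ht0' : (0 : ℝ) < t := ht0
    have h3 : 0 < t ^ p⁻¹ := Real.rpow_pos_of_pos ht0' _
    simpa [ENNReal.div_eq_zero_iff, ENNReal.rpow_eq_zero_iff_of_pos hq0, rearrangementAverage,
      not_le.2 h3] using ht
  have hex : ∃ t, 0 < t ∧ ∫⁻ s in Ioo 0 t, rearrangement μ g s = 0 := by
    have hne : NeBot (ae (volume.restrict (Ioi (0 : ℝ)))) := by
      rw [ae_neBot]
      intro hz
      have := congrArg (fun m : Measure ℝ => m univ) hz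
      simp at this
    obtain ⟨t, ht1, ht2⟩ := (hav.and (ae_restrict_mem measurableSet_Ioi)).exists
    exact ⟨t, ht2, ht1⟩
  obtain ⟨t, ht, hI⟩ := hex
  rw [lintegral_eq_zero_iff (rearrangement_antitone μ g).measurable] at hI
  have hall : ∀ s, 0 < s → rearrangement μ g s = 0 := by
    intro s hs
    have hne : NeBot (ae (volume.restrict (Ioo 0 (min s t)))) := by
      rw [ae_neBot]
      intro hz
      have := congrArg (fun m : Measure ℝ => m univ) hz
      simp at this
      exact this.elim (not_le.2 hs) (not_le.2 ht)
    obtain ⟨r, hr1, hr2⟩ := ((ae_restrict_of_ae_restrict_of_subset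
      (Ioo_subset_Ioo_right (min_le_right s t)) hI).and (ae_restrict_mem measurableSet_Ioo)).exists
    refine le_antisymm ?_ zero_le
    calc rearrangement μ g s ≤ rearrangement μ g r :=
          rearrangement_antitone μ g (hr2.2.le.trans (min_le_left _ _))
      _ = 0 := hr1
  have hd : distribution μ g 0 = 0 := by
    refine le_antisymm (ENNReal.le_of_forall_pos_le_add fun ε hε _ => ?_) zero_le
    rw [zero_add]
    have := rearrangement_le_iff.1 (hall (ε : ℝ) (by exact_mod_cast hε)).le
    simpa using this
  rw [Filter.EventuallyEq, ae_iff]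
  simpa [distribution, pos_iff_ne_zero] using hd

end Lorentz

/-- The Lorentz norm as a function norm. -/
def lorentzNorm (μ : Measure ℝ) [SFinite μ] (p q : ℝ) (hq : 1 < q) : FunctionNorm μ where
  toFun := lorentzFun μ p q
  mono hgh := lorentzFun_mono_of_average (by positivity) fun t _ =>
    ENNReal.div_le_div_right (lintegral_mono fun s => rearrangement_mono hgh s) _
  zero := by
    have h1 : ∀ t, rearrangement μ (fun _ => 0) t = 0 := fun t =>
      le_antisymm (rearrangement_le_iff.2 (by simp [distribution])) zero_le
    have hq0 : 0 < q := by positivity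
    simp [lorentzFun, rearrangementAverage, h1, hq0]
  add_le hg hh := lorentzFun_add_le hq hg hh
  smul_le c hc g := lorentzFun_smul_le hq c hc g
  eq_zero _ h0 := eq_zero_of_lorentzFun hq h0

/-- The Lorentz space `L^{p,q}`. -/
def lorentz (p q : ℝ) (hq : 1 < q) : SpacePair where
  line := lorentzNorm volume p q hq
  half := lorentzNorm halfVolume p q hq
  indicator_eq g := by
    have h1 : ∀ l, distribution volume ((Ioi (0 : ℝ)).indicator g) l
        = distribution halfVolume g l := by
      intro l
      rw [distribution, distribution, Measure.restrict_apply' measurableSet_Ioi]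
      congr 1
      ext x
      by_cases hx : x ∈ Ioi (0 : ℝ)
      · simp only [mem_ofPred_eq, mem_inter_iff, indicator_of_mem hx, hx, and_true]
      · simp only [mem_ofPred_eq, mem_inter_iff, indicator_of_notMem hx, hx, and_false,
          not_lt_zero]
    change lorentzFun volume p q _ = lorentzFun halfVolume p q g
    simp only [lorentzFun, rearrangementAverage, rearrangement, h1]

/-! ### The three classes of spaces -/

/-- The spaces under consideration: Lorentz spaces `L^{p,q}` with `1 < p, q < ∞`, reflexive Orlicz
spaces, and variable Lebesgue spaces with exponent in `𝓑_M(ℝ)`. -/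
inductive IsAdmissible : SpacePair → Prop
  | lorentz (p q : ℝ) (hp : 1 < p) (hq : 1 < q) : IsAdmissible (lorentz p q hq)
  | orlicz (φ : ℝ → ℝ≥0∞) (hφ : IsYoungDensity φ) (hrefl : IsReflexive (orlicz hφ).half.space) :
      IsAdmissible (orlicz hφ)
  | variableLebesgue (p : ℝ → ℝ) (hp : IsMaximalExponent p) :
      IsAdmissible (variableLebesgue hp.toIsVariableExponent)

/-! ### Fourier convolution operators and Wiener-Hopf operators -/

/-- The Fourier transform `(F f)(ξ) = ∫ f(x) exp(i ξ x) dx` on `L²(ℝ)`. The transform of the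
library has the kernel `exp(-2 π i ξ x)`, so that `(F f)(ξ)` is its value at `-ξ / (2 π)`. -/
def fourierL2 (u : Lp ℂ 2 (volume : Measure ℝ)) : ℝ → ℂ :=
  fun ξ => (𝓕 u : Lp ℂ 2 (volume : Measure ℝ)) (-ξ / (2 * Real.pi))

/-- `v = F⁻¹(a · F u)` for `u, v ∈ L²(ℝ)`. -/
def IsConvolutionL2 (a : ℝ → ℂ) (u v : Lp ℂ 2 (volume : Measure ℝ)) : Prop :=
  fourierL2 v =ᵐ[volume] fun ξ => a ξ * fourierL2 u ξ

/-- `T` is a bounded operator on `X(ℝ)` with `T f = F⁻¹(a · F f)` for all `f ∈ L²(ℝ) ∩ X(ℝ)`. -/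
def ExtendsConvolution (X : SpacePair) (a : ℝ → ℂ) (T : X.line.space →L[ℂ] X.line.space) : Prop :=
  ∀ (f : X.line.space) (u : Lp ℂ 2 (volume : Measure ℝ)),
    (f : ℝ →ₘ[volume] ℂ) = (u : ℝ →ₘ[volume] ℂ) →
    ∃ v : Lp ℂ 2 (volume : Measure ℝ), IsConvolutionL2 a u v ∧
      (T f : ℝ →ₘ[volume] ℂ) = (v : ℝ →ₘ[volume] ℂ)

/-- `a` is a Fourier multiplier on `X(ℝ)`. -/
def IsFourierMultiplier (X : SpacePair) (a : ℝ → ℂ) : Prop :=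
  MemLp a ∞ (volume : Measure ℝ) ∧ ∃ T, ExtendsConvolution X a T

open Classical in
/-- The Fourier convolution operator `W⁰(a)` on `X(ℝ)`: the bounded extension of
`f ↦ F⁻¹(a · F f)` from `L²(ℝ) ∩ X(ℝ)`, which is unique when `L²(ℝ) ∩ X(ℝ)` is dense in `X(ℝ)`
(and `0` if `a` is not a Fourier multiplier on `X(ℝ)`). -/
def fourierConvolution (X : SpacePair) (a : ℝ → ℂ) : X.line.space →L[ℂ] X.line.space :=
  if h : IsFourierMultiplier X a then h.2.choose else 0

/-- The Wiener-Hopf operator `W(a) = r₊ W⁰(a) ℓ₊` on `X(ℝ₊)`. -/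
def wienerHopf (X : SpacePair) (a : ℝ → ℂ) : X.half.space →L[ℂ] X.half.space :=
  X.restrict ∘L fourierConvolution X a ∘L X.extend

/-- The Fredholm index `dim Ker T - dim E / Im T`. -/
def fredholmIndex {E : Type*} [NormedAddCommGroup E] [NormedSpace ℂ E] (T : E →L[ℂ] E) : ℤ :=
  (Module.finrank ℂ T.ker : ℤ) - (Module.finrank ℂ (E ⧸ T.range) : ℤ)

/-- The symbol `r_n(ξ) = ((ξ - i) / (ξ + i)) ^ n`. -/
def rSymbol (n : ℤ) (ξ : ℝ) : ℂ := (((ξ : ℂ) - Complex.I) / ((ξ : ℂ) + Complex.I)) ^ n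

end WienerHopf

end

/-!
Up to a factor `2`, the functions `1 - r₁` and `1 - r₋₁` are the Fourier symbols of averaging
`f(x - y)` and `f(x + y)` over the exponential distribution `e^{-y} dy`. Averages are bounded
on Orlicz spaces by Jensen's inequality, on variable Lebesgue spaces since the maximal function
dominates them, and on Lorentz spaces since they do not increase `f**`. So `r₁` and `r₋₁` are
Fourier multipliers. Averaging over the past is causal and averaging over the future is anticausal,
hence `W(rₙ)` is a power of `T₊ = W(r₁)` or of `T₋ = W(r₋₁)`.

Multiplying symbols gives `T₋ T₊ = 1`. The defect `1 - T₊ T₋` is the rank-one operator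
`f ↦ 2 (∫ f(y) e^{-y} dy) e^{-x}`, so the kernel of `T₋` is one-dimensional. Therefore `T₋ⁿ` is
onto with an `n`-dimensional kernel, and its right inverse `T₊ⁿ` is injective with a range of
codimension `n`.

All of this only determines the operators on square integrable functions, which are dense in
`X(ℝ₊)`: truncation converges by dominated convergence in Lorentz and variable Lebesgue spaces,
and weakly, by compactness, in reflexive spaces.
-/

noncomputable section

namespace WienerHopf

/-! ### Averages of translates over the exponential distribution -/

theorem FunctionNorm.mul_toFun_le {μ : Measure ℝ} (ρ : FunctionNorm μ) (c : ℝ≥0∞)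
    (g : ℝ → ℝ≥0∞) : c * ρ.toFun g ≤ ρ.toFun fun x => c * g x := by
  have finite_case : ∀ r : ℝ≥0, r * ρ.toFun g ≤ ρ.toFun fun x => r * g x := by
    intro r
    rcases eq_or_ne r 0 with rfl | hr
    · simp
    · have hr' : (r : ℝ≥0∞) ≠ 0 := ENNReal.coe_ne_zero.2 hr
      calc (r : ℝ≥0∞) * ρ.toFun g
          = r * ρ.toFun fun x => (r⁻¹ : ℝ≥0) * (r * g x) := by
            simp only [ENNReal.coe_inv hr, ← mul_assoc,
              ENNReal.inv_mul_cancel hr' ENNReal.coe_ne_top, one_mul]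
        _ ≤ r * ((r⁻¹ : ℝ≥0) * ρ.toFun fun x => r * g x) := by
            gcongr
            exact ρ.smul_le _ (inv_ne_zero hr) _
        _ = ρ.toFun fun x => r * g x := by
            rw [ENNReal.coe_inv hr, ← mul_assoc,
              ENNReal.mul_inv_cancel hr' ENNReal.coe_ne_top, one_mul]
  refine ENNReal.mul_le_of_forall_lt fun r hr b hb => ?_
  lift r to ℝ≥0 using hr.ne_top
  calc (r : ℝ≥0∞) * b ≤ r * ρ.toFun g := by gcongr
    _ ≤ ρ.toFun fun x => r * g x := finite_case r
    _ ≤ ρ.toFun fun x => c * g x := ρ.mono (Eventually.of_forall fun x => by dsimp only; gcongr)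

theorem FunctionNorm.ae_lt_top {μ : Measure ℝ} (ρ : FunctionNorm μ) {g : ℝ → ℝ≥0∞}
    (hg : AEMeasurable g μ) (hfin : ρ.toFun g < ∞) : ∀ᵐ x ∂μ, g x < ∞ := by
  set e : ℝ → ℝ≥0∞ := fun x => ({∞} : Set ℝ≥0∞).indicator 1 (g x) with he
  have he_meas : AEMeasurable e μ :=
    (measurable_one.indicator (measurableSet_singleton ∞)).comp_aemeasurable hg
  have he_bound : ∞ * ρ.toFun e ≤ ρ.toFun g :=
    (ρ.mul_toFun_le ∞ e).trans <| ρ.mono <| Eventually.of_forall fun x => by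
      by_cases hx : g x = ∞ <;> simp [he, hx]
  have he_zero : ρ.toFun e = 0 := by
    by_contra hne
    rw [ENNReal.top_mul hne] at he_bound
    exact hfin.not_ge he_bound
  filter_upwards [ρ.eq_zero he_meas he_zero] with x hx
  refine lt_top_iff_ne_top.2 fun htop => ?_
  simp [he, htop] at hx

/-- The exponential distribution `e^{-y} dy` on `(0, ∞)`. -/
abbrev expLaw : Measure ℝ := ProbabilityTheory.expMeasure 1

instance : IsProbabilityMeasure expLaw :=
  ProbabilityTheory.isProbabilityMeasure_expMeasure one_pos

theorem expLaw_eq_withDensity :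
    expLaw = halfVolume.withDensity fun y => ENNReal.ofReal (Real.exp (-y)) := by
  rw [halfVolume, Measure.restrict_congr_set Ioi_ae_eq_Ici,
    ← withDensity_indicator measurableSet_Ici]
  change volume.withDensity (ProbabilityTheory.exponentialPDF 1) = _
  congr 1 with y
  by_cases hy : 0 ≤ y <;> simp [ProbabilityTheory.exponentialPDF_eq, hy]

theorem lintegral_expLaw (g : ℝ → ℝ≥0∞) :
    ∫⁻ y, g y ∂expLaw = ∫⁻ y in Ioi (0 : ℝ), ENNReal.ofReal (Real.exp (-y)) * g y := by
  rw [expLaw_eq_withDensity, lintegral_withDensity_eq_lintegral_mul_non_measurable _ (by fun_prop)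
    (Eventually.of_forall fun y => ENNReal.ofReal_lt_top)]
  rfl

theorem integral_expLaw (f : ℝ → ℂ) :
    ∫ y, f y ∂expLaw = ∫ y in Ioi (0 : ℝ), (Real.exp (-y) : ℂ) * f y := by
  rw [expLaw_eq_withDensity, integral_withDensity_eq_integral_toReal_smul (by fun_prop)
    (Eventually.of_forall fun y => ENNReal.ofReal_lt_top)]
  refine integral_congr_ae (Eventually.of_forall fun y => ?_)
  simp [ENNReal.toReal_ofReal (Real.exp_pos _).le]

theorem expLaw_absolutelyContinuous : expLaw ≪ halfVolume := by
  rw [expLaw_eq_withDensity]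
  exact withDensity_absolutelyContinuous _ _

section Averages

variable (σ : ℝ)

/-- The average `x ↦ ∫ g(x - σ y) e^{-y} dy` of a `[0, ∞]`-valued function. For `σ = 1` it
averages over the past of `x`, for `σ = -1` over its future. -/
def lexpAverage (g : ℝ → ℝ≥0∞) (x : ℝ) : ℝ≥0∞ := ∫⁻ y, g (x - σ * y) ∂expLaw

/-- The average `x ↦ ∫ f(x - σ y) e^{-y} dy` of a complex-valued function. -/
def expAverage (f : ℝ → ℂ) (x : ℝ) : ℂ := ∫ y, f (x - σ * y) ∂expLaw

theorem measurable_sub_mul : Measurable fun z : ℝ × ℝ => z.1 - σ * z.2 := by fun_prop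

theorem measurable_lexpAverage {g : ℝ → ℝ≥0∞} (hg : Measurable g) :
    Measurable (lexpAverage σ g) :=
  Measurable.lintegral_prod_right' (f := fun z : ℝ × ℝ => g (z.1 - σ * z.2))
    (hg.comp (measurable_sub_mul σ))

theorem stronglyMeasurable_expAverage {f : ℝ → ℂ} (hf : StronglyMeasurable f) :
    StronglyMeasurable (expAverage σ f) :=
  StronglyMeasurable.integral_prod_right (f := fun x y => f (x - σ * y))
    (hf.comp_measurable (measurable_sub_mul σ))

theorem ae_ae_sub_mul (μ : Measure ℝ) [SFinite μ] {p : ℝ → Prop} (h : ∀ᵐ x, p x) :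
    ∀ᵐ x : ℝ, ∀ᵐ y ∂μ, p (x - σ * y) :=
  Measure.ae_ae_of_ae_prod <|
    (QuasiMeasurePreserving.prod_of_left (measurable_sub_mul σ) <| Eventually.of_forall fun y =>
      (measurePreserving_sub_right volume (σ * y)).quasiMeasurePreserving).ae h

theorem lexpAverage_congr_ae {g h : ℝ → ℝ≥0∞} (hgh : g =ᵐ[volume] h) :
    lexpAverage σ g =ᵐ[volume] lexpAverage σ h := by
  filter_upwards [ae_ae_sub_mul σ expLaw hgh] with x hx
  exact lintegral_congr_ae hx

theorem expAverage_congr_ae {f g : ℝ → ℂ} (hfg : f =ᵐ[volume] g) :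
    expAverage σ f =ᵐ[volume] expAverage σ g := by
  filter_upwards [ae_ae_sub_mul σ expLaw hfg] with x hx
  exact integral_congr_ae hx

theorem enorm_expAverage_le (f : ℝ → ℂ) (x : ℝ) :
    ‖expAverage σ f x‖ₑ ≤ lexpAverage σ (fun x => ‖f x‖ₑ) x :=
  enorm_integral_le_lintegral_enorm _

theorem lintegral_lexpAverage {g : ℝ → ℝ≥0∞} (hg : Measurable g) :
    ∫⁻ x, lexpAverage σ g x = ∫⁻ x, g x := by
  calc ∫⁻ x, (∫⁻ y, g (x - σ * y) ∂expLaw)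
      = ∫⁻ y, (∫⁻ x, g (x - σ * y)) ∂expLaw :=
        lintegral_lintegral_swap (hg.comp (measurable_sub_mul σ)).aemeasurable
    _ = ∫⁻ _, (∫⁻ x, g x) ∂expLaw :=
        lintegral_congr fun y => lintegral_sub_right_eq_self g (σ * y)
    _ = ∫⁻ x, g x := by simp

/-- The average `expAverage` of a class of functions. -/
def expAverageFun (f : ℝ →ₘ[volume] ℂ) : ℝ →ₘ[volume] ℂ :=
  AEEqFun.mk (expAverage σ f)
    (stronglyMeasurable_expAverage σ f.stronglyMeasurable).aestronglyMeasurable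

theorem coeFn_expAverageFun (f : ℝ →ₘ[volume] ℂ) :
    expAverageFun σ f =ᵐ[volume] expAverage σ f :=
  AEEqFun.coeFn_mk _ _

variable {σ}

theorem ae_integrable_sub_mul {f : ℝ →ₘ[volume] ℂ}
    (hf : ∀ᵐ x, lexpAverage σ (fun x => ‖f x‖ₑ) x < ∞) :
    ∀ᵐ x, Integrable (fun y => f (x - σ * y)) expLaw := by
  filter_upwards [hf] with x hx
  exact ⟨(f.stronglyMeasurable.comp_measurable (by fun_prop)).aestronglyMeasurable, hx⟩

theorem expAverageFun_add {f g : ℝ →ₘ[volume] ℂ}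
    (hf : ∀ᵐ x, lexpAverage σ (fun x => ‖f x‖ₑ) x < ∞)
    (hg : ∀ᵐ x, lexpAverage σ (fun x => ‖g x‖ₑ) x < ∞) :
    expAverageFun σ (f + g) = expAverageFun σ f + expAverageFun σ g := by
  refine AEEqFun.ext ?_
  filter_upwards [coeFn_expAverageFun σ (f + g), coeFn_expAverageFun σ f, coeFn_expAverageFun σ g,
    AEEqFun.coeFn_add (expAverageFun σ f) (expAverageFun σ g), ae_integrable_sub_mul hf,
    ae_integrable_sub_mul hg, expAverage_congr_ae σ (AEEqFun.coeFn_add f g)]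
    with x hfg_mk hf_mk hg_mk hadd hf_int hg_int hcongr
  rw [hfg_mk, hadd, Pi.add_apply, hf_mk, hg_mk, hcongr]
  exact integral_add hf_int hg_int

theorem expAverageFun_smul (c : ℂ) (f : ℝ →ₘ[volume] ℂ) :
    expAverageFun σ (c • f) = c • expAverageFun σ f := by
  refine AEEqFun.ext ?_
  filter_upwards [coeFn_expAverageFun σ (c • f), coeFn_expAverageFun σ f,
    AEEqFun.coeFn_smul c (expAverageFun σ f), expAverage_congr_ae σ (AEEqFun.coeFn_smul c f)]
    with x hcf_mk hf_mk hsmul hcongr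
  rw [hcf_mk, hsmul, Pi.smul_apply, hf_mk, hcongr]
  exact integral_smul c _

end Averages

namespace FunctionNorm

variable {ρ : FunctionNorm volume} {σ : ℝ}

/-- Boundedness of the averages `lexpAverage σ` of moduli in a function norm. -/
def AveragingBounded (ρ : FunctionNorm volume) (σ : ℝ) : Prop :=
  ∃ C : ℝ≥0, ∀ f : ℝ →ₘ[volume] ℂ, ρ.toFun (lexpAverage σ fun x => ‖f x‖ₑ) ≤ C * ρ.eval f

namespace AveragingBounded

theorem ae_lt_top (h : ρ.AveragingBounded σ) {f : ℝ →ₘ[volume] ℂ} (hf : f ∈ ρ.space) :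
    ∀ᵐ x, lexpAverage σ (fun x => ‖f x‖ₑ) x < ∞ := by
  obtain ⟨C, hC⟩ := h
  exact ρ.ae_lt_top (measurable_lexpAverage σ f.stronglyMeasurable.enorm).aemeasurable
    ((hC f).trans_lt (ENNReal.mul_lt_top ENNReal.coe_lt_top hf))

theorem eval_expAverageFun_le (h : ρ.AveragingBounded σ) (f : ℝ →ₘ[volume] ℂ) :
    ρ.eval (expAverageFun σ f) ≤ h.choose * ρ.eval f := by
  refine le_trans (ρ.mono ?_) (h.choose_spec f)
  filter_upwards [coeFn_expAverageFun σ f] with x hx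
  rw [hx]
  exact enorm_expAverage_le σ f x

/-- The bounded operator `f ↦ ∫ f(· - σ y) e^{-y} dy` on a function space. -/
def toCLM (h : ρ.AveragingBounded σ) : ρ.space →L[ℂ] ρ.space :=
  LinearMap.mkContinuous
    { toFun := fun f => ⟨expAverageFun σ f, (h.eval_expAverageFun_le f).trans_lt
        (ENNReal.mul_lt_top ENNReal.coe_lt_top f.2)⟩
      map_add' := fun f g => Subtype.ext (expAverageFun_add (h.ae_lt_top f.2) (h.ae_lt_top g.2))
      map_smul' := fun c f => Subtype.ext (expAverageFun_smul c f) }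
    h.choose fun f => by
      simpa [norm_def] using ENNReal.toReal_mono
        (ENNReal.mul_ne_top ENNReal.coe_ne_top f.2.ne) (h.eval_expAverageFun_le f)

end AveragingBounded

end FunctionNorm

/-! ### Averages in `L²` -/

theorem rpow_lintegral_le {α : Type*} {mα : MeasurableSpace α} {μ : Measure α}
    [IsProbabilityMeasure μ] {g : α → ℝ≥0∞} (hg : AEMeasurable g μ) {r : ℝ} (hr : 1 ≤ r) :
    (∫⁻ y, g y ∂μ) ^ r ≤ ∫⁻ y, g y ^ r ∂μ := by
  have hr0 : 0 < r := zero_lt_one.trans_le hr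
  have power_mean := eLpNorm'_le_eLpNorm'_of_exponent_le (μ := μ) one_pos hr
    hg.aestronglyMeasurable
  simp only [eLpNorm'_eq_lintegral_enorm, enorm_eq_self, ENNReal.rpow_one, div_one]
    at power_mean
  exact (ENNReal.rpow_le_rpow power_mean hr0.le).trans_eq (by
    rw [← ENNReal.rpow_mul, one_div_mul_cancel hr0.ne', ENNReal.rpow_one])

theorem lintegral_rpow_lexpAverage_le (σ : ℝ) {g : ℝ → ℝ≥0∞} (hg : Measurable g) {r : ℝ}
    (hr : 1 ≤ r) : ∫⁻ x, lexpAverage σ g x ^ r ≤ ∫⁻ x, g x ^ r := by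
  rw [← lintegral_lexpAverage σ (hg.pow_const r)]
  exact lintegral_mono fun x => rpow_lintegral_le (by fun_prop) hr

theorem eLpNorm_expAverageFun_le (σ : ℝ) (f : ℝ →ₘ[volume] ℂ) {p : ℝ≥0∞} (hp : 1 ≤ p)
    (hp_top : p ≠ ∞) : eLpNorm (expAverageFun σ f) p volume ≤ eLpNorm f p volume := by
  have hp0 : p ≠ 0 := (zero_lt_one.trans_le hp).ne'
  rw [eLpNorm_congr_ae (coeFn_expAverageFun σ f),
    eLpNorm_eq_lintegral_rpow_enorm_toReal hp0 hp_top,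
    eLpNorm_eq_lintegral_rpow_enorm_toReal hp0 hp_top]
  gcongr ?_ ^ _
  calc ∫⁻ x, ‖expAverage σ f x‖ₑ ^ p.toReal
      ≤ ∫⁻ x, lexpAverage σ (fun x => ‖f x‖ₑ) x ^ p.toReal := by
        gcongr
        exact enorm_expAverage_le σ f _
    _ ≤ ∫⁻ x, ‖f x‖ₑ ^ p.toReal :=
        lintegral_rpow_lexpAverage_le σ f.stronglyMeasurable.enorm
          (by simpa using ENNReal.toReal_mono hp_top hp)

theorem ae_lexpAverage_lt_top_of_memLp (σ : ℝ) {f : ℝ →ₘ[volume] ℂ} {p : ℝ≥0∞} (hp : 1 ≤ p)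
    (hp_top : p ≠ ∞) (hf : MemLp f p volume) :
    ∀ᵐ x, lexpAverage σ (fun x => ‖f x‖ₑ) x < ∞ := by
  have hp1 : 1 ≤ p.toReal := by simpa using ENNReal.toReal_mono hp_top hp
  have hf_meas := f.stronglyMeasurable.enorm
  have hfin : ∫⁻ x, lexpAverage σ (fun x => ‖f x‖ₑ) x ^ p.toReal ≠ ∞ :=
    ((lintegral_rpow_lexpAverage_le σ hf_meas hp1).trans_lt
      (lintegral_rpow_enorm_lt_top_of_eLpNorm_lt_top (zero_lt_one.trans_le hp).ne' hp_top
        hf.2)).ne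
  filter_upwards [ae_lt_top ((measurable_lexpAverage σ hf_meas).pow_const _) hfin] with x hx
  exact (ENNReal.rpow_lt_top_iff_of_pos (zero_lt_one.trans_le hp1)).1 hx

/-- The operator `f ↦ ∫ f(· - σ y) e^{-y} dy` on `L²(ℝ)`. -/
def expAverageL2 (σ : ℝ) : Lp ℂ 2 (volume : Measure ℝ) →L[ℂ] Lp ℂ 2 (volume : Measure ℝ) :=
  LinearMap.mkContinuous
    { toFun := fun f => ⟨expAverageFun σ f, Lp.mem_Lp_iff_eLpNorm_lt_top.2
        ((eLpNorm_expAverageFun_le σ f one_le_two ENNReal.ofNat_ne_top).trans_lt (Lp.memLp f).2)⟩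
      map_add' := fun f g => Subtype.ext <| expAverageFun_add
        (ae_lexpAverage_lt_top_of_memLp σ one_le_two ENNReal.ofNat_ne_top (Lp.memLp f))
        (ae_lexpAverage_lt_top_of_memLp σ one_le_two ENNReal.ofNat_ne_top (Lp.memLp g))
      map_smul' := fun c f => Subtype.ext (expAverageFun_smul c f) }
    1 fun f => by
      rw [one_mul, Lp.norm_def, Lp.norm_def]
      exact ENNReal.toReal_mono (Lp.memLp f).2.ne
        (eLpNorm_expAverageFun_le σ f one_le_two ENNReal.ofNat_ne_top)

/-! ### The Fourier symbol of the averages -/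

theorem ofReal_add_I_ne_zero (ξ : ℝ) : (ξ : ℂ) + Complex.I ≠ 0 := fun h => by
  simpa using congrArg Complex.im h

theorem ofReal_sub_I_ne_zero (ξ : ℝ) : (ξ : ℂ) - Complex.I ≠ 0 := fun h => by
  simpa using congrArg Complex.im h

theorem one_add_mul_I_ne_zero (t : ℝ) : (1 : ℂ) + t * Complex.I ≠ 0 := fun h => by
  simpa using congrArg Complex.re h

/-- The characteristic function `η ↦ ∫ e^{-2πiση y} e^{-y} dy = (1 + 2πiση)⁻¹` of the exponential
distribution scaled by `σ`, in Mathlib's normalization of the Fourier transform. -/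
def expSymbol (σ η : ℝ) : ℂ := (1 + (2 * Real.pi * σ * η : ℝ) * Complex.I)⁻¹

theorem integral_cexp_expLaw (t : ℝ) :
    ∫ y : ℝ, Complex.exp (-(t * y) * Complex.I) ∂expLaw = (1 + t * Complex.I)⁻¹ := by
  have exponents (y : ℝ) : (Real.exp (-y) : ℂ) * Complex.exp (-(t * y) * Complex.I)
      = Complex.exp (-(1 + t * Complex.I) * y) := by
    rw [Complex.ofReal_exp, ← Complex.exp_add]
    push_cast
    ring_nf
  simp_rw [integral_expLaw, exponents]
  rw [integral_exp_mul_complex_Ioi (by simp)]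
  rw [Complex.ofReal_zero, mul_zero, Complex.exp_zero, neg_div_neg_eq, one_div]

theorem continuous_expSymbol (σ : ℝ) : Continuous (expSymbol σ) :=
  Continuous.inv₀ (by fun_prop) fun η => one_add_mul_I_ne_zero (2 * Real.pi * σ * η)

theorem norm_expSymbol_le (σ η : ℝ) : ‖expSymbol σ η‖ ≤ 1 := by
  rw [expSymbol, norm_inv]
  refine inv_le_one_of_one_le₀ ?_
  simpa using Complex.abs_re_le_norm (1 + (2 * Real.pi * σ * η : ℝ) * Complex.I)

theorem memLp_expSymbol (σ : ℝ) : MemLp (expSymbol σ) ∞ (volume : Measure ℝ) :=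
  memLp_top_of_bound (continuous_expSymbol σ).aestronglyMeasurable 1
    (Eventually.of_forall (norm_expSymbol_le σ))

theorem inv_one_add_mul_I_eq (t : ℝ) :
    (1 + t * Complex.I : ℂ)⁻¹ = ((1 + ‖t‖ ^ 2) ^ (-1 : ℝ) : ℝ) * (1 - t * Complex.I) := by
  have norm_sq_pos : (0 : ℝ) < 1 + t ^ 2 := by positivity
  refine inv_eq_of_mul_eq_one_right ?_
  rw [Real.rpow_neg_one, Real.norm_eq_abs, sq_abs, Complex.ofReal_inv, mul_left_comm,
    inv_mul_eq_one₀ (by exact_mod_cast norm_sq_pos.ne')]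
  push_cast
  linear_combination (t : ℂ) ^ 2 * Complex.I_sq

theorem hasTemperateGrowth_expSymbol (σ : ℝ) : (expSymbol σ).HasTemperateGrowth := by
  have inv_norm_sq : (fun η : ℝ => (1 + ‖2 * Real.pi * σ * η‖ ^ 2) ^ (-1 : ℝ)).HasTemperateGrowth :=
    (Function.hasTemperateGrowth_one_add_norm_sq_rpow ℝ (-1)).comp
      (f := fun η : ℝ => 2 * Real.pi * σ * η) (by fun_prop)
  have conj_denom :
      (fun η : ℝ => 1 - (2 * Real.pi * σ * η : ℝ) * Complex.I).HasTemperateGrowth := by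
    push_cast
    fun_prop
  unfold expSymbol
  simp_rw [inv_one_add_mul_I_eq]
  exact (Function.Complex.hasTemperateGrowth_ofReal.comp inv_norm_sq).mul conj_denom

section Schwartz

open scoped SchwartzMap

/-- The average `expAverage σ f` of a Schwartz function, defined on the Fourier side. -/
def schwartzExpAverage (σ : ℝ) (f : 𝓢(ℝ, ℂ)) : 𝓢(ℝ, ℂ) :=
  𝓕⁻ (SchwartzMap.smulLeftCLM ℂ (expSymbol σ) (𝓕 f))

theorem fourier_schwartzExpAverage (σ : ℝ) (f : 𝓢(ℝ, ℂ)) (η : ℝ) :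
    𝓕 (schwartzExpAverage σ f) η = expSymbol σ η * 𝓕 f η := by
  rw [schwartzExpAverage, FourierTransform.fourier_fourierInv_eq,
    SchwartzMap.smulLeftCLM_apply_apply (hasTemperateGrowth_expSymbol σ), smul_eq_mul]

theorem schwartz_eq_integral_fourier (f : 𝓢(ℝ, ℂ)) (x : ℝ) :
    f x = ∫ η : ℝ, Complex.exp ((2 * Real.pi * (η * x) : ℝ) * Complex.I) * 𝓕 f η := by
  conv_lhs => rw [← FourierTransform.fourierInv_fourier_eq (F := 𝓢(ℝ, ℂ)) f]
  rw [SchwartzMap.fourierInv_coe, Real.fourierInv_eq']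
  simp [mul_comm]

theorem expAverage_schwartz (σ : ℝ) (f : 𝓢(ℝ, ℂ)) : expAverage σ f = schwartzExpAverage σ f := by
  ext x
  set e : ℝ → ℝ → ℂ := fun z η => Complex.exp ((2 * Real.pi * (η * z) : ℝ) * Complex.I) with he
  have e_continuous : Continuous fun z : ℝ × ℝ => e (x - σ * z.1) z.2 := by fun_prop
  have e_average (η : ℝ) : ∫ y, e (x - σ * y) η ∂expLaw = e x η * expSymbol σ η := by
    rw [expSymbol, ← integral_cexp_expLaw, ← integral_const_mul]
    congr 1 with y
    rw [he, ← Complex.exp_add]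
    push_cast
    ring_nf
  have integrable_kernel : Integrable (fun z : ℝ × ℝ => e (x - σ * z.1) z.2 * 𝓕 f z.2)
      (expLaw.prod volume) :=
    ((𝓕 f).integrable.comp_snd expLaw).bdd_mul (c := 1) e_continuous.aestronglyMeasurable
      (Eventually.of_forall fun z => (Complex.norm_exp_ofReal_mul_I _).le)
  calc expAverage σ f x
      = ∫ y, (∫ η, e (x - σ * y) η * 𝓕 f η) ∂expLaw := by
        simp only [expAverage, schwartz_eq_integral_fourier f, he]
    _ = ∫ η, ∫ y, e (x - σ * y) η * 𝓕 f η ∂expLaw := integral_integral_swap integrable_kernel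
    _ = ∫ η, e x η * 𝓕 (schwartzExpAverage σ f) η := by
        simp only [integral_mul_const, e_average, fourier_schwartzExpAverage, mul_assoc]
    _ = schwartzExpAverage σ f x := (schwartz_eq_integral_fourier _ x).symm

end Schwartz

/-- Multiplication by `expSymbol σ` on `L²(ℝ)`. -/
def expSymbolMul (σ : ℝ) : Lp ℂ 2 (volume : Measure ℝ) →L[ℂ] Lp ℂ 2 (volume : Measure ℝ) :=
  (ContinuousLinearMap.mul ℂ ℂ).holderL volume ∞ 2 2 ((memLp_expSymbol σ).toLp _)

theorem coeFn_expSymbolMul (σ : ℝ) (u : Lp ℂ 2 (volume : Measure ℝ)) :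
    expSymbolMul σ u =ᵐ[volume] fun η => expSymbol σ η * u η := by
  have coeFn_holder : expSymbolMul σ u =ᵐ[volume] _ :=
    ContinuousLinearMap.coeFn_holder (r := 2) (B := ContinuousLinearMap.mul ℂ ℂ)
      ((memLp_expSymbol σ).toLp _) u
  filter_upwards [coeFn_holder, (memLp_expSymbol σ).coeFn_toLp] with η h_holder h_symbol
  rw [h_holder, h_symbol]
  rfl

theorem expAverageL2_toLp_schwartz (σ : ℝ) (f : SchwartzMap ℝ ℂ) :
    expAverageL2 σ (f.toLp 2) = (schwartzExpAverage σ f).toLp 2 := by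
  have coeFn_average : expAverageL2 σ (f.toLp 2) =ᵐ[volume] expAverage σ (f.toLp 2 : ℝ → ℂ) :=
    coeFn_expAverageFun σ _
  refine Lp.ext (coeFn_average.trans ((expAverage_congr_ae σ (f.coeFn_toLp 2)).trans ?_))
  rw [expAverage_schwartz]
  exact ((schwartzExpAverage σ f).coeFn_toLp 2).symm

theorem fourier_expAverageL2 (σ : ℝ) (u : Lp ℂ 2 (volume : Measure ℝ)) :
    𝓕 (expAverageL2 σ u) = expSymbolMul σ (𝓕 u) := by
  refine (SchwartzMap.denseRange_toLpCLM (E := ℝ) (F := ℂ) (p := 2)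
    ENNReal.ofNat_ne_top).induction_on (p := fun u => 𝓕 (expAverageL2 σ u) = expSymbolMul σ (𝓕 u))
    u ?_ fun f => ?_
  · have fourier_continuous : Continuous fun u : Lp ℂ 2 (volume : Measure ℝ) => 𝓕 u :=
      (Lp.fourierTransformₗᵢ ℝ ℂ).continuous
    exact isClosed_eq (fourier_continuous.comp (expAverageL2 σ).continuous)
      ((expSymbolMul σ).continuous.comp fourier_continuous)
  · rw [SchwartzMap.toLpCLM_apply, expAverageL2_toLp_schwartz, SchwartzMap.toLp_fourier_eq,
      SchwartzMap.toLp_fourier_eq]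
    refine Lp.ext ?_
    filter_upwards [(𝓕 (schwartzExpAverage σ f)).coeFn_toLp 2,
      coeFn_expSymbolMul σ ((𝓕 f).toLp 2), (𝓕 f).coeFn_toLp 2] with η h_lhs h_mul h_rhs
    rw [h_lhs, h_mul, h_rhs, fourier_schwartzExpAverage]

/-! ### Operators realizing a symbol -/

theorem quasiMeasurePreserving_neg_div_two_pi :
    Measure.QuasiMeasurePreserving (fun ξ : ℝ => -ξ / (2 * Real.pi)) volume volume := by
  have scale_ne_zero : -(2 * Real.pi)⁻¹ ≠ 0 := neg_ne_zero.2 (by positivity)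
  have as_mul : (fun ξ : ℝ => -ξ / (2 * Real.pi)) = fun ξ => -(2 * Real.pi)⁻¹ * ξ := by
    ext ξ
    ring
  rw [as_mul]
  refine ⟨by fun_prop, ?_⟩
  rw [Real.map_volume_mul_left scale_ne_zero]
  exact Measure.smul_absolutelyContinuous

theorem fourierL2_add (u v : Lp ℂ 2 (volume : Measure ℝ)) :
    fourierL2 (u + v) =ᵐ[volume] fourierL2 u + fourierL2 v := by
  have h := Lp.coeFn_add (𝓕 u) (𝓕 v)
  rw [← FourierTransform.fourier_add] at h
  exact quasiMeasurePreserving_neg_div_two_pi.ae h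

theorem fourierL2_smul (c : ℂ) (u : Lp ℂ 2 (volume : Measure ℝ)) :
    fourierL2 (c • u) =ᵐ[volume] c • fourierL2 u := by
  have h := Lp.coeFn_smul c (𝓕 u)
  rw [← FourierTransform.fourier_smul] at h
  exact quasiMeasurePreserving_neg_div_two_pi.ae h

theorem expSymbol_neg_div_two_pi (σ ξ : ℝ) :
    expSymbol σ (-ξ / (2 * Real.pi)) = (1 - Complex.I * σ * ξ)⁻¹ := by
  have rescale : 2 * Real.pi * σ * (-ξ / (2 * Real.pi)) = -(σ * ξ) := by
    field_simp
  rw [expSymbol, rescale]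
  push_cast
  ring_nf

theorem isConvolutionL2_expAverageL2 (σ : ℝ) (u : Lp ℂ 2 (volume : Measure ℝ)) :
    IsConvolutionL2 (fun ξ => (1 - Complex.I * σ * ξ)⁻¹) u (expAverageL2 σ u) := by
  have h := coeFn_expSymbolMul σ (𝓕 u)
  rw [← fourier_expAverageL2] at h
  simp only [← expSymbol_neg_div_two_pi]
  exact quasiMeasurePreserving_neg_div_two_pi.ae h

/-- The symbol of the identity minus twice the averaging operator `expAverage σ`. -/
def reflectionSymbol (σ ξ : ℝ) : ℂ := 1 - 2 * (1 - Complex.I * σ * ξ)⁻¹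

theorem isConvolutionL2_sub_expAverageL2 (σ : ℝ) (u : Lp ℂ 2 (volume : Measure ℝ)) :
    IsConvolutionL2 (reflectionSymbol σ) u (u + (-2 : ℂ) • expAverageL2 σ u) := by
  filter_upwards [fourierL2_add u ((-2 : ℂ) • expAverageL2 σ u),
    fourierL2_smul (-2) (expAverageL2 σ u), isConvolutionL2_expAverageL2 σ u]
    with ξ hadd hsmul haverage
  rw [hadd, Pi.add_apply, hsmul, Pi.smul_apply, haverage, smul_eq_mul, reflectionSymbol]
  ring

theorem reflectionSymbol_one : reflectionSymbol 1 = rSymbol 1 := by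
  ext ξ
  have hξ := ofReal_add_I_ne_zero ξ
  have denom : (1 - Complex.I * (1 : ℝ) * ξ : ℂ) = -Complex.I * (ξ + Complex.I) := by
    push_cast
    linear_combination Complex.I_mul_I
  rw [reflectionSymbol, rSymbol, zpow_one, denom, mul_inv, inv_neg, Complex.inv_I]
  field_simp
  ring

theorem reflectionSymbol_neg_one : reflectionSymbol (-1) = rSymbol (-1) := by
  ext ξ
  have hξ := ofReal_sub_I_ne_zero ξ
  have denom : (1 - Complex.I * (-1 : ℝ) * ξ : ℂ) = Complex.I * (ξ - Complex.I) := by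
    push_cast
    linear_combination Complex.I_mul_I
  rw [reflectionSymbol, rSymbol, zpow_neg_one, inv_div, denom, mul_inv, Complex.inv_I]
  field_simp
  ring

theorem rSymbol_natCast (n : ℕ) : rSymbol n = rSymbol 1 ^ n := by
  ext ξ
  simp [rSymbol]

theorem rSymbol_neg_natCast (n : ℕ) : rSymbol (-n) = rSymbol (-1) ^ n := by
  ext ξ
  simp [rSymbol, ← inv_pow]

theorem rSymbol_neg_one_mul_rSymbol_one : rSymbol (-1) * rSymbol 1 = 1 := by
  ext ξ
  simp [rSymbol, ofReal_sub_I_ne_zero ξ, ofReal_add_I_ne_zero ξ]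

theorem norm_rSymbol (n : ℤ) (ξ : ℝ) : ‖rSymbol n ξ‖ = 1 := by
  have conj_eq : ‖(ξ : ℂ) - Complex.I‖ = ‖(ξ : ℂ) + Complex.I‖ := by
    rw [← Complex.norm_conj ((ξ : ℂ) + Complex.I)]
    simp [sub_eq_add_neg]
  rw [rSymbol, norm_zpow, norm_div, conj_eq,
    div_self (norm_ne_zero_iff.2 (ofReal_add_I_ne_zero ξ)), one_zpow]

theorem memLp_rSymbol (n : ℤ) : MemLp (rSymbol n) ∞ (volume : Measure ℝ) := by
  have h_cont : Continuous (rSymbol n) :=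
    (Continuous.div (by fun_prop) (by fun_prop) ofReal_add_I_ne_zero).zpow₀ n fun ξ =>
      Or.inl (div_ne_zero (ofReal_sub_I_ne_zero ξ) (ofReal_add_I_ne_zero ξ))
  exact memLp_top_of_bound h_cont.aestronglyMeasurable 1
    (Eventually.of_forall fun ξ => (norm_rSymbol n ξ).le)

/-! ### Fredholm index of operators with a one-sided inverse -/

theorem rank_ker_comp_of_surjective.{u, v} {K : Type*} {V W : Type u} {U : Type v} [DivisionRing K]
    [AddCommGroup V] [Module K V] [AddCommGroup W] [Module K W] [AddCommGroup U] [Module K U]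
    (f : W →ₗ[K] U) {g : V →ₗ[K] W} (hg : Function.Surjective g) :
    Module.rank K (f ∘ₗ g).ker = Module.rank K f.ker + Module.rank K g.ker := by
  set q : (f ∘ₗ g).ker →ₗ[K] f.ker := g.restrict fun _ hx => hx
  have q_surjective : Function.Surjective q := by
    rintro ⟨y, hy⟩
    obtain ⟨x, rfl⟩ := hg y
    exact ⟨⟨x, hy⟩, rfl⟩
  have q_ker : q.ker = g.ker.comap (f ∘ₗ g).ker.subtype := by
    exact Submodule.ext fun x => Subtype.ext_iff
  rw [LinearMap.rank_eq_of_surjective q_surjective, q_ker,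
    (Submodule.comapSubtypeEquivOfLe (LinearMap.ker_le_ker_comp g f)).rank_eq]

theorem rank_ker_pow_of_surjective {K V : Type*} [DivisionRing K] [AddCommGroup V] [Module K V]
    {f : V →ₗ[K] V} (hf : Function.Surjective f) (n : ℕ) :
    Module.rank K (f ^ n).ker = n * Module.rank K f.ker := by
  induction n with
  | zero =>
    have ker_one : (1 : V →ₗ[K] V).ker = ⊥ := LinearMap.ker_id
    rw [pow_zero, ker_one, rank_bot, Nat.cast_zero, zero_mul]
  | succ n ih =>
    rw [pow_succ, Module.End.mul_eq_comp, rank_ker_comp_of_surjective _ hf, ih]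
    push_cast
    ring

theorem finite_ker_pow_of_surjective {K V : Type*} [DivisionRing K] [AddCommGroup V] [Module K V]
    {f : V →ₗ[K] V} (hf : Function.Surjective f) [Module.Finite K f.ker] (n : ℕ) :
    Module.Finite K (f ^ n).ker := by
  rw [← Module.rank_lt_aleph0_iff, rank_ker_pow_of_surjective hf]
  exact Cardinal.mul_lt_aleph0 Cardinal.natCast_lt_aleph0 (Module.rank_lt_aleph0 K _)

theorem finrank_ker_pow_of_surjective {K V : Type*} [DivisionRing K] [AddCommGroup V] [Module K V]
    {f : V →ₗ[K] V} (hf : Function.Surjective f) (n : ℕ) :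
    Module.finrank K (f ^ n).ker = n * Module.finrank K f.ker := by
  rw [Module.finrank, rank_ker_pow_of_surjective hf, Cardinal.toNat_mul, Cardinal.toNat_natCast,
    Module.finrank]

section OneSidedInverse

variable {E : Type*} [NormedAddCommGroup E] [NormedSpace ℂ E] {A B : E →L[ℂ] E}

theorem leftInverse_of_mul_eq_one (h : B * A = 1) : Function.LeftInverse B A :=
  fun x => congrArg (fun T : E →L[ℂ] E => T x) h

theorem surjective_of_mul_eq_one (h : B * A = 1) : Function.Surjective B :=
  (leftInverse_of_mul_eq_one h).surjective

theorem isCompl_range_ker_of_mul_eq_one (h : B * A = 1) : IsCompl A.range B.ker := by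
  have left_inv := leftInverse_of_mul_eq_one h
  have idempotent : IsIdempotentElem ((A : E →ₗ[ℂ] E) * (B : E →ₗ[ℂ] E)) := by
    ext x
    simp [left_inv (B x)]
  rw [← LinearMap.range_comp_of_range_eq_top _ (LinearMap.range_eq_top.2 left_inv.surjective),
    ← LinearMap.ker_comp_of_ker_eq_bot _ (LinearMap.ker_eq_bot.2 left_inv.injective)]
  exact LinearMap.IsIdempotentElem.isCompl idempotent

theorem finiteDimensional_ker_pow_of_mul_eq_one (h : B * A = 1) [FiniteDimensional ℂ B.ker]
    (n : ℕ) : FiniteDimensional ℂ (B ^ n).ker := by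
  rw [ContinuousLinearMap.toLinearMap_pow]
  exact finite_ker_pow_of_surjective (surjective_of_mul_eq_one h) n

theorem finrank_ker_pow_of_mul_eq_one (h : B * A = 1) (n : ℕ) :
    Module.finrank ℂ (B ^ n).ker = n * Module.finrank ℂ B.ker := by
  rw [ContinuousLinearMap.toLinearMap_pow]
  exact finrank_ker_pow_of_surjective (surjective_of_mul_eq_one h) n

open scoped LinearMap.FiniteRangeSetoid in
theorem isQuasiInverse_of_mul_eq_one (h : B * A = 1) [FiniteDimensional ℂ B.ker] :
    LinearMap.IsQuasiInverse (B : E →ₗ[ℂ] E) (A : E →ₗ[ℂ] E) := by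
  have left_inv := leftInverse_of_mul_eq_one h
  have comp_eq_id : (B : E →ₗ[ℂ] E) ∘ₗ (A : E →ₗ[ℂ] E) = LinearMap.id := LinearMap.ext left_inv
  refine ⟨by rw [LinearMap.IsLeftQuasiInverse, comp_eq_id], ?_⟩
  rw [LinearMap.IsRightQuasiInverse, Setoid.comm,
    LinearMap.FiniteRangeSetoid.equiv_iff_hasNoetherianRange,
    LinearMap.hasNoetherianRange_iff_range]
  have range_le : LinearMap.range (LinearMap.id - (A : E →ₗ[ℂ] E) ∘ₗ (B : E →ₗ[ℂ] E)) ≤ B.ker := by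
    rintro _ ⟨x, rfl⟩
    simp [left_inv (B x)]
  exact isNoetherian_of_le range_le

theorem isFredholm_of_leftInverse (h : B * A = 1) [FiniteDimensional ℂ B.ker] : A.IsFredholm :=
  .of_isQuasiInverse (isQuasiInverse_of_mul_eq_one h)

theorem isFredholm_of_rightInverse (h : B * A = 1) [FiniteDimensional ℂ B.ker] : B.IsFredholm :=
  .of_isQuasiInverse (isQuasiInverse_of_mul_eq_one h).symm

theorem fredholmIndex_of_leftInverse (h : B * A = 1) :
    fredholmIndex A = -(Module.finrank ℂ B.ker : ℤ) := by
  have ker_eq : A.ker = ⊥ := LinearMap.ker_eq_bot.2 (leftInverse_of_mul_eq_one h).injective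
  rw [fredholmIndex, ker_eq, finrank_bot,
    (Submodule.quotientEquivOfIsCompl _ _ (isCompl_range_ker_of_mul_eq_one h)).finrank_eq]
  simp

theorem fredholmIndex_of_rightInverse (h : B * A = 1) :
    fredholmIndex B = Module.finrank ℂ B.ker := by
  have range_eq : B.range = ⊤ := LinearMap.range_eq_top.2 (surjective_of_mul_eq_one h)
  have : Subsingleton (E ⧸ B.range) := Submodule.Quotient.subsingleton_iff.2 range_eq
  rw [fredholmIndex, Module.finrank_zero_of_subsingleton (M := E ⧸ B.range), Nat.cast_zero,
    sub_zero]

end OneSidedInverse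

/-! ### Fourier convolution operators and their compressions -/

section Multipliers

variable {X : SpacePair} {a b : ℝ → ℂ} {S T : X.line.space →L[ℂ] X.line.space}

theorem ExtendsConvolution.mul (hS : ExtendsConvolution X a S) (hT : ExtendsConvolution X b T) :
    ExtendsConvolution X (a * b) (S * T) := by
  intro f u hfu
  obtain ⟨v, hv, hTv⟩ := hT f u hfu
  obtain ⟨w, hw, hSw⟩ := hS (T f) v hTv
  refine ⟨w, ?_, hSw⟩
  filter_upwards [hv, hw] with ξ hvξ hwξ
  rw [hwξ, hvξ, Pi.mul_apply, mul_assoc]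

theorem extendsConvolution_one : ExtendsConvolution X 1 1 := fun _ u hfu =>
  ⟨u, Eventually.of_forall fun _ => (one_mul _).symm, hfu⟩

theorem ExtendsConvolution.pow (hT : ExtendsConvolution X a T) (n : ℕ) :
    ExtendsConvolution X (a ^ n) (T ^ n) := by
  induction n with
  | zero => simpa only [pow_zero] using extendsConvolution_one
  | succ n ih => simpa only [pow_succ] using ih.mul hT

theorem fourierL2_injective {u v : Lp ℂ 2 (volume : Measure ℝ)}
    (h : fourierL2 u =ᵐ[volume] fourierL2 v) : u = v := by
  have scaling :
      Measure.QuasiMeasurePreserving (fun η : ℝ => -(2 * Real.pi) * η) volume volume := by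
    refine ⟨by fun_prop, ?_⟩
    rw [Real.map_volume_mul_left (neg_ne_zero.2 (by positivity))]
    exact Measure.smul_absolutelyContinuous
  have fourier_eq : 𝓕 u = 𝓕 v := by
    refine Lp.ext ?_
    filter_upwards [scaling.ae h] with η hη
    have cancel : -(-(2 * Real.pi) * η) / (2 * Real.pi) = η := by
      have := Real.pi_pos
      field_simp
    simpa only [fourierL2, cancel] using hη
  rw [← FourierTransform.fourierInv_fourier_eq (F := Lp ℂ 2 (volume : Measure ℝ)) u, fourier_eq,
    FourierTransform.fourierInv_fourier_eq]

theorem ExtendsConvolution.eq_of_memLp (hS : ExtendsConvolution X a S)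
    (hT : ExtendsConvolution X a T) {f : X.line.space}
    (hf : MemLp (f : ℝ →ₘ[volume] ℂ) 2 volume) : S f = T f := by
  obtain ⟨v, hv, hSv⟩ := hS f ⟨f, Lp.mem_Lp_iff_memLp.2 hf⟩ rfl
  obtain ⟨w, hw, hTw⟩ := hT f ⟨f, Lp.mem_Lp_iff_memLp.2 hf⟩ rfl
  have : v = w := fourierL2_injective (hv.trans hw.symm)
  exact Subtype.ext (by rw [hSv, hTw, this])

/-- Density in `X(ℝ₊)` of its square integrable functions: it determines a Fourier convolution
operator, which is given on `L²(ℝ) ∩ X(ℝ)` only, on the functions supported on the half-line. -/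
def DenseL2 (X : SpacePair) : Prop :=
  Dense {f : X.half.space | MemLp (f : ℝ →ₘ[halfVolume] ℂ) 2 halfVolume}

theorem memLp_extendFun {f : ℝ →ₘ[halfVolume] ℂ} (hf : MemLp f 2 halfVolume) :
    MemLp (extendFun f) 2 volume := by
  rw [memLp_congr_ae (coeFn_extendFun f), memLp_indicator_iff_restrict measurableSet_Ioi]
  exact hf

theorem ExtendsConvolution.apply_extend_eq (hX : DenseL2 X) (hS : ExtendsConvolution X a S)
    (hT : ExtendsConvolution X a T) (f : X.half.space) : S (X.extend f) = T (X.extend f) := by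
  have eqOn : Set.EqOn (fun f => S (X.extend f)) (fun f => T (X.extend f))
      {f : X.half.space | MemLp (f : ℝ →ₘ[halfVolume] ℂ) 2 halfVolume} := fun f hf =>
    hS.eq_of_memLp hT (memLp_extendFun hf)
  exact congrFun (Continuous.ext_on hX (by fun_prop) (by fun_prop) eqOn) f

/-- The compression `r₊ T ℓ₊` of an operator `T` on `X(ℝ)` to `X(ℝ₊)`. -/
def compression (T : X.line.space →L[ℂ] X.line.space) : X.half.space →L[ℂ] X.half.space :=
  X.restrict ∘L T ∘L X.extend

theorem compression_apply (f : X.half.space) :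
    compression T f = X.restrict (T (X.extend f)) := rfl

theorem wienerHopf_eq_compression (hX : DenseL2 X) (ha : MemLp a ∞ (volume : Measure ℝ))
    (hT : ExtendsConvolution X a T) : wienerHopf X a = compression T := by
  have multiplier : IsFourierMultiplier X a := ⟨ha, T, hT⟩
  ext1 f
  simp only [wienerHopf, fourierConvolution, dif_pos multiplier, ContinuousLinearMap.comp_apply,
    compression_apply]
  rw [ExtendsConvolution.apply_extend_eq hX multiplier.2.choose_spec hT f]

end Multipliers

/-! ### Causal and anticausal operators -/

section Causality

variable {X : SpacePair} {S T : X.line.space →L[ℂ] X.line.space}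

theorem coeFn_extend (f : X.half.space) :
    (X.extend f : ℝ →ₘ[volume] ℂ) =ᵐ[volume] (Ioi 0).indicator (f : ℝ →ₘ[halfVolume] ℂ) :=
  coeFn_extendFun _

theorem coeFn_restrict (g : X.line.space) :
    (X.restrict g : ℝ →ₘ[halfVolume] ℂ) =ᵐ[halfVolume] (g : ℝ →ₘ[volume] ℂ) :=
  coeFn_restrictFun _

theorem coeFn_extend_restrict (g : X.line.space) :
    (X.extend (X.restrict g) : ℝ →ₘ[volume] ℂ) =ᵐ[volume]
      (Ioi 0).indicator (g : ℝ →ₘ[volume] ℂ) :=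
  (coeFn_extend _).trans <|
    (ae_eq_restrict_iff_indicator_ae_eq measurableSet_Ioi).1 (coeFn_restrict g)

theorem restrict_extend (f : X.half.space) : X.restrict (X.extend f) = f := by
  refine Subtype.ext (AEEqFun.ext ((coeFn_restrict _).trans ?_))
  exact EventuallyEq.trans (ae_restrict_of_ae (coeFn_extend f))
    (indicator_ae_eq_restrict measurableSet_Ioi)

theorem extend_restrict_eq_of_ae {g : X.line.space}
    (hg : ∀ᵐ x, x ∉ Ioi (0 : ℝ) → (g : ℝ →ₘ[volume] ℂ) x = 0) :
    X.extend (X.restrict g) = g := by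
  refine Subtype.ext (AEEqFun.ext ((coeFn_extend_restrict g).trans ?_))
  filter_upwards [hg] with x hx
  exact indicator_apply_eq_self.2 hx

theorem restrict_congr_ae {g h : X.line.space}
    (hgh : (g : ℝ →ₘ[volume] ℂ) =ᵐ[halfVolume] (h : ℝ →ₘ[volume] ℂ)) :
    X.restrict g = X.restrict h :=
  Subtype.ext (AEEqFun.ext ((coeFn_restrict g).trans (hgh.trans (coeFn_restrict h).symm)))

/-- An operator on `X(ℝ)` is causal if it maps functions supported on the half-line `(0, ∞)` to
such functions. -/
def IsCausal (T : X.line.space →L[ℂ] X.line.space) : Prop :=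
  ∀ f, X.extend (X.restrict (T (X.extend f))) = T (X.extend f)

/-- An operator `T` on `X(ℝ)` is anticausal if `T g` on `(0, ∞)` only depends on `g` on
`(0, ∞)`. -/
def IsAnticausal (T : X.line.space →L[ℂ] X.line.space) : Prop :=
  ∀ g, X.restrict (T (X.extend (X.restrict g))) = X.restrict (T g)

theorem compression_one : compression (1 : X.line.space →L[ℂ] X.line.space) = 1 :=
  ContinuousLinearMap.ext restrict_extend

theorem IsCausal.compression_mul (hT : IsCausal T) :
    compression (S * T) = compression S * compression T :=
  ContinuousLinearMap.ext fun f => congrArg (X.restrict <| S ·) (hT f).symm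

theorem IsAnticausal.compression_mul (hS : IsAnticausal S) :
    compression (S * T) = compression S * compression T :=
  ContinuousLinearMap.ext fun f => (hS (T (X.extend f))).symm

theorem IsCausal.compression_pow (hT : IsCausal T) (n : ℕ) :
    compression (T ^ n) = compression T ^ n := by
  induction n with
  | zero => simpa only [pow_zero] using compression_one
  | succ n ih => rw [pow_succ, pow_succ, hT.compression_mul, ih]

theorem IsAnticausal.compression_pow (hT : IsAnticausal T) (n : ℕ) :
    compression (T ^ n) = compression T ^ n := by
  induction n with
  | zero => simpa only [pow_zero] using compression_one
  | succ n ih => rw [pow_succ', pow_succ', hT.compression_mul, ih]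

end Causality

/-! ### The operators with symbols `r₁` and `r₋₁` -/

theorem expLaw_ae_pos : ∀ᵐ y ∂expLaw, (0 : ℝ) < y :=
  expLaw_absolutelyContinuous.ae_le (ae_restrict_mem measurableSet_Ioi)

theorem expAverage_eq_zero_of_nonneg {σ : ℝ} (hσ : 0 ≤ σ) {f : ℝ → ℂ}
    (hf : ∀ᵐ x, x ∉ Ioi (0 : ℝ) → f x = 0) :
    ∀ᵐ x : ℝ, x ∉ Ioi (0 : ℝ) → expAverage σ f x = 0 := by
  filter_upwards [ae_ae_sub_mul σ expLaw hf] with x hfx hx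
  refine integral_eq_zero_of_ae ?_
  filter_upwards [hfx, expLaw_ae_pos] with y hfxy hy
  refine hfxy ?_
  rw [mem_Ioi, not_lt] at hx ⊢
  nlinarith

theorem expAverage_congr_of_nonpos {σ : ℝ} (hσ : σ ≤ 0) {f g : ℝ → ℂ}
    (hfg : ∀ᵐ x, x ∈ Ioi (0 : ℝ) → f x = g x) :
    ∀ᵐ x : ℝ, x ∈ Ioi (0 : ℝ) → expAverage σ f x = expAverage σ g x := by
  filter_upwards [ae_ae_sub_mul σ expLaw hfg] with x hfgx hx
  refine integral_congr_ae ?_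
  filter_upwards [hfgx, expLaw_ae_pos] with y hfgxy hy
  refine hfgxy ?_
  rw [mem_Ioi] at hx ⊢
  nlinarith

namespace FunctionNorm.AveragingBounded

variable {X : SpacePair} {σ : ℝ}

/-- The identity minus twice exponential averaging; its symbol `reflectionSymbol σ` is `r₁` for
`σ = 1` and `r₋₁` for `σ = -1`. -/
def reflection (h : X.line.AveragingBounded σ) : X.line.space →L[ℂ] X.line.space :=
  1 + (-2 : ℂ) • h.toCLM

theorem extendsConvolution_reflection (h : X.line.AveragingBounded σ) :
    ExtendsConvolution X (reflectionSymbol σ) h.reflection := by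
  intro f u hfu
  refine ⟨_, isConvolutionL2_sub_expAverageL2 σ u, ?_⟩
  change (f : ℝ →ₘ[volume] ℂ) + (-2 : ℂ) • expAverageFun σ f
    = (u : ℝ →ₘ[volume] ℂ) + (-2 : ℂ) • expAverageFun σ u
  rw [hfu]

theorem extendsConvolution_rSymbol_natCast (h : X.line.AveragingBounded 1) (n : ℕ) :
    ExtendsConvolution X (rSymbol n) (h.reflection ^ n) := by
  rw [rSymbol_natCast, ← reflectionSymbol_one]
  exact h.extendsConvolution_reflection.pow n

theorem extendsConvolution_rSymbol_neg_natCast (h : X.line.AveragingBounded (-1)) (n : ℕ) :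
    ExtendsConvolution X (rSymbol (-n)) (h.reflection ^ n) := by
  rw [rSymbol_neg_natCast, ← reflectionSymbol_neg_one]
  exact h.extendsConvolution_reflection.pow n

theorem coeFn_reflection (h : X.line.AveragingBounded σ) (f : X.line.space) :
    (h.reflection f : ℝ →ₘ[volume] ℂ) =ᵐ[volume]
      fun x => (f : ℝ →ₘ[volume] ℂ) x - 2 * expAverage σ (f : ℝ →ₘ[volume] ℂ) x := by
  change ((f : ℝ →ₘ[volume] ℂ) + (-2 : ℂ) • expAverageFun σ f : ℝ →ₘ[volume] ℂ) =ᵐ[volume] _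
  filter_upwards [AEEqFun.coeFn_add (f : ℝ →ₘ[volume] ℂ) ((-2 : ℂ) • expAverageFun σ f),
    AEEqFun.coeFn_smul (-2 : ℂ) (expAverageFun σ (f : ℝ →ₘ[volume] ℂ)),
    coeFn_expAverageFun σ (f : ℝ →ₘ[volume] ℂ)] with x hadd hsmul hmk
  rw [hadd, Pi.add_apply, hsmul, Pi.smul_apply, hmk, smul_eq_mul]
  ring

theorem isCausal_reflection (hσ : 0 ≤ σ) (h : X.line.AveragingBounded σ) :
    IsCausal h.reflection := by
  intro f
  have extend_eq_zero : ∀ᵐ x, x ∉ Ioi (0 : ℝ) → (X.extend f : ℝ →ₘ[volume] ℂ) x = 0 := by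
    filter_upwards [coeFn_extend f] with x hext hx
    rw [hext, indicator_of_notMem hx]
  refine extend_restrict_eq_of_ae ?_
  filter_upwards [h.coeFn_reflection (X.extend f), extend_eq_zero,
    expAverage_eq_zero_of_nonneg hσ extend_eq_zero] with x hreflection hzero haverage hx
  rw [hreflection, hzero hx, haverage hx, mul_zero, sub_zero]

theorem isAnticausal_reflection (hσ : σ ≤ 0) (h : X.line.AveragingBounded σ) :
    IsAnticausal h.reflection := by
  intro g
  have extend_restrict_eq : ∀ᵐ x, x ∈ Ioi (0 : ℝ) →
      (X.extend (X.restrict g) : ℝ →ₘ[volume] ℂ) x = (g : ℝ →ₘ[volume] ℂ) x := by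
    filter_upwards [coeFn_extend_restrict g] with x hext hx
    rw [hext, indicator_of_mem hx]
  refine restrict_congr_ae <| (ae_restrict_iff' measurableSet_Ioi).2 ?_
  filter_upwards [h.coeFn_reflection (X.extend (X.restrict g)), h.coeFn_reflection g,
    extend_restrict_eq, expAverage_congr_of_nonpos hσ extend_restrict_eq]
    with x hreflection_ext hreflection heq haverage hx
  rw [hreflection_ext, hreflection, heq hx, haverage hx]

end FunctionNorm.AveragingBounded

/-! ### The rank-one defect -/

theorem expAverage_neg_one_indicator_of_nonpos (f : ℝ → ℂ) {x : ℝ} (hx : x ≤ 0) :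
    expAverage (-1) ((Ioi 0).indicator f) x = (Real.exp x : ℂ) * ∫ y, f y ∂expLaw := by
  have shift : ∀ y, (Ioi (0 : ℝ)).indicator
      (fun y => (Real.exp (-y) : ℂ) * (Ioi 0).indicator f (x - (-1) * y)) y
      = (Ioi 0).indicator (fun z => (Real.exp x : ℂ) * ((Real.exp (-z) : ℂ) * f z)) (y + x) := by
    intro y
    have arg_eq : x - (-1) * y = y + x := by ring
    by_cases hyx : 0 < y + x
    · rw [indicator_of_mem (show y ∈ Ioi (0 : ℝ) by rw [mem_Ioi]; linarith), arg_eq,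
        indicator_of_mem (mem_Ioi.2 hyx), indicator_of_mem (mem_Ioi.2 hyx), ← mul_assoc,
        ← Complex.ofReal_mul, ← Real.exp_add]
      ring_nf
    · rw [indicator_of_notMem (s := Ioi 0) (a := y + x) hyx, indicator_apply, arg_eq,
        indicator_of_notMem (s := Ioi 0) (a := y + x) hyx, mul_zero, ite_self]
  rw [expAverage, integral_expLaw, integral_expLaw, ← integral_indicator measurableSet_Ioi,
    integral_congr_ae (Eventually.of_forall shift), integral_add_right_eq_self,
    integral_indicator measurableSet_Ioi, integral_const_mul]

theorem integral_Ioi_exp_neg_two_mul (a : ℝ) :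
    ∫ y in Ioi a, Real.exp (-2 * y) = Real.exp (-2 * a) / 2 := by
  rw [integral_exp_mul_Ioi (by norm_num) a]
  ring

theorem expAverage_one_indicator_exp {x : ℝ} (hx : 0 < x) :
    expAverage 1 ((Iic (0 : ℝ)).indicator fun z => (Real.exp z : ℂ)) x
      = (Real.exp (-x) : ℂ) / 2 := by
  have integrand : ∀ y : ℝ, (Real.exp (-y) : ℂ)
      * (Iic (0 : ℝ)).indicator (fun z => (Real.exp z : ℂ)) (x - 1 * y)
      = (Ici x).indicator (fun y => ((Real.exp x * Real.exp (-2 * y) : ℝ) : ℂ)) y := by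
    intro y
    by_cases hy : x ≤ y
    · rw [indicator_of_mem (show x - 1 * y ∈ Iic (0 : ℝ) by simpa using hy),
        indicator_of_mem (mem_Ici.2 hy), ← Complex.ofReal_mul, ← Real.exp_add, ← Real.exp_add]
      ring_nf
    · rw [indicator_of_notMem (show x - 1 * y ∉ Iic (0 : ℝ) by simpa using hy),
        indicator_of_notMem (show y ∉ Ici x from hy), mul_zero]
  rw [expAverage, integral_expLaw, integral_congr_ae (Eventually.of_forall integrand),
    setIntegral_indicator measurableSet_Ici, inter_eq_self_of_subset_right (Ici_subset_Ioi.2 hx),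
    integral_Ici_eq_integral_Ioi, integral_complex_ofReal, integral_const_mul,
    integral_Ioi_exp_neg_two_mul, mul_div_assoc', ← Real.exp_add,
    show x + -2 * x = -x by ring, Complex.ofReal_div, Complex.ofReal_ofNat]

section Defect

open FunctionNorm.AveragingBounded

variable {X : SpacePair} (hp : X.line.AveragingBounded 1) (hm : X.line.AveragingBounded (-1))

theorem reflection_one_reflection_neg_one (hX : DenseL2 X) (f : X.half.space) :
    hp.reflection (hm.reflection (X.extend f)) = X.extend f := by
  have symbol_eq : reflectionSymbol 1 * reflectionSymbol (-1) = 1 := by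
    rw [reflectionSymbol_one, reflectionSymbol_neg_one, mul_comm, rSymbol_neg_one_mul_rSymbol_one]
  exact ExtendsConvolution.apply_extend_eq hX (symbol_eq ▸
    hp.extendsConvolution_reflection.mul hm.extendsConvolution_reflection) extendsConvolution_one f

theorem compression_reflection_neg_one_mul_compression_reflection_one (hX : DenseL2 X) :
    compression hm.reflection * compression hp.reflection = 1 := by
  have symbol_eq : reflectionSymbol (-1) * reflectionSymbol 1 = 1 := by
    rw [reflectionSymbol_one, reflectionSymbol_neg_one, rSymbol_neg_one_mul_rSymbol_one]
  rw [← (hp.isCausal_reflection zero_le_one).compression_mul, ← compression_one (X := X)]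
  refine ContinuousLinearMap.ext fun f => congrArg X.restrict ?_
  exact ExtendsConvolution.apply_extend_eq hX (symbol_eq ▸
    hm.extendsConvolution_reflection.mul hp.extendsConvolution_reflection) extendsConvolution_one f

theorem reflection_neg_one_sub_extend_restrict (f : X.half.space) :
    ((hm.reflection (X.extend f) - X.extend (X.restrict (hm.reflection (X.extend f))) :
      X.line.space) : ℝ →ₘ[volume] ℂ) =ᵐ[volume] fun x =>
        (-2 * ∫ y, (f : ℝ →ₘ[halfVolume] ℂ) y ∂expLaw)
          * (Iic (0 : ℝ)).indicator (fun z => (Real.exp z : ℂ)) x := by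
  set h := hm.reflection (X.extend f) with h_def
  filter_upwards [AEEqFun.coeFn_sub (h : ℝ →ₘ[volume] ℂ) (X.extend (X.restrict h) : X.line.space),
    coeFn_extend_restrict h, hm.coeFn_reflection (X.extend f), coeFn_extend f,
    expAverage_congr_ae (-1) (coeFn_extend f)]
    with x hsub hext_restrict hreflection hextend haverage
  rw [Submodule.coe_sub, hsub, Pi.sub_apply, hext_restrict]
  by_cases hx : 0 < x
  · rw [indicator_of_mem (mem_Ioi.2 hx), indicator_of_notMem (notMem_Iic.2 hx), sub_self, mul_zero]
  · rw [indicator_of_notMem (s := Ioi 0) hx, indicator_of_mem (mem_Iic.2 (not_lt.1 hx)), h_def,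
      hreflection, hextend, haverage, indicator_of_notMem (s := Ioi 0) hx,
      expAverage_neg_one_indicator_of_nonpos _ (not_lt.1 hx)]
    ring

theorem restrict_reflection_one_of_ae_eq {g : X.line.space} {c : ℂ}
    (hg : (g : ℝ →ₘ[volume] ℂ) =ᵐ[volume]
      fun x => c * (Iic (0 : ℝ)).indicator (fun z => (Real.exp z : ℂ)) x) :
    (X.restrict (hp.reflection g) : ℝ →ₘ[halfVolume] ℂ) =ᵐ[halfVolume]
      fun x => -c * (Real.exp (-x) : ℂ) := by
  filter_upwards [coeFn_restrict (hp.reflection g), ae_restrict_of_ae (hp.coeFn_reflection g),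
    ae_restrict_of_ae hg, ae_restrict_of_ae (expAverage_congr_ae 1 hg),
    ae_restrict_mem measurableSet_Ioi] with x hrestrict hreflection hgx haverage hx
  have pull_out : expAverage 1
      (fun x => c * (Iic (0 : ℝ)).indicator (fun z => (Real.exp z : ℂ)) x) x
      = c * expAverage 1 ((Iic (0 : ℝ)).indicator fun z => (Real.exp z : ℂ)) x :=
    integral_const_mul _ _
  rw [hrestrict, hreflection, hgx, haverage, pull_out, expAverage_one_indicator_exp hx,
    indicator_of_notMem (notMem_Iic.2 hx)]
  ring

theorem coeFn_sub_compression_compression (hX : DenseL2 X) (f : X.half.space) :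
    ((f - compression hp.reflection (compression hm.reflection f) : X.half.space) :
      ℝ →ₘ[halfVolume] ℂ) =ᵐ[halfVolume]
      fun x => 2 * (∫ y, (f : ℝ →ₘ[halfVolume] ℂ) y ∂expLaw) * (Real.exp (-x) : ℂ) := by
  set h := hm.reflection (X.extend f) with h_def
  have defect_eq : f - compression hp.reflection (compression hm.reflection f)
      = X.restrict (hp.reflection (h - X.extend (X.restrict h))) := by
    rw [map_sub, map_sub, h_def, reflection_one_reflection_neg_one hp hm hX, restrict_extend,
      compression_apply, compression_apply]
  rw [defect_eq]
  filter_upwards [restrict_reflection_one_of_ae_eq hp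
    (reflection_neg_one_sub_extend_restrict hm f)] with x hx
  rw [hx]
  ring

theorem smul_sub_compression_compression (hX : DenseL2 X) (f g : X.half.space) :
    (∫ y, (g : ℝ →ₘ[halfVolume] ℂ) y ∂expLaw) •
        (f - compression hp.reflection (compression hm.reflection f))
      = (∫ y, (f : ℝ →ₘ[halfVolume] ℂ) y ∂expLaw) •
        (g - compression hp.reflection (compression hm.reflection g)) := by
  refine Subtype.ext (AEEqFun.ext ?_)
  rw [Submodule.coe_smul, Submodule.coe_smul]
  filter_upwards [coeFn_sub_compression_compression hp hm hX f,
    coeFn_sub_compression_compression hp hm hX g,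
    AEEqFun.coeFn_smul (∫ y, (g : ℝ →ₘ[halfVolume] ℂ) y ∂expLaw)
      (f - compression hp.reflection (compression hm.reflection f) : X.half.space).1,
    AEEqFun.coeFn_smul (∫ y, (f : ℝ →ₘ[halfVolume] ℂ) y ∂expLaw)
      (g - compression hp.reflection (compression hm.reflection g) : X.half.space).1]
    with x hf hg hsmul_f hsmul_g
  rw [hsmul_f, hsmul_g, Pi.smul_apply, Pi.smul_apply, hf, hg, smul_eq_mul, smul_eq_mul]
  ring

theorem sub_compression_compression_ne_zero (hX : DenseL2 X) {f : X.half.space}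
    (hf : ∫ y, (f : ℝ →ₘ[halfVolume] ℂ) y ∂expLaw ≠ 0) :
    f - compression hp.reflection (compression hm.reflection f) ≠ 0 := by
  intro defect_eq_zero
  have defect := coeFn_sub_compression_compression hp hm hX f
  rw [defect_eq_zero, Submodule.coe_zero] at defect
  have : NeBot (ae halfVolume) := by
    rw [ae_neBot, Ne, Measure.restrict_eq_zero, Real.volume_Ioi]
    exact ENNReal.top_ne_zero
  obtain ⟨x, hdefect, hzero⟩ :=
    (defect.and (AEEqFun.coeFn_zero (μ := halfVolume) (β := ℂ))).exists
  rw [hzero, Pi.zero_apply] at hdefect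
  simp [hf, Complex.exp_ne_zero] at hdefect

end Defect

/-! ### The kernel of `W(r₋₁)` and the index -/

theorem halfVolume_absolutelyContinuous : halfVolume ≪ expLaw := by
  rw [expLaw_eq_withDensity]
  exact withDensity_absolutelyContinuous' (by fun_prop)
    (Eventually.of_forall fun x => by simp [Real.exp_pos])

theorem FunctionNorm.exists_integral_expLaw_ne_zero (ρ : FunctionNorm halfVolume)
    [Nontrivial ρ.space] :
    ∃ f : ρ.space, ∫ y, (f : ℝ →ₘ[halfVolume] ℂ) y ∂expLaw ≠ 0 := by
  obtain ⟨f, f_ne_zero⟩ := exists_ne (0 : ρ.space)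
  set g : ℝ → ℝ := fun x => min ‖(f : ℝ →ₘ[halfVolume] ℂ) x‖ 1
  have g_nonneg : 0 ≤ g := fun x => le_min (norm_nonneg _) zero_le_one
  have g_measurable : Measurable g :=
    (f : ℝ →ₘ[halfVolume] ℂ).stronglyMeasurable.norm.measurable.min measurable_const
  set G : ℝ →ₘ[halfVolume] ℂ := AEEqFun.mk (fun x => (g x : ℂ))
    (Complex.measurable_ofReal.comp g_measurable).aestronglyMeasurable
  have coeFn_G : G =ᵐ[halfVolume] fun x => (g x : ℂ) := AEEqFun.coeFn_mk _ _
  have G_mem : G ∈ ρ.space := by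
    refine (ρ.mono ?_).trans_lt f.2
    filter_upwards [coeFn_G] with x hx
    rw [hx, enorm_le_iff_norm_le, Complex.norm_real, Real.norm_of_nonneg (g_nonneg x)]
    exact min_le_left _ _
  refine ⟨⟨G, G_mem⟩, fun integral_eq_zero => f_ne_zero ?_⟩
  rw [integral_congr_ae (expLaw_absolutelyContinuous.ae_eq coeFn_G), integral_complex_ofReal,
    Complex.ofReal_eq_zero, integral_eq_zero_iff_of_nonneg g_nonneg] at integral_eq_zero
  · refine Subtype.ext (AEEqFun.ext ?_)
    filter_upwards [halfVolume_absolutelyContinuous.ae_eq integral_eq_zero,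
      AEEqFun.coeFn_zero (μ := halfVolume) (β := ℂ)] with x hgx hzero
    rw [Submodule.coe_zero, hzero, Pi.zero_apply, ← norm_eq_zero]
    by_contra norm_ne_zero
    exact (lt_min ((norm_nonneg _).lt_of_ne' norm_ne_zero) one_pos).ne' hgx
  · refine .of_bound g_measurable.aestronglyMeasurable 1 (Eventually.of_forall fun x => ?_)
    rw [Real.norm_of_nonneg (g_nonneg x)]
    exact min_le_right _ _

/-- The properties of `X(ℝ)` and `X(ℝ₊)` on which the theorem depends: averaging over the past and
over the future is bounded, the square integrable functions are dense, and `X(ℝ₊) ≠ 0`. -/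
structure SpacePair.IsAveragingPair (X : SpacePair) : Prop where
  averagingBounded_one : X.line.AveragingBounded 1
  averagingBounded_neg_one : X.line.AveragingBounded (-1)
  denseL2 : DenseL2 X
  nontrivial : Nontrivial X.half.space

namespace SpacePair.IsAveragingPair

variable {X : SpacePair}

theorem compression_neg_one_mul_compression_one (hX : X.IsAveragingPair) :
    compression hX.averagingBounded_neg_one.reflection *
      compression hX.averagingBounded_one.reflection = 1 :=
  compression_reflection_neg_one_mul_compression_reflection_one _ _ hX.denseL2

theorem finrank_ker_compression (hX : X.IsAveragingPair) :
    Module.finrank ℂ (compression hX.averagingBounded_neg_one.reflection).ker = 1 := by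
  set hp := hX.averagingBounded_one
  set hm := hX.averagingBounded_neg_one
  have := hX.nontrivial
  obtain ⟨g, hg⟩ := X.half.exists_integral_expLaw_ne_zero
  set e := g - compression hp.reflection (compression hm.reflection g) with e_def
  have e_mem : e ∈ (compression hm.reflection).ker := by
    rw [LinearMap.mem_ker, ContinuousLinearMap.coe_coe, e_def, map_sub, sub_eq_zero]
    exact (leftInverse_of_mul_eq_one hX.compression_neg_one_mul_compression_one _).symm
  refine finrank_eq_one (⟨e, e_mem⟩ : (compression hm.reflection).ker) ?_ fun ⟨f, f_mem⟩ => ?_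
  · exact fun h => sub_compression_compression_ne_zero hp hm hX.denseL2 hg (congrArg Subtype.val h)
  · have proportional := smul_sub_compression_compression hp hm hX.denseL2 f g
    rw [show compression hm.reflection f = 0 from f_mem, map_zero, sub_zero] at proportional
    refine ⟨(∫ y, (g : ℝ →ₘ[halfVolume] ℂ) y ∂expLaw)⁻¹ *
      ∫ y, (f : ℝ →ₘ[halfVolume] ℂ) y ∂expLaw, Subtype.ext ?_⟩
    change (_ * _) • e = f
    rw [mul_smul, ← proportional, inv_smul_smul₀ hg]

theorem finiteDimensional_ker_compression_pow (hX : X.IsAveragingPair) (n : ℕ) :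
    FiniteDimensional ℂ (compression hX.averagingBounded_neg_one.reflection ^ n).ker := by
  have : FiniteDimensional ℂ (compression hX.averagingBounded_neg_one.reflection).ker :=
    .of_finrank_pos (hX.finrank_ker_compression ▸ one_pos)
  exact finiteDimensional_ker_pow_of_mul_eq_one hX.compression_neg_one_mul_compression_one n

theorem finrank_ker_compression_pow (hX : X.IsAveragingPair) (n : ℕ) :
    Module.finrank ℂ (compression hX.averagingBounded_neg_one.reflection ^ n).ker = n := by
  rw [finrank_ker_pow_of_mul_eq_one hX.compression_neg_one_mul_compression_one,
    hX.finrank_ker_compression, mul_one]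

end SpacePair.IsAveragingPair

/-! ### Truncations -/

section Truncations

/-- The set of points outside which a function is cut off: there `x > n` or `|f(x)| > n`. -/
def tailSet (f : ℝ →ₘ[halfVolume] ℂ) (n : ℕ) : Set ℝ := {x | (n : ℝ) < x ∨ (n : ℝ) < ‖f x‖}

variable (f : ℝ →ₘ[halfVolume] ℂ) (n : ℕ)

theorem measurableSet_tailSet : MeasurableSet (tailSet f n) :=
  (measurableSet_lt measurable_const measurable_id).union
    (measurableSet_lt measurable_const f.stronglyMeasurable.norm.measurable)

theorem compl_tailSet : (tailSet f n)ᶜ = {x : ℝ | x ≤ n ∧ ‖f x‖ ≤ n} := by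
  ext x
  simp [tailSet]

theorem eventually_notMem_tailSet (x : ℝ) : ∀ᶠ n in atTop, x ∉ tailSet f n := by
  filter_upwards [eventually_ge_atTop ⌈x⌉₊, eventually_ge_atTop ⌈‖f x‖⌉₊] with n hx hfx
  simpa [tailSet] using ⟨Nat.ceil_le.1 hx, Nat.ceil_le.1 hfx⟩

theorem tendsto_setLIntegral_tailSet {μ : Measure ℝ} {G : ℝ → ℝ≥0∞} (hG : AEMeasurable G μ)
    (hfin : ∫⁻ x, G x ∂μ ≠ ∞) :
    Tendsto (fun n => ∫⁻ x in tailSet f n, G x ∂μ) atTop (𝓝 0) := by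
  simp only [← lintegral_indicator (measurableSet_tailSet f _)]
  rw [← lintegral_zero (μ := μ)]
  refine tendsto_lintegral_of_dominated_convergence' G
    (fun n => hG.indicator (measurableSet_tailSet f n))
    (fun n => Eventually.of_forall fun x => indicator_le_self' (by simp) x) hfin
    (Eventually.of_forall fun x => tendsto_const_nhds.congr' ?_)
  filter_upwards [eventually_notMem_tailSet f x] with n hn
  rw [indicator_of_notMem hn]

/-- The truncation of a function to the complement of `tailSet`. -/
def truncation : ℝ →ₘ[halfVolume] ℂ :=
  AEEqFun.mk ((tailSet f n)ᶜ.indicator f)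
    (f.aestronglyMeasurable.indicator (measurableSet_tailSet f n).compl)

theorem coeFn_truncation : truncation f n =ᵐ[halfVolume] (tailSet f n)ᶜ.indicator f :=
  AEEqFun.coeFn_mk _ _

theorem memLp_truncation : MemLp (truncation f n) 2 halfVolume := by
  have hmeas := (measurableSet_tailSet f n).compl
  rw [memLp_congr_ae (coeFn_truncation f n), memLp_indicator_iff_restrict hmeas]
  have : IsFiniteMeasure (halfVolume.restrict (tailSet f n)ᶜ) := by
    refine ⟨?_⟩
    rw [Measure.restrict_apply_univ, Measure.restrict_apply hmeas, compl_tailSet]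
    have subset_Icc : {x : ℝ | x ≤ n ∧ ‖f x‖ ≤ n} ∩ Ioi 0 ⊆ Icc 0 n := fun x hx =>
      ⟨le_of_lt hx.2, hx.1.1⟩
    exact measure_lt_top_of_subset subset_Icc measure_Icc_lt_top.ne
  refine MemLp.of_bound f.aestronglyMeasurable.restrict n ?_
  filter_upwards [ae_restrict_mem hmeas] with x hx
  rw [compl_tailSet] at hx
  exact hx.2

theorem FunctionNorm.eval_truncation_le (ρ : FunctionNorm halfVolume) :
    ρ.eval (truncation f n) ≤ ρ.eval f := by
  refine ρ.mono ?_
  filter_upwards [coeFn_truncation f n] with x hx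
  rw [hx]
  exact enorm_indicator_le_enorm_self _ _

theorem enorm_truncation_sub : (fun x => ‖(truncation f n - f) x‖ₑ) =ᵐ[halfVolume]
    (tailSet f n).indicator fun x => ‖f x‖ₑ := by
  filter_upwards [coeFn_truncation f n, AEEqFun.coeFn_sub (truncation f n) f] with x htrunc hsub
  rw [hsub, Pi.sub_apply, htrunc]
  by_cases h : x ∈ tailSet f n <;> simp [h]

end Truncations

/-- `truncation` as a map of a function space to itself. -/
def FunctionNorm.truncate (ρ : FunctionNorm halfVolume) (f : ρ.space) (n : ℕ) : ρ.space :=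
  ⟨truncation f n, (ρ.eval_truncation_le f n).trans_lt f.2⟩

theorem denseL2_of_tendsto {X : SpacePair}
    (h : ∀ f : X.half.space, Tendsto
      (fun n => X.half.toFun ((tailSet f n).indicator fun x => ‖f.1 x‖ₑ)) atTop (𝓝 0)) :
    DenseL2 X := by
  intro f
  refine mem_closure_of_tendsto (b := atTop) ?_
    (Eventually.of_forall fun n => memLp_truncation f.1 n : ∀ᶠ n in atTop, X.half.truncate f n ∈ _)
  rw [tendsto_iff_norm_sub_tendsto_zero]
  refine ((ENNReal.tendsto_toReal ENNReal.zero_ne_top).comp (h f)).congr fun n => ?_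
  rw [X.half.norm_def]
  exact congrArg ENNReal.toReal (X.half.congr (enorm_truncation_sub f.1 n).symm)

/-! ### Density in reflexive spaces -/

theorem IsReflexive.exists_weak_limit {E : Type*} [NormedAddCommGroup E] [NormedSpace ℂ E]
    (hE : IsReflexive E) (u : ℕ → E) {r : ℝ} (hu : ∀ n, ‖u n‖ ≤ r) :
    ∃ x : E, ∀ l : StrongDual ℂ E, Tendsto (fun n => l (u n)) (hyperfilter ℕ) (𝓝 (l x)) := by
  set v : ℕ → WeakDual ℂ (StrongDual ℂ E) :=
    fun n => StrongDual.toWeakDual (NormedSpace.inclusionInDoubleDual ℂ E (u n))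
  have v_mem : ∀ n, v n ∈ WeakDual.toStrongDual ⁻¹' Metric.closedBall 0 r := fun n =>
    (mem_closedBall_zero_iff (E := StrongDual ℂ (StrongDual ℂ E))).2
      ((NormedSpace.double_dual_bound ℂ E (u n)).trans (hu n))
  obtain ⟨w, -, hw⟩ := (WeakDual.isCompact_closedBall 0 r).ultrafilter_le_nhds
    ((hyperfilter ℕ).map v) (le_principal_iff.2 (Filter.mem_map.2 (univ_mem' v_mem)))
  obtain ⟨x, hx⟩ := hE (WeakDual.toStrongDual w)
  refine ⟨x, fun l => ?_⟩
  have hwl : w l = l x := congrArg (fun φ => φ l) hx.symm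
  exact hwl ▸ ((WeakDual.eval_continuous l).tendsto w).comp hw

theorem IsReflexive.mem_topologicalClosure {E F : Type*} [NormedAddCommGroup E]
    [NormedSpace ℂ E] [NormedAddCommGroup F] [NormedSpace ℂ F] (hE : IsReflexive E)
    {J : E →L[ℂ] F} (hJ : Function.Injective J) {p : Submodule ℂ E} {u : ℕ → E} {r : ℝ} {x : E}
    (hu : ∀ n, ‖u n‖ ≤ r) (hup : ∀ n, u n ∈ p) (hlim : Tendsto (fun n => J (u n)) atTop (𝓝 (J x))) :
    x ∈ p.topologicalClosure := by
  obtain ⟨y, hy⟩ := hE.exists_weak_limit u hu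
  obtain rfl : y = x := hJ <| (SeparatingDual.eq_iff_forall_dual_eq (R := ℂ)).2 fun l =>
    tendsto_nhds_unique (hy (l ∘L J))
      (((l.continuous.tendsto _).comp hlim).mono_left Nat.hyperfilter_le_atTop)
  have := p.isClosed_topologicalClosure
  rw [← Submodule.Quotient.mk_eq_zero, SeparatingDual.eq_zero_iff_forall_dual_eq_zero (R := ℂ)]
  intro l
  have vanishes : ∀ z ∈ p, (l ∘L p.topologicalClosure.mkQL) z = 0 := fun z hz => by
    simp [(Submodule.Quotient.mk_eq_zero _).2 (p.le_topologicalClosure hz)]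
  exact tendsto_nhds_unique (hy (l ∘L p.topologicalClosure.mkQL))
    (tendsto_const_nhds.congr fun n => (vanishes _ (hup n)).symm)

namespace FunctionNorm

variable {μ ν : Measure ℝ} {ρ : FunctionNorm μ} {D : ℝ≥0}

theorem integrable_of_lintegral_le (hν : ν ≪ μ)
    (hD : ∀ f : ℝ →ₘ[μ] ℂ, ∫⁻ y, ‖f y‖ₑ ∂ν ≤ D * ρ.eval f) (f : ρ.space) :
    Integrable f.1 ν :=
  ⟨f.1.aestronglyMeasurable.mono_ac hν,
    (hD f).trans_lt (ENNReal.mul_lt_top ENNReal.coe_lt_top f.2)⟩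

/-- The map of a function space into a weighted `L¹` space given by a bound of the `L¹` norm. -/
def toL1 (hν : ν ≪ μ) (hD : ∀ f : ℝ →ₘ[μ] ℂ, ∫⁻ y, ‖f y‖ₑ ∂ν ≤ D * ρ.eval f) :
    ρ.space →L[ℂ] Lp ℂ 1 ν :=
  LinearMap.mkContinuous
    { toFun := fun f => (integrable_of_lintegral_le hν hD f).toL1 f.1
      map_add' := fun f g => by
        rw [← Integrable.toL1_add, Integrable.toL1_eq_toL1_iff]
        exact hν.ae_le (AEEqFun.coeFn_add f.1 g.1)
      map_smul' := fun c f => by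
        rw [RingHom.id_apply, ← Integrable.toL1_smul', Integrable.toL1_eq_toL1_iff]
        exact hν.ae_le (AEEqFun.coeFn_smul c f.1) }
    D fun f => by
      simpa [Integrable.norm_toL1_eq_lintegral_enorm, norm_def] using
        ENNReal.toReal_mono (ENNReal.mul_ne_top ENNReal.coe_ne_top f.2.ne) (hD f)

theorem toL1_apply (hν : ν ≪ μ) (hD : ∀ f : ℝ →ₘ[μ] ℂ, ∫⁻ y, ‖f y‖ₑ ∂ν ≤ D * ρ.eval f)
    (f : ρ.space) : toL1 hν hD f = (integrable_of_lintegral_le hν hD f).toL1 f.1 := rfl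

theorem toL1_injective (hν : ν ≪ μ) (hμ : μ ≪ ν)
    (hD : ∀ f : ℝ →ₘ[μ] ℂ, ∫⁻ y, ‖f y‖ₑ ∂ν ≤ D * ρ.eval f) :
    Function.Injective (toL1 hν hD) := fun f g hfg => by
  rw [toL1_apply, toL1_apply, Integrable.toL1_eq_toL1_iff] at hfg
  exact Subtype.ext (AEEqFun.ext (hμ.ae_le hfg))

end FunctionNorm

theorem exp_mul_lintegral_le_lexpAverage (f : ℝ →ₘ[halfVolume] ℂ) :
    (fun x => (∫⁻ y, ‖f y‖ₑ ∂expLaw) * (Iic (0 : ℝ)).indicator (ENNReal.ofReal ∘ Real.exp) x)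
      ≤ᵐ[volume] lexpAverage (-1) fun x => ‖extendFun f x‖ₑ := by
  have enorm_extend : (fun x => ‖extendFun f x‖ₑ) =ᵐ[volume]
      (Ioi 0).indicator fun x => ‖f x‖ₑ := by
    filter_upwards [coeFn_extendFun f] with x hx
    rw [hx, enorm_indicator_eq_indicator_enorm]
  filter_upwards [lexpAverage_congr_ae (-1) enorm_extend] with x hx
  rw [hx]
  by_cases hx0 : x ∈ Iic (0 : ℝ)
  swap
  · simp [hx0]
  rw [indicator_of_mem hx0, Function.comp_apply, mul_comm, lexpAverage, lintegral_expLaw,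
    lintegral_expLaw, ← lintegral_const_mul' _ _ ENNReal.ofReal_ne_top,
    ← lintegral_indicator measurableSet_Ioi, ← lintegral_indicator measurableSet_Ioi,
    ← lintegral_add_right_eq_self _ x]
  refine lintegral_mono fun y => ?_
  by_cases hy : 0 < y + x
  · have hy0 : 0 < y := by linarith [mem_Iic.1 hx0]
    have weight : ENNReal.ofReal (Real.exp x) * ENNReal.ofReal (Real.exp (-x + -y)) =
        ENNReal.ofReal (Real.exp (-y)) := by
      rw [← ENNReal.ofReal_mul (Real.exp_pos _).le, ← Real.exp_add]
      ring_nf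
    simp [hy, hy0, ← mul_assoc, weight, add_comm x y]
  · simp [hy]

theorem exists_lintegral_expLaw_le {X : SpacePair} (hm : X.line.AveragingBounded (-1)) :
    ∃ D : ℝ≥0, ∀ f : ℝ →ₘ[halfVolume] ℂ, ∫⁻ y, ‖f y‖ₑ ∂expLaw ≤ D * X.half.eval f := by
  obtain ⟨C, hC⟩ := hm
  set w : ℝ → ℝ≥0∞ := (Iic (0 : ℝ)).indicator (ENNReal.ofReal ∘ Real.exp) with hw
  have hw_ne : X.line.toFun w ≠ 0 := fun h0 => by
    have hw_meas : Measurable w := (by fun_prop : Measurable _).indicator measurableSet_Iic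
    have null : volume (Iic (0 : ℝ)) = 0 :=
      measure_mono_null (fun x hx => by simpa [hw, Real.exp_pos] using hx)
        (X.line.eq_zero hw_meas.aemeasurable h0)
    simp at null
  -- `w` may have infinite norm, hence the minimum
  lift min (X.line.toFun w) 1 to ℝ≥0 using (by simp) with k hk
  have hk0 : k ≠ 0 := fun h => by
    rw [h, ENNReal.coe_zero] at hk
    exact (lt_min (pos_iff_ne_zero.2 hw_ne) one_pos).ne hk
  refine ⟨C * k⁻¹, fun f => ?_⟩
  rw [ENNReal.coe_mul, ENNReal.coe_inv hk0, mul_right_comm, ← div_eq_mul_inv,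
    ENNReal.le_div_iff_mul_le (by simp [hk0]) (by simp)]
  calc (∫⁻ y, ‖f y‖ₑ ∂expLaw) * k ≤ (∫⁻ y, ‖f y‖ₑ ∂expLaw) * X.line.toFun w := by
        gcongr
        exact hk.trans_le (min_le_left _ _)
    _ ≤ X.line.toFun fun x => (∫⁻ y, ‖f y‖ₑ ∂expLaw) * w x := X.line.mul_toFun_le _ _
    _ ≤ X.line.toFun (lexpAverage (-1) fun x => ‖extendFun f x‖ₑ) :=
        X.line.mono (exp_mul_lintegral_le_lexpAverage f)
    _ ≤ C * X.half.eval f := by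
        rw [← X.eval_extendFun]
        exact hC _

theorem denseL2_of_isReflexive {X : SpacePair} (hm : X.line.AveragingBounded (-1))
    (hE : IsReflexive X.half.space) : DenseL2 X := by
  obtain ⟨D, hD⟩ := exists_lintegral_expLaw_le hm
  intro f
  set p : Submodule ℂ X.half.space :=
    (Lp.LpSubmodule ℂ ℂ 2 halfVolume).comap X.half.space.subtype
  have coe_p : (p : Set X.half.space) = {g | MemLp g.1 2 halfVolume} :=
    Set.ext fun _ => Lp.mem_Lp_iff_memLp
  have bounded : ∀ n, ‖X.half.truncate f n‖ ≤ ‖f‖ := fun n =>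
    ENNReal.toReal_mono f.2.ne (X.half.eval_truncation_le f n)
  have tendsto_L1 : Tendsto
      (fun n => FunctionNorm.toL1 expLaw_absolutelyContinuous hD (X.half.truncate f n)) atTop
      (𝓝 (FunctionNorm.toL1 expLaw_absolutelyContinuous hD f)) := by
    rw [tendsto_iff_enorm_sub_tendsto_zero]
    refine (tendsto_setLIntegral_tailSet f.1
      (f.1.aestronglyMeasurable.enorm.mono_ac expLaw_absolutelyContinuous)
      (FunctionNorm.integrable_of_lintegral_le expLaw_absolutelyContinuous hD f).2.ne).congr
      fun n => ?_
    rw [← map_sub, FunctionNorm.toL1_apply, Integrable.enorm_toL1,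
      ← lintegral_indicator (measurableSet_tailSet f.1 n)]
    exact lintegral_congr_ae
      (expLaw_absolutelyContinuous.ae_le (enorm_truncation_sub f.1 n).symm)
  rw [← coe_p]
  exact hE.mem_topologicalClosure
    (FunctionNorm.toL1_injective expLaw_absolutelyContinuous halfVolume_absolutelyContinuous hD)
    bounded (fun n => coe_p.ge (memLp_truncation f.1 n)) tendsto_L1

/-! ### Function spaces that contain an indicator function -/

theorem FunctionNorm.nontrivial_space {μ : Measure ℝ} (ρ : FunctionNorm μ) {s : Set ℝ}
    (hs : MeasurableSet s) (hμ : μ s ≠ 0)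
    (h : ∀ f : ℝ →ₘ[μ] ℂ, (fun x => ‖f x‖ₑ) =ᵐ[μ] s.indicator 1 → f ∈ ρ.space) :
    Nontrivial ρ.space := by
  set f : ℝ →ₘ[μ] ℂ := AEEqFun.mk (s.indicator 1)
    (stronglyMeasurable_one.indicator hs).aestronglyMeasurable
  have hf : f =ᵐ[μ] s.indicator 1 := AEEqFun.coeFn_mk _ _
  have hf_enorm : (fun x => ‖f x‖ₑ) =ᵐ[μ] s.indicator 1 := by
    filter_upwards [hf] with x hx
    rw [hx, enorm_indicator_eq_indicator_enorm]
    by_cases hxs : x ∈ s <;> simp [hxs]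
  refine nontrivial_of_ne ⟨f, h f hf_enorm⟩ 0 fun hf0 => hμ ?_
  rw [show f = 0 from congrArg Subtype.val hf0] at hf
  refine measure_eq_zero_iff_ae_notMem.2 ?_
  filter_upwards [hf, AEEqFun.coeFn_zero (μ := μ) (β := ℂ)] with x hx hx0 hxs
  rw [hx0, indicator_of_mem hxs] at hx
  exact zero_ne_one hx

theorem IsYoungIntegrand.nontrivial_space {μ : Measure ℝ} {Ψ : ℝ → ℝ≥0∞ → ℝ≥0∞}
    (h : IsYoungIntegrand μ Ψ) {s : Set ℝ} (hs : MeasurableSet s) (hμ : μ s ≠ 0) {t : ℝ≥0}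
    (ht : 0 < t) (hfin : ∫⁻ x in s, Ψ x t ∂μ < ∞) : Nontrivial h.functionNorm.space := by
  refine h.functionNorm.nontrivial_space hs hμ fun f hf => ?_
  refine (h.mem_space_iff f).2 ⟨t⁻¹, inv_pos.2 ht, ?_⟩
  convert hfin using 1
  rw [← lintegral_indicator hs]
  refine lintegral_congr_ae ?_
  filter_upwards [hf] with x hx
  rw [hx, ENNReal.coe_inv ht.ne', div_eq_mul_inv, inv_inv]
  by_cases hxs : x ∈ s <;> simp [hxs, h.zero]

theorem halfVolume_Ioo_zero_one : halfVolume (Ioo 0 1) = 1 := by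
  rw [halfVolume, Measure.restrict_eq_self _ Ioo_subset_Ioi_self]
  simp

/-! ### Orlicz spaces -/

namespace IsYoungDensity

variable {φ : ℝ → ℝ≥0∞}

theorem youngFunction_zero (φ : ℝ → ℝ≥0∞) : youngFunction φ 0 = 0 := by
  simpa using youngFunction_coe φ 0

theorem youngFunction_add_mul_le (h : IsYoungDensity φ) (r : ℝ≥0) (s : ℝ≥0∞) :
    youngFunction φ r + s * φ r ≤ youngFunction φ s + r * φ r := by
  rcases eq_or_ne s ∞ with rfl | hs
  · simp [h.youngFunction_top]
  lift s to ℝ≥0 using hs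
  rcases le_total s r with hsr | hrs
  · calc youngFunction φ r + s * φ r
        ≤ youngFunction φ s + (r - s : ℝ≥0) * φ r + s * φ r := by
          gcongr
          exact h.youngFunction_le hsr
      _ = youngFunction φ s + r * φ r := by
          rw [add_assoc, ← add_mul, ← ENNReal.coe_add, tsub_add_cancel_of_le hsr]
  · calc youngFunction φ r + s * φ r
        = youngFunction φ r + (s - r : ℝ≥0) * φ r + r * φ r := by
          rw [add_assoc, ← add_mul, ← ENNReal.coe_add, tsub_add_cancel_of_le hrs]
      _ ≤ youngFunction φ s + r * φ r := by
          gcongr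
          exact h.le_youngFunction hrs

theorem youngFunction_eq_top (h : IsYoungDensity φ) {r : ℝ≥0} {s : ℝ≥0∞} (hrs : r < s)
    (hφ : φ r = ∞) : youngFunction φ s = ∞ := by
  obtain ⟨t, hrt, hts⟩ := ENNReal.lt_iff_exists_nnreal_btwn.1 hrs
  have hrt' : r < t := ENNReal.coe_lt_coe.1 hrt
  refine top_unique ?_
  calc ∞ = youngFunction φ r + (t - r : ℝ≥0) * φ r := by
        rw [hφ, ENNReal.mul_top (ENNReal.coe_ne_zero.2 (tsub_pos_of_lt hrt').ne'), add_top]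
    _ ≤ youngFunction φ t := h.le_youngFunction hrt'.le
    _ ≤ youngFunction φ s := youngFunction_mono φ hts.le

theorem youngFunction_le_of_forall_lt {m B : ℝ≥0∞}
    (hB : ∀ r : ℝ≥0, r < m → youngFunction φ r ≤ B) : youngFunction φ m ≤ B := by
  rcases eq_or_ne m 0 with rfl | hm
  · simp [youngFunction_zero]
  obtain ⟨u, hu, hum, hlim⟩ := exists_seq_strictMono_tendsto' (pos_iff_ne_zero.2 hm)
  have domain_eq : ({t : ℝ | 0 < t ∧ ENNReal.ofReal t ≤ m} : Set ℝ)
      =ᵐ[volume] ⋃ n, {t : ℝ | 0 < t ∧ ENNReal.ofReal t ≤ u n} := by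
    filter_upwards [Measure.ae_ne volume m.toReal] with t ht
    refine propext ⟨fun ⟨ht0, htm⟩ => ?_, fun hmem => ?_⟩
    · have hlt : ENNReal.ofReal t < m := htm.lt_of_ne fun he => ht (by
        rw [← he, ENNReal.toReal_ofReal ht0.le])
      obtain ⟨n, hn⟩ := (hlim.eventually (lt_mem_nhds hlt)).exists
      exact mem_iUnion.2 ⟨n, ht0, hn.le⟩
    · obtain ⟨n, ht0, htn⟩ := mem_iUnion.1 hmem
      exact ⟨ht0, htn.trans (hum n).2.le⟩
  rw [youngFunction, setLIntegral_congr domain_eq, setLIntegral_iUnion_of_directed]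
  · refine iSup_le fun n => ?_
    have bound := hB (u n).toNNReal
    rw [ENNReal.coe_toNNReal (hum n).2.ne_top] at bound
    exact bound (hum n).2
  · exact Monotone.directed_le fun i j hij t ht => ⟨ht.1, ht.2.trans (hu.monotone hij)⟩

theorem youngFunction_lintegral_le (h : IsYoungDensity φ) {α : Type*} {mα : MeasurableSpace α}
    {ν : Measure α} [IsProbabilityMeasure ν] {g : α → ℝ≥0∞} (hg : Measurable g) :
    youngFunction φ (∫⁻ y, g y ∂ν) ≤ ∫⁻ y, youngFunction φ (g y) ∂ν := by
  have hΦg : Measurable fun y => youngFunction φ (g y) := (youngFunction_mono φ).measurable.comp hg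
  refine youngFunction_le_of_forall_lt fun r hr => ?_
  rcases eq_or_ne (φ r) ∞ with hφ | hφ
  · have exceeds : ν {y | (r : ℝ≥0∞) < g y} ≠ 0 := fun hnull => hr.not_ge <| by
      have hle : ∀ᵐ y ∂ν, g y ≤ r := ae_iff.2 (by simpa using hnull)
      simpa using lintegral_mono_ae hle
    have integral_top : ∫⁻ y, youngFunction φ (g y) ∂ν = ∞ := by
      by_contra hne
      refine exceeds (measure_mono_null (fun y hy => ?_) (ae_iff.1 (ae_lt_top hΦg hne)))
      simpa using h.youngFunction_eq_top hy hφ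
    exact le_top.trans_eq integral_top.symm
  · have supporting_line := lintegral_mono (μ := ν) fun y => h.youngFunction_add_mul_le r (g y)
    rw [lintegral_add_left measurable_const, lintegral_add_left hΦg, lintegral_const,
      lintegral_const, measure_univ, mul_one, mul_one, lintegral_mul_const _ hg]
      at supporting_line
    refine (ENNReal.add_le_add_iff_right (ENNReal.mul_ne_top ENNReal.coe_ne_top hφ)).1
      (le_trans ?_ supporting_line)
    gcongr

theorem averagingBounded (h : IsYoungDensity φ) (σ : ℝ) :
    (orlicz h).line.AveragingBounded σ := by
  refine ⟨1, fun f => ?_⟩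
  rw [ENNReal.coe_one, one_mul]
  change luxemburg volume (fun _ => youngFunction φ) _
    ≤ luxemburg volume (fun _ => youngFunction φ) _
  refine le_of_forall_gt fun t ht => ?_
  obtain ⟨s, hs, hs1, hst⟩ := exists_of_luxemburg_lt ht
  refine (luxemburg_le hs ?_).trans_lt hst
  have hf : Measurable fun x => ‖f x‖ₑ := f.stronglyMeasurable.enorm
  calc ∫⁻ x, youngFunction φ (lexpAverage σ (fun x => ‖f x‖ₑ) x / s)
      ≤ ∫⁻ x, lexpAverage σ (fun x => youngFunction φ (‖f x‖ₑ / s)) x := by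
        refine lintegral_mono fun x => ?_
        rw [lexpAverage, div_eq_mul_inv, ← lintegral_mul_const _ (by fun_prop)]
        exact h.youngFunction_lintegral_le (by fun_prop)
    _ = ∫⁻ x, youngFunction φ (‖f x‖ₑ / s) :=
        lintegral_lexpAverage σ ((youngFunction_mono φ).measurable.comp (hf.div_const _))
    _ ≤ 1 := hs1

theorem nontrivial_half (h : IsYoungDensity φ) : Nontrivial (orlicz h).half.space := by
  obtain ⟨t, ht, hφt⟩ := h.finite
  lift t to ℝ≥0 using ht.le
  refine (h.isYoungIntegrand halfVolume).nontrivial_space (t := t) measurableSet_Ioo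
    (halfVolume_Ioo_zero_one.trans_ne one_ne_zero) (mod_cast ht) ?_
  rw [setLIntegral_const, halfVolume_Ioo_zero_one, mul_one]
  calc youngFunction φ t ≤ youngFunction φ (0 : ℝ≥0) + (t - 0 : ℝ≥0) * φ t :=
        h.youngFunction_le zero_le
    _ = t * φ t := by simp [youngFunction_zero]
    _ < ∞ := ENNReal.mul_lt_top ENNReal.coe_lt_top hφt

theorem isAveragingPair (h : IsYoungDensity φ) (hrefl : IsReflexive (orlicz h).half.space) :
    (orlicz h).IsAveragingPair where
  averagingBounded_one := h.averagingBounded 1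
  averagingBounded_neg_one := h.averagingBounded (-1)
  denseL2 := denseL2_of_isReflexive (h.averagingBounded (-1)) hrefl
  nontrivial := h.nontrivial_half

end IsYoungDensity

/-! ### Variable Lebesgue spaces -/

theorem expLaw_Ioi {y : ℝ} (hy : 0 ≤ y) : expLaw (Ioi y) = ENNReal.ofReal (Real.exp (-y)) := by
  have indicator_mul (r : ℝ) : ENNReal.ofReal (Real.exp (-r)) * (Ioi y).indicator 1 r
      = (Ioi y).indicator (fun r => ENNReal.ofReal (Real.exp (-r))) r := by
    by_cases hr : r ∈ Ioi y <;> simp [hr]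
  have integrable_exp : IntegrableOn (fun r : ℝ => Real.exp (-r)) (Ioi y) := by
    simpa using integrableOn_exp_mul_Ioi (neg_one_lt_zero (R := ℝ)) y
  rw [← lintegral_indicator_one measurableSet_Ioi, lintegral_expLaw]
  simp only [indicator_mul]
  rw [setLIntegral_indicator measurableSet_Ioi,
    inter_eq_self_of_subset_left (Ioi_subset_Ioi hy),
    ← ofReal_integral_eq_lintegral_ofReal integrable_exp
      (Eventually.of_forall fun r => (Real.exp_pos _).le),
    integral_exp_neg_Ioi]

theorem lintegral_expLaw_eq_lintegral_Ioo {g : ℝ → ℝ≥0∞} (hg : Measurable g) :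
    ∫⁻ y, g y ∂expLaw = ∫⁻ r, (∫⁻ y in Ioo 0 r, g y) ∂expLaw := by
  have kernel_measurable : Measurable fun z : ℝ × ℝ => (Iio z.2).indicator g z.1 :=
    Measurable.indicator (f := fun z : ℝ × ℝ => g z.1) (hg.comp measurable_fst)
      (measurableSet_lt measurable_fst measurable_snd)
  have kernel_eq (y r : ℝ) : (Iio r).indicator g y = (Ioi y).indicator (fun _ => g y) r := rfl
  calc ∫⁻ y, g y ∂expLaw
      = ∫⁻ y in Ioi 0, ENNReal.ofReal (Real.exp (-y)) * g y := lintegral_expLaw g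
    _ = ∫⁻ y in Ioi 0, (∫⁻ r, (Iio r).indicator g y ∂expLaw) :=
        setLIntegral_congr_fun measurableSet_Ioi fun y hy => by
          simp only [kernel_eq]
          rw [lintegral_indicator_const measurableSet_Ioi, expLaw_Ioi (le_of_lt hy), mul_comm]
    _ = ∫⁻ r, (∫⁻ y in Ioi 0, (Iio r).indicator g y) ∂expLaw :=
        lintegral_lintegral_swap kernel_measurable.aemeasurable
    _ = ∫⁻ r, (∫⁻ y in Ioo 0 r, g y) ∂expLaw := by
        simp only [setLIntegral_indicator measurableSet_Iio, Iio_inter_Ioi]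

theorem lintegral_ofReal_expLaw : ∫⁻ r, ENNReal.ofReal r ∂expLaw = 1 := by
  simpa using (lintegral_expLaw_eq_lintegral_Ioo (g := 1) measurable_one).symm

theorem lintegral_uIcc_le_maximalFunction (f : ℝ → ℂ) {a b x : ℝ} (hab : a ≠ b)
    (hx : x ∈ uIcc a b) :
    ∫⁻ t in uIcc a b, ‖f t‖ₑ ≤ ENNReal.ofReal |b - a| * maximalFunction f x := by
  rw [← max_sub_min_eq_abs,
    ← ENNReal.div_le_iff' (ENNReal.ofReal_pos.2 (sub_pos.2 (min_lt_max.2 hab))).ne'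
      ENNReal.ofReal_ne_top]
  exact le_iSup₂_of_le _ _ (le_iSup₂_of_le (min_lt_max.2 hab) hx le_rfl)

theorem lintegral_Ioo_sub_mul_le_maximalFunction {f : ℝ → ℂ} (hf : Measurable f) {σ : ℝ}
    (hσ : |σ| = 1) (x : ℝ) {r : ℝ} (hr : 0 < r) :
    ∫⁻ y in Ioo 0 r, ‖f (x - σ * y)‖ₑ ≤ ENNReal.ofReal r * maximalFunction f x := by
  have mapsTo : Ioo 0 r ⊆ (fun y => x - σ * y) ⁻¹' uIcc x (x - σ * r) := fun y ⟨hy0, hyr⟩ => by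
    refine mem_uIcc.2 ?_
    rcases eq_or_eq_neg_of_abs_eq hσ with rfl | rfl
    · exact Or.inr ⟨by linarith, by linarith⟩
    · exact Or.inl ⟨by linarith, by linarith⟩
  have preserving : MeasurePreserving (fun y => x - σ * y) := by
    rcases eq_or_eq_neg_of_abs_eq hσ with rfl | rfl
    · simpa using Measure.measurePreserving_sub_left volume x
    · simpa using measurePreserving_add_left volume x
  have length_eq : |x - σ * r - x| = r := by
    rw [sub_sub_cancel_left, abs_neg, abs_mul, hσ, one_mul, abs_of_pos hr]
  calc ∫⁻ y in Ioo 0 r, ‖f (x - σ * y)‖ₑ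
      ≤ ∫⁻ y in (fun y => x - σ * y) ⁻¹' uIcc x (x - σ * r), ‖f (x - σ * y)‖ₑ :=
        lintegral_mono_set mapsTo
    _ = ∫⁻ t in uIcc x (x - σ * r), ‖f t‖ₑ :=
        preserving.setLIntegral_comp_preimage measurableSet_uIcc hf.enorm
    _ ≤ ENNReal.ofReal |x - σ * r - x| * maximalFunction f x := by
        refine lintegral_uIcc_le_maximalFunction f (fun h => hr.ne' ?_) left_mem_uIcc
        rw [← length_eq, ← h, sub_self, abs_zero]
    _ = ENNReal.ofReal r * maximalFunction f x := by rw [length_eq]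

theorem lexpAverage_le_maximalFunction {f : ℝ → ℂ} (hf : Measurable f) {σ : ℝ} (hσ : |σ| = 1)
    (x : ℝ) : lexpAverage σ (fun x => ‖f x‖ₑ) x ≤ maximalFunction f x := by
  calc lexpAverage σ (fun x => ‖f x‖ₑ) x
      = ∫⁻ r, (∫⁻ y in Ioo 0 r, ‖f (x - σ * y)‖ₑ) ∂expLaw :=
        lintegral_expLaw_eq_lintegral_Ioo (by fun_prop)
    _ ≤ ∫⁻ r, ENNReal.ofReal r * maximalFunction f x ∂expLaw := by
        refine lintegral_mono fun r => ?_
        rcases le_or_gt r 0 with hr | hr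
        · simp [Ioo_eq_empty_of_le hr]
        · exact lintegral_Ioo_sub_mul_le_maximalFunction hf hσ x hr
    _ = maximalFunction f x := by
        rw [lintegral_mul_const _ ENNReal.measurable_ofReal, lintegral_ofReal_expLaw, one_mul]

theorem FunctionNorm.AveragingBounded.of_mem_space {ρ : FunctionNorm volume} {σ : ℝ} (C : ℝ≥0)
    (h : ∀ f ∈ ρ.space, ρ.toFun (lexpAverage σ fun x => ‖f x‖ₑ) ≤ C * ρ.eval f) :
    ρ.AveragingBounded σ := by
  refine ⟨C + 1, fun f => ?_⟩
  rcases eq_or_ne (ρ.eval f) ∞ with hf | hf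
  · simp [hf, ENNReal.mul_top]
  · refine (h f (lt_top_iff_ne_top.2 hf)).trans ?_
    gcongr
    exact le_self_add

theorem IsVariableExponent.nontrivial_half {p : ℝ → ℝ} (h : IsVariableExponent p) :
    Nontrivial (variableLebesgue h).half.space := by
  refine (h.isYoungIntegrand Measure.absolutelyContinuous_restrict).nontrivial_space (t := 1)
    measurableSet_Ioo (halfVolume_Ioo_zero_one.trans_ne one_ne_zero) one_pos ?_
  simp only [ENNReal.coe_one, ENNReal.one_rpow, setLIntegral_one, halfVolume_Ioo_zero_one,
    ENNReal.one_lt_top]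

theorem IsVariableExponent.lintegral_rpow_div_lt_top {p : ℝ → ℝ} (h : IsVariableExponent p)
    {P : ℝ} (hP : ∀ᵐ x, p x ≤ P) (f : (variableLebesgue h).half.space) {e : ℝ≥0} (he : 0 < e) :
    ∫⁻ x, (‖f.1 x‖ₑ / e) ^ p x ∂halfVolume < ∞ := by
  obtain ⟨s, hs, hfin⟩ :=
    ((h.isYoungIntegrand Measure.absolutelyContinuous_restrict).mem_space_iff f.1).1 f.2
  set K : ℝ≥0 := max (s / e) 1
  have rescale (x : ℝ) (hx : p x ≤ P) :
      (‖f.1 x‖ₑ / e) ^ p x ≤ (K ^ P : ℝ≥0) * (‖f.1 x‖ₑ / s) ^ p x := by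
    have hp : 0 ≤ p x := zero_le_one.trans (h.one_le x)
    calc (‖f.1 x‖ₑ / e) ^ p x = ((s / e : ℝ≥0) * (‖f.1 x‖ₑ / s)) ^ p x := by
          rw [ENNReal.coe_div he.ne', ← ENNReal.mul_div_right_comm,
            ENNReal.mul_div_cancel (ENNReal.coe_ne_zero.2 hs.ne') ENNReal.coe_ne_top]
      _ ≤ (K * (‖f.1 x‖ₑ / s)) ^ p x := by
          gcongr
          exact le_max_left _ _
      _ = (K : ℝ≥0∞) ^ p x * (‖f.1 x‖ₑ / s) ^ p x := ENNReal.mul_rpow_of_nonneg _ _ hp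
      _ ≤ (K : ℝ≥0∞) ^ P * (‖f.1 x‖ₑ / s) ^ p x := by
          gcongr
          exact ENNReal.one_le_coe_iff.2 (le_max_right _ _)
      _ = (K ^ P : ℝ≥0) * (‖f.1 x‖ₑ / s) ^ p x := by
          rw [ENNReal.coe_rpow_of_nonneg _ (hp.trans hx)]
  calc ∫⁻ x, (‖f.1 x‖ₑ / e) ^ p x ∂halfVolume
      ≤ ∫⁻ x, (K ^ P : ℝ≥0) * (‖f.1 x‖ₑ / s) ^ p x ∂halfVolume :=
        lintegral_mono_ae ((ae_restrict_of_ae hP).mono rescale)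
    _ = (K ^ P : ℝ≥0) * ∫⁻ x, (‖f.1 x‖ₑ / s) ^ p x ∂halfVolume :=
        lintegral_const_mul' _ _ ENNReal.coe_ne_top
    _ < ∞ := ENNReal.mul_lt_top ENNReal.coe_lt_top hfin

theorem IsVariableExponent.denseL2 {p : ℝ → ℝ} (h : IsVariableExponent p) {P : ℝ}
    (hP : ∀ᵐ x, p x ≤ P) : DenseL2 (variableLebesgue h) := by
  refine denseL2_of_tendsto fun f => ?_
  change Tendsto (fun n => luxemburg halfVolume (fun x s => s ^ p x)
    ((tailSet f.1 n).indicator fun x => ‖f.1 x‖ₑ)) atTop (𝓝 0)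
  refine ENNReal.tendsto_nhds_zero.2 fun ε hε => ?_
  obtain ⟨e, he, heε⟩ := ENNReal.lt_iff_exists_nnreal_btwn.1 hε
  have he' : 0 < e := ENNReal.coe_pos.1 he
  have modular_meas : AEMeasurable (fun x => (‖f.1 x‖ₑ / e) ^ p x) halfVolume :=
    (f.1.stronglyMeasurable.enorm.div_const _).aemeasurable.pow
      (h.aemeasurable.mono_ac Measure.absolutelyContinuous_restrict)
  have modular_tail (n : ℕ) :
      ∫⁻ x, ((tailSet f.1 n).indicator (fun x => ‖f.1 x‖ₑ) x / e) ^ p x ∂halfVolume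
        = ∫⁻ x in tailSet f.1 n, (‖f.1 x‖ₑ / e) ^ p x ∂halfVolume := by
    rw [← lintegral_indicator (measurableSet_tailSet f.1 n)]
    refine lintegral_congr fun x => ?_
    by_cases hx : x ∈ tailSet f.1 n
    · simp only [indicator_of_mem hx]
    · simp only [indicator_of_notMem hx, ENNReal.zero_div,
        ENNReal.zero_rpow_of_pos (zero_lt_one.trans_le (h.one_le x))]
  have tail := tendsto_setLIntegral_tailSet f.1 modular_meas
    (h.lintegral_rpow_div_lt_top hP f he').ne
  filter_upwards [tail.eventually (ge_mem_nhds one_pos)] with n hn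
  exact (luxemburg_le he' ((modular_tail n).trans_le hn)).trans heε.le

namespace IsMaximalExponent

variable {p : ℝ → ℝ}

theorem averagingBounded (h : IsMaximalExponent p) {σ : ℝ} (hσ : |σ| = 1) :
    (variableLebesgue h.toIsVariableExponent).line.AveragingBounded σ := by
  obtain ⟨C, hC⟩ := h.maximal_bounded
  exact .of_mem_space C fun f hf => (FunctionNorm.mono _ <| Eventually.of_forall fun x =>
    lexpAverage_le_maximalFunction f.stronglyMeasurable.measurable hσ x).trans (hC f hf)

theorem isAveragingPair (h : IsMaximalExponent p) :
    (variableLebesgue h.toIsVariableExponent).IsAveragingPair where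
  averagingBounded_one := h.averagingBounded abs_one
  averagingBounded_neg_one := h.averagingBounded (by simp)
  denseL2 := h.sup_lt_top.elim fun _ hP => h.toIsVariableExponent.denseL2 hP
  nontrivial := h.toIsVariableExponent.nontrivial_half

end IsMaximalExponent

/-! ### Lorentz spaces -/

theorem lexpAverage_tsub_le (σ : ℝ) (g : ℝ → ℝ≥0∞) (l : ℝ≥0∞) (x : ℝ) :
    lexpAverage σ g x - l ≤ lexpAverage σ (fun x => g x - l) x := by
  simpa [lexpAverage] using
    lintegral_sub_le (μ := expLaw) (fun _ => l) (fun y => g (x - σ * y)) measurable_const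

theorem rearrangementAverage_lexpAverage_le (σ : ℝ) {g : ℝ → ℝ≥0∞} (hg : Measurable g) {t : ℝ}
    (ht : 0 < t) :
    rearrangementAverage volume (lexpAverage σ g) t ≤ rearrangementAverage volume g t := by
  refine ENNReal.div_le_div_right ?_ _
  -- `∫₀ᵗ g*` is the minimum over `l` of `∫ (g - l)₊ + t l`, which averages do not increase
  obtain ⟨l, hl⟩ := exists_lintegral_Ioo_rearrangement hg.aemeasurable (μ := volume) ht
  calc ∫⁻ s in Ioo 0 t, rearrangement volume (lexpAverage σ g) s
      ≤ (∫⁻ x, lexpAverage σ g x - l) + ENNReal.ofReal t * l :=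
        lintegral_Ioo_rearrangement_le (measurable_lexpAverage σ hg).aemeasurable t l
    _ ≤ (∫⁻ x, lexpAverage σ (fun x => g x - l) x) + ENNReal.ofReal t * l := by
        gcongr with x
        exact lexpAverage_tsub_le σ g l x
    _ = (∫⁻ x, g x - l) + ENNReal.ofReal t * l := by
        rw [lintegral_lexpAverage σ (hg.sub_const l)]
    _ ≤ ∫⁻ s in Ioo 0 t, rearrangement volume g s := hl

theorem averagingBounded_lorentz {p q : ℝ} (hq : 1 < q) (σ : ℝ) :
    (lorentz p q hq).line.AveragingBounded σ := by
  refine ⟨1, fun f => ?_⟩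
  rw [ENNReal.coe_one, one_mul]
  exact lorentzFun_mono_of_average (zero_le_one.trans hq.le) fun t ht =>
    rearrangementAverage_lexpAverage_le σ f.stronglyMeasurable.enorm ht

section LorentzIntegrand

variable {μ : Measure ℝ} {p q : ℝ} {g : ℝ → ℝ≥0∞}

/-- The integrand `(t^{1/p} g**(t))^q / t` of the Lorentz norm. -/
def lorentzIntegrand (μ : Measure ℝ) (p q : ℝ) (g : ℝ → ℝ≥0∞) (t : ℝ) : ℝ≥0∞ :=
  (ENNReal.ofReal (t ^ (1 / p)) * rearrangementAverage μ g t) ^ q / ENNReal.ofReal t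

theorem measurable_lorentzIntegrand : Measurable (lorentzIntegrand μ p q g) :=
  (((ENNReal.measurable_ofReal.comp (by fun_prop)).mul
    (measurable_rearrangementAverage μ g)).pow_const q).div ENNReal.measurable_ofReal

theorem lorentzIntegrand_mono (hq : 0 ≤ q) {h : ℝ → ℝ≥0∞} (hgh : ∀ x, g x ≤ h x) (t : ℝ) :
    lorentzIntegrand μ p q g t ≤ lorentzIntegrand μ p q h t := by
  refine ENNReal.div_le_div_right (ENNReal.rpow_le_rpow ?_ hq) _
  gcongr
  exact ENNReal.div_le_div_right (lintegral_mono fun s =>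
    rearrangement_mono (Eventually.of_forall hgh) s) _

theorem lorentzFun_lt_top_iff (hq : 0 < q) :
    lorentzFun μ p q g < ∞ ↔ ∫⁻ t in Ioi 0, lorentzIntegrand μ p q g t < ∞ :=
  ENNReal.rpow_lt_top_iff_of_pos (one_div_pos.2 hq)

theorem rearrangementAverage_le_of_ae_le {l : ℝ≥0∞} (hl : ∀ᵐ x ∂μ, g x ≤ l) (t : ℝ) :
    rearrangementAverage μ g t ≤ l := by
  have rearrangement_le (s : ℝ) : rearrangement μ g s ≤ l := by
    refine rearrangement_le_iff.2 (le_of_eq_of_le ?_ zero_le)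
    simpa [distribution, ae_iff] using hl
  refine ENNReal.div_le_of_le_mul ?_
  calc ∫⁻ s in Ioo 0 t, rearrangement μ g s ≤ ∫⁻ _ in Ioo 0 t, l := lintegral_mono rearrangement_le
    _ = l * ENNReal.ofReal t := by simp

theorem rearrangementAverage_le_lintegral_div [SFinite μ] (hg : AEMeasurable g μ) (t : ℝ) :
    rearrangementAverage μ g t ≤ (∫⁻ x, g x ∂μ) / ENNReal.ofReal t :=
  ENNReal.div_le_div_right
    ((lintegral_mono_set Ioo_subset_Ioi_self).trans_eq (lintegral_rearrangement hg)) _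

theorem lorentzIntegrand_le_of_average_le (hq : 0 ≤ q) {t : ℝ} (ht : 0 < t) {c : ℝ≥0∞} {r : ℝ}
    (h : rearrangementAverage μ g t ≤ c * ENNReal.ofReal (t ^ r)) :
    lorentzIntegrand μ p q g t ≤ c ^ q * ENNReal.ofReal (t ^ ((1 / p + r) * q - 1)) := by
  calc lorentzIntegrand μ p q g t
      ≤ (ENNReal.ofReal (t ^ (1 / p)) * (c * ENNReal.ofReal (t ^ r))) ^ q / ENNReal.ofReal t := by
        rw [lorentzIntegrand]
        gcongr
    _ = (c * ENNReal.ofReal (t ^ (1 / p + r))) ^ q / ENNReal.ofReal t := by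
        rw [mul_left_comm, ← ENNReal.ofReal_mul (by positivity), ← Real.rpow_add ht]
    _ = c ^ q * ENNReal.ofReal (t ^ ((1 / p + r) * q - 1)) := by
        rw [ENNReal.mul_rpow_of_nonneg _ _ hq, ENNReal.ofReal_rpow_of_nonneg (by positivity) hq,
          mul_div_assoc, ← Real.rpow_mul ht.le, ← ENNReal.ofReal_div_of_pos ht,
          ← Real.rpow_sub_one ht.ne']

theorem lintegral_Ioc_lorentzIntegrand_lt_top (hp : 0 < p) (hq : 0 < q) {l : ℝ≥0∞} (hl : l ≠ ∞)
    (hgl : ∀ᵐ x ∂μ, g x ≤ l) : ∫⁻ t in Ioc 0 1, lorentzIntegrand μ p q g t < ∞ := by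
  have integrable_rpow : IntegrableOn (fun t : ℝ => t ^ ((1 / p + 0) * q - 1)) (Ioc 0 1) := by
    rw [← intervalIntegrable_iff_integrableOn_Ioc_of_le zero_le_one]
    refine intervalIntegral.intervalIntegrable_rpow' ?_
    have : 0 < (1 / p + 0) * q := by positivity
    linarith
  calc ∫⁻ t in Ioc 0 1, lorentzIntegrand μ p q g t
      ≤ ∫⁻ t in Ioc 0 1, l ^ q * ENNReal.ofReal (t ^ ((1 / p + 0) * q - 1)) := by
        refine setLIntegral_mono' measurableSet_Ioc fun t ht => ?_
        refine lorentzIntegrand_le_of_average_le hq.le ht.1 ?_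
        simpa using rearrangementAverage_le_of_ae_le hgl t
    _ = l ^ q * ∫⁻ t in Ioc 0 1, ENNReal.ofReal (t ^ ((1 / p + 0) * q - 1)) :=
        lintegral_const_mul _ (by fun_prop)
    _ < ∞ := ENNReal.mul_lt_top (ENNReal.rpow_lt_top_of_nonneg hq.le hl)
        integrable_rpow.lintegral_lt_top

theorem lintegral_Ioi_lorentzIntegrand_lt_top [SFinite μ] (hp : 1 < p) (hq : 0 < q)
    (hg : AEMeasurable g μ) (hint : ∫⁻ x, g x ∂μ ≠ ∞) :
    ∫⁻ t in Ioi 1, lorentzIntegrand μ p q g t < ∞ := by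
  have integrable_rpow : IntegrableOn (fun t : ℝ => t ^ ((1 / p + -1) * q - 1)) (Ioi 1) := by
    refine integrableOn_Ioi_rpow_of_lt ?_ one_pos
    have : 1 / p < 1 := (div_lt_one (one_pos.trans hp)).2 hp
    nlinarith
  calc ∫⁻ t in Ioi 1, lorentzIntegrand μ p q g t
      ≤ ∫⁻ t in Ioi 1,
          (∫⁻ x, g x ∂μ) ^ q * ENNReal.ofReal (t ^ ((1 / p + -1) * q - 1)) := by
        refine setLIntegral_mono' measurableSet_Ioi fun t ht => ?_
        have ht0 : 0 < t := one_pos.trans ht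
        refine lorentzIntegrand_le_of_average_le hq.le ht0 ?_
        rw [Real.rpow_neg_one, ENNReal.ofReal_inv_of_pos ht0, ← div_eq_mul_inv]
        exact rearrangementAverage_le_lintegral_div hg t
    _ = (∫⁻ x, g x ∂μ) ^ q * ∫⁻ t in Ioi 1, ENNReal.ofReal (t ^ ((1 / p + -1) * q - 1)) :=
        lintegral_const_mul _ (by fun_prop)
    _ < ∞ := ENNReal.mul_lt_top (ENNReal.rpow_lt_top_of_nonneg hq.le hint)
        integrable_rpow.lintegral_lt_top

theorem lorentzFun_lt_top_of_bounded [SFinite μ] (hp : 1 < p) (hq : 0 < q)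
    (hg : AEMeasurable g μ) {l : ℝ≥0∞} (hl : l ≠ ∞) (hgl : ∀ᵐ x ∂μ, g x ≤ l)
    (hint : ∫⁻ x, g x ∂μ ≠ ∞) : lorentzFun μ p q g < ∞ := by
  rw [lorentzFun_lt_top_iff hq, ← Ioc_union_Ioi_eq_Ioi zero_le_one]
  exact (lintegral_union_le _ _ _).trans_lt (ENNReal.add_lt_top.2
    ⟨lintegral_Ioc_lorentzIntegrand_lt_top (one_pos.trans hp) hq hl hgl,
      lintegral_Ioi_lorentzIntegrand_lt_top hp hq hg hint⟩)

theorem lintegral_Ioi_inv_eq_top : ∫⁻ t in Ioi (1 : ℝ), (ENNReal.ofReal t)⁻¹ = ∞ := by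
  by_contra hne
  refine not_integrableOn_Ioi_inv (a := 1) ⟨by fun_prop, ?_⟩
  refine lt_of_eq_of_lt (setLIntegral_congr_fun measurableSet_Ioi fun t ht => ?_)
    (lt_top_iff_ne_top.2 hne)
  have ht0 : 0 < t := one_pos.trans ht
  rw [← ENNReal.ofReal_inv_of_pos ht0, Real.enorm_eq_ofReal (inv_nonneg.2 ht0.le)]

theorem le_rearrangement_of_distribution_eq_top {l : ℝ≥0∞} (h : distribution μ g l = ∞) (t : ℝ) :
    l ≤ rearrangement μ g t := by
  by_contra! hlt
  have := rearrangement_le_iff.1 hlt.le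
  simp [h] at this

theorem le_rearrangementAverage_of_distribution_eq_top {l : ℝ≥0∞} (h : distribution μ g l = ∞)
    {t : ℝ} (ht : 0 < t) : l ≤ rearrangementAverage μ g t := by
  rw [rearrangementAverage, ENNReal.le_div_iff_mul_le (Or.inl (by simpa using ht))
    (Or.inl ENNReal.ofReal_ne_top)]
  calc l * ENNReal.ofReal t = ∫⁻ _ in Ioo 0 t, l := by
        rw [setLIntegral_const, Real.volume_Ioo, sub_zero]
    _ ≤ ∫⁻ s in Ioo 0 t, rearrangement μ g s :=
        lintegral_mono (le_rearrangement_of_distribution_eq_top h)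

theorem distribution_lt_top_of_lorentzFun_lt_top (hp : 0 < p) (hq : 0 < q)
    (hfin : lorentzFun μ p q g < ∞) {l : ℝ≥0∞} (hl : 0 < l) : distribution μ g l < ∞ := by
  by_contra! htop
  refine ((lorentzFun_lt_top_iff hq).1 hfin).ne (top_unique ?_)
  calc ∞ = l ^ q * ∫⁻ t in Ioi (1 : ℝ), (ENNReal.ofReal t)⁻¹ := by
        rw [lintegral_Ioi_inv_eq_top, ENNReal.mul_top (ENNReal.rpow_pos_of_nonneg hl hq.le).ne']
    _ = ∫⁻ t in Ioi (1 : ℝ), l ^ q / ENNReal.ofReal t :=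
        (lintegral_const_mul _ (by fun_prop)).symm
    _ ≤ ∫⁻ t in Ioi 1, lorentzIntegrand μ p q g t := by
        refine setLIntegral_mono' measurableSet_Ioi fun t (ht : 1 < t) => ?_
        have one_le_weight : 1 ≤ ENNReal.ofReal (t ^ (1 / p)) :=
          ENNReal.one_le_ofReal.2 (Real.one_le_rpow ht.le (by positivity))
        have le_average : l ≤ rearrangementAverage μ g t :=
          le_rearrangementAverage_of_distribution_eq_top (top_unique htop) (one_pos.trans ht)
        rw [lorentzIntegrand]
        gcongr
        exact le_mul_of_one_le_of_le one_le_weight le_average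
    _ ≤ ∫⁻ t in Ioi 0, lorentzIntegrand μ p q g t :=
        lintegral_mono_set (Ioi_subset_Ioi zero_le_one)

theorem rearrangementAverage_ne_top_of_lorentzIntegrand_lt_top (hq : 0 < q) {t : ℝ} (ht : 0 < t)
    (h : lorentzIntegrand μ p q g t < ∞) : rearrangementAverage μ g t ≠ ∞ := by
  intro htop
  have weight_ne_zero : ENNReal.ofReal (t ^ (1 / p)) ≠ 0 :=
    (ENNReal.ofReal_pos.2 (Real.rpow_pos_of_pos ht _)).ne'
  refine h.ne ?_
  rw [lorentzIntegrand, htop, ENNReal.mul_top weight_ne_zero, ENNReal.top_rpow_of_pos hq,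
    ENNReal.top_div_of_ne_top ENNReal.ofReal_ne_top]

theorem lintegral_rearrangement_ne_top_of_lorentzIntegrand_lt_top (hq : 0 < q) {t : ℝ}
    (ht : 0 < t) (h : lorentzIntegrand μ p q g t < ∞) :
    ∫⁻ s in Ioo 0 t, rearrangement μ g s ≠ ∞ := fun htop =>
  rearrangementAverage_ne_top_of_lorentzIntegrand_lt_top hq ht h <| by
    rw [rearrangementAverage, htop, ENNReal.top_div_of_ne_top ENNReal.ofReal_ne_top]

end LorentzIntegrand

section Tails

variable (f : ℝ →ₘ[halfVolume] ℂ)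

theorem tendsto_rearrangement_tailSet
    (hfin : ∀ l : ℝ≥0∞, 0 < l → distribution halfVolume (fun x => ‖f x‖ₑ) l < ∞) {t : ℝ}
    (ht : 0 < t) :
    Tendsto (fun n => rearrangement halfVolume ((tailSet f n).indicator fun x => ‖f x‖ₑ) t)
      atTop (𝓝 0) := by
  refine ENNReal.tendsto_nhds_zero.2 fun ε hε => ?_
  set S : Set ℝ := {x | ε < ‖f x‖ₑ}
  have measurableSet_S : MeasurableSet S :=
    measurableSet_lt measurable_const f.stronglyMeasurable.enorm
  have tendsto_measure : Tendsto (fun n => halfVolume (S ∩ tailSet f n)) atTop (𝓝 0) := by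
    simpa [lintegral_indicator_one measurableSet_S, Measure.restrict_apply measurableSet_S] using
      tendsto_setLIntegral_tailSet f (μ := halfVolume) (G := S.indicator 1)
        (measurable_one.indicator measurableSet_S).aemeasurable
        ((lintegral_indicator_one measurableSet_S).trans_lt (hfin ε hε)).ne
  filter_upwards [tendsto_measure.eventually (ge_mem_nhds (ENNReal.ofReal_pos.2 ht))] with n hn
  refine rearrangement_le_iff.2 ((measure_mono fun x hx => ?_).trans hn)
  have hxn : x ∈ tailSet f n := by
    by_contra hxn
    simp [hxn] at hx
  exact ⟨show ε < ‖f x‖ₑ by simpa [hxn] using hx, hxn⟩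

theorem tendsto_lorentzIntegrand_tailSet {p q : ℝ} (hq : 0 < q)
    (hfin : ∀ l : ℝ≥0∞, 0 < l → distribution halfVolume (fun x => ‖f x‖ₑ) l < ∞) {t : ℝ}
    (ht : 0 < t) (hft : ∫⁻ s in Ioo 0 t, rearrangement halfVolume (fun x => ‖f x‖ₑ) s ≠ ∞) :
    Tendsto (fun n => lorentzIntegrand halfVolume p q ((tailSet f n).indicator fun x => ‖f x‖ₑ) t)
      atTop (𝓝 0) := by
  have integral_tendsto : Tendsto (fun n => ∫⁻ s in Ioo 0 t,
      rearrangement halfVolume ((tailSet f n).indicator fun x => ‖f x‖ₑ) s) atTop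
      (𝓝 (∫⁻ _ in Ioo 0 t, 0)) := by
    refine tendsto_lintegral_of_dominated_convergence _
      (fun n => (rearrangement_antitone _ _).measurable)
      (fun n => Eventually.of_forall fun s => rearrangement_mono
        (Eventually.of_forall (indicator_le_self _ _)) s) hft ?_
    filter_upwards [ae_restrict_mem measurableSet_Ioo] with s hs
    exact tendsto_rearrangement_tailSet f hfin hs.1
  have ht0 : ENNReal.ofReal t ≠ 0 := (ENNReal.ofReal_pos.2 ht).ne'
  have average_tendsto := ENNReal.Tendsto.div_const integral_tendsto (Or.inr ht0)
  have integrand_tendsto := ENNReal.Tendsto.div_const ((ENNReal.Tendsto.const_mul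
    average_tendsto (Or.inr (ENNReal.ofReal_ne_top (r := t ^ (1 / p))))).ennrpow_const q)
    (Or.inr ht0)
  simpa [lorentzIntegrand, rearrangementAverage, hq] using integrand_tendsto

end Tails

section LorentzPair

variable {p q : ℝ}

theorem denseL2_lorentz (hp : 1 < p) (hq : 1 < q) : DenseL2 (lorentz p q hq) := by
  have hq0 : 0 < q := one_pos.trans hq
  refine denseL2_of_tendsto fun f => ?_
  change Tendsto (fun n => (∫⁻ t in Ioi 0, lorentzIntegrand halfVolume p q
    ((tailSet f.1 n).indicator fun x => ‖f.1 x‖ₑ) t) ^ (1 / q)) atTop (𝓝 0)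
  have norm_lt_top : lorentzFun halfVolume p q (fun x => ‖f.1 x‖ₑ) < ∞ := f.2
  have integral_lt_top := (lorentzFun_lt_top_iff hq0).1 norm_lt_top
  have integral_tendsto : Tendsto (fun n => ∫⁻ t in Ioi 0, lorentzIntegrand halfVolume p q
      ((tailSet f.1 n).indicator fun x => ‖f.1 x‖ₑ) t) atTop (𝓝 (∫⁻ _ in Ioi (0 : ℝ), 0)) := by
    refine tendsto_lintegral_of_dominated_convergence _ (fun n => measurable_lorentzIntegrand)
      (fun n => Eventually.of_forall fun t =>
        lorentzIntegrand_mono hq0.le (indicator_le_self _ _) t) integral_lt_top.ne ?_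
    filter_upwards [ae_lt_top measurable_lorentzIntegrand integral_lt_top.ne,
      ae_restrict_mem measurableSet_Ioi] with t hft ht
    exact tendsto_lorentzIntegrand_tailSet f.1 hq0
      (fun l hl => distribution_lt_top_of_lorentzFun_lt_top (one_pos.trans hp) hq0 norm_lt_top hl)
      ht (lintegral_rearrangement_ne_top_of_lorentzIntegrand_lt_top hq0 ht hft)
  simpa [hq0] using integral_tendsto.ennrpow_const (1 / q)

theorem nontrivial_half_lorentz (hp : 1 < p) (hq : 1 < q) :
    Nontrivial (lorentz p q hq).half.space := by
  refine FunctionNorm.nontrivial_space _ (measurableSet_Ioo (a := 0) (b := 1))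
    (halfVolume_Ioo_zero_one.trans_ne one_ne_zero) fun f hf => ?_
  have norm_le_one : ∀ᵐ x ∂halfVolume, ‖f x‖ₑ ≤ 1 := by
    filter_upwards [hf] with x hx
    exact hx.trans_le (indicator_le_self _ _ x)
  have integral_eq_one : ∫⁻ x, ‖f x‖ₑ ∂halfVolume = 1 := by
    rw [lintegral_congr_ae hf, lintegral_indicator_one measurableSet_Ioo, halfVolume_Ioo_zero_one]
  exact lorentzFun_lt_top_of_bounded hp (one_pos.trans hq)
    f.stronglyMeasurable.enorm.aemeasurable ENNReal.one_ne_top norm_le_one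
    (integral_eq_one.trans_ne ENNReal.one_ne_top)

theorem isAveragingPair_lorentz (hp : 1 < p) (hq : 1 < q) : (lorentz p q hq).IsAveragingPair where
  averagingBounded_one := averagingBounded_lorentz hq 1
  averagingBounded_neg_one := averagingBounded_lorentz hq (-1)
  denseL2 := denseL2_lorentz hp hq
  nontrivial := nontrivial_half_lorentz hp hq

end LorentzPair

theorem IsAdmissible.isAveragingPair {X : SpacePair} (hX : IsAdmissible X) :
    X.IsAveragingPair := by
  cases hX with
  | lorentz p q hp hq => exact isAveragingPair_lorentz hp hq
  | orlicz φ hφ hrefl => exact hφ.isAveragingPair hrefl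
  | variableLebesgue p hp => exact hp.isAveragingPair

end WienerHopf

end

open WienerHopf in
theorem mainTheorem9_general (X : SpacePair) (hX : X.IsAveragingPair) (n : ℤ) :
    IsFourierMultiplier X (rSymbol n) ∧ (wienerHopf X (rSymbol n)).IsFredholm ∧
      fredholmIndex (wienerHopf X (rSymbol n)) = -n := by
  set hp := hX.averagingBounded_one
  set hm := hX.averagingBounded_neg_one
  have left_inv (m : ℕ) : compression hm.reflection ^ m * compression hp.reflection ^ m = 1 :=
    pow_mul_pow_eq_one m hX.compression_neg_one_mul_compression_one
  have := hX.finiteDimensional_ker_compression_pow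
  obtain ⟨m, rfl | rfl⟩ := n.eq_nat_or_neg
  · have extends_pow := hp.extendsConvolution_rSymbol_natCast m
    rw [wienerHopf_eq_compression hX.denseL2 (memLp_rSymbol m) extends_pow,
      (hp.isCausal_reflection zero_le_one).compression_pow]
    refine ⟨⟨memLp_rSymbol m, _, extends_pow⟩, isFredholm_of_leftInverse (left_inv m), ?_⟩
    rw [fredholmIndex_of_leftInverse (left_inv m), hX.finrank_ker_compression_pow]
  · have extends_pow := hm.extendsConvolution_rSymbol_neg_natCast m
    rw [wienerHopf_eq_compression hX.denseL2 (memLp_rSymbol (-m)) extends_pow,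
      (hm.isAnticausal_reflection (by norm_num)).compression_pow]
    refine ⟨⟨memLp_rSymbol (-m), _, extends_pow⟩, isFredholm_of_rightInverse (left_inv m), ?_⟩
    rw [fredholmIndex_of_rightInverse (left_inv m), hX.finrank_ker_compression_pow, neg_neg]

theorem mainTheorem9 (X : WienerHopf.SpacePair) (hX : WienerHopf.IsAdmissible X) (n : ℤ) :
    WienerHopf.IsFourierMultiplier X (WienerHopf.rSymbol n) ∧
      (WienerHopf.wienerHopf X (WienerHopf.rSymbol n)).IsFredholm ∧
      WienerHopf.fredholmIndex (WienerHopf.wienerHopf X (WienerHopf.rSymbol n)) = -n := by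
  exact mainTheorem9_general X hX.isAveragingPair n
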